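/- Let $n\ge 2$ and let $W_{\mathrm{af}}$ be the affine symmetric group, i.e. the group of permutations of $\mathbb Z$ generated by the simple reflections $s_i$ ($i\in\mathbb Z/n\mathbb Z$), where $s_i$ exchanges $k$ and $k+1$ for all $k\equiv i \pmod n$ and fixes the other integers. Let $\ell$ be the length function with respect to the $s_i$, let $\lessdot$ denote covers in the Bruhat order, and for $i\not\equiv j \pmod n$ let $t_{ij}$ exchange $i+kn$ and $j+kn$ for all $k\in\mathbb Z$ and fix the other integers. Put $\rho_i=s_{i-1}\cdots s_1s_0$ for $i\ge 0$ (indices modulo $n$, $\rho_0=1$). Strong strips. A marked strong cover $u\overset{a}{\longrightarrow}v$ consists of $u,v\in W_{\mathrm{af}}$ and $a\in\mathbb Z$ such that $v\lessdot u$ and, for some $i\le 0<j$ with $i\not\equiv j \pmod n$, $u=vt_{ij}$ and $a=u(j)=v(i)$. A strong strip of length $i$ from $w$ to $u$ is a path $w\overset{a_1}{\longrightarrow}u_1\overset{a_2}{\longrightarrow}\cdots\overset{a_i}{\longrightarrow}u_i=u$ of marked strong covers with $a_1>a_2>\cdots>a_i$. Coproduct. Let $P=\mathbb Z^n/\mathbb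 Z(1,\dots,1)$ be the weight lattice of $SL_n$, with coordinates indexed by $\mathbb Z/n\mathbb Z$, on which $w\in W_{\mathrm{af}}$ acts by $e_r\mapsto e_{w(r)}$ (level zero action); let $\alpha_i=e_i-e_{i+1}$, $S=\mathrm{Sym}(P)$, $F=\mathrm{Frac}(S)$, and let $F_{W_{\mathrm{af}}}=\bigoplus_{w} Fw$ with product $(pv)(qw)=p\,(v\cdot q)\,vw$. Let $A_i=\alpha_i^{-1}(1-s_i)$, let $A_w=A_{i_1}\cdots A_{i_l}$ for a reduced word $w=s_{i_1}\cdots s_{i_l}$, and let $\mathbb A_0$ be the subring of $F_{W_{\mathrm{af}}}$ generated by the $A_i$. Let $\Delta:F_{W_{\mathrm{af}}}\to F_{W_{\mathrm{af}}}\otimes_F F_{W_{\mathrm{af}}}$ be the left $F$-linear map with $\Delta(w)=w\otimes w$. The structure constants $p^w_{u,v}\in S$ are the coefficients in the finite expansion $\Delta(A_w)=\sum_{u,v}p^w_{u,v}\,A_u\otimes A_v$; this expansion, with coefficients in $S$, exists and is unique. Theorem. There are only finitely many strong strips of given length starting at a given $w\in W_{\mathrm{af}}$. For $w,u\in W_{\mathrm{af}}$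 with $i=\ell(w)-\ell(u)\ge 0$, the structure constant $p^w_{\rho_i,u}$ equals the number of strong strips (necessarily of length $i$) from $w$ to $u$. Equivalently, for every $i\ge 0$, the cap operator $D_{\rho_i}$ and the Pieri operator $D'_i$, i.e. the unique $\mathbb Z$-linear maps $\mathbb A_0\to\mathbb A_0$ with $$D_{\rho_i}(A_w)=\sum_{\ell(v)=\ell(w)-\ell(\rho_i)}p^w_{\rho_i,v}\,A_v,\qquad D'_i(A_w)=\sum_{w\to_{(i)}u}A_u \quad (w\in W_{\mathrm{af}}),$$ the second sum being over all strong strips of length $i$ starting at $w$, exist and are equal; here the $p^w_{\rho_i,v}$ in the first sum are integers. -/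

import Mathlib

open scoped TensorProduct

noncomputable section

namespace AffinePieri

/-! ### The affine symmetric group -/

theorem zmod_succ_ne {n : ℕ} [n.AtLeastTwo] (i : ZMod n) : i + 1 ≠ i := by
  have : Fact (1 < n) := ⟨Nat.AtLeastTwo.prop⟩
  simp

/-- The underlying function of `simplePerm`: it exchanges `k` and `k + 1` for all `k ≡ i` modulo
`n`, and fixes all other integers. -/
def simpleFun (n : ℕ) (i : ZMod n) (k : ℤ) : ℤ :=
  if (k : ZMod n) = i then k + 1 else if (k : ZMod n) = i + 1 then k - 1 else k

theorem simpleFun_involutive (n : ℕ) [n.AtLeastTwo] (i : ZMod n) :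
    Function.Involutive (simpleFun n i) := by
  intro k
  have h := zmod_succ_ne i
  unfold simpleFun
  split_ifs <;> simp_all

/-- The simple reflection `s_i` as a permutation of `ℤ`. -/
def simplePerm (n : ℕ) [n.AtLeastTwo] (i : ZMod n) : Equiv.Perm ℤ :=
  (simpleFun_involutive n i).toPerm

/-- The affine symmetric group, realised as the group of permutations of `ℤ` generated by the
simple reflections `s_i`, `i ∈ ℤ/nℤ`. -/
def affineSymmetricGroup (n : ℕ) [n.AtLeastTwo] : Subgroup (Equiv.Perm ℤ) :=
  Subgroup.closure (Set.range (simplePerm n))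

/-- The type of elements of the affine symmetric group. -/
abbrev W (n : ℕ) [n.AtLeastTwo] : Type := affineSymmetricGroup n

variable {n : ℕ} [n.AtLeastTwo]

/-- The simple reflection `s_i`. -/
def s (i : ZMod n) : W n :=
  ⟨simplePerm n i, Subgroup.subset_closure ⟨i, rfl⟩⟩

/-- The value `w(k)` of an affine permutation. -/
def value (w : W n) (k : ℤ) : ℤ := (w : Equiv.Perm ℤ) k

/-- The product `s_{i_1} ⋯ s_{i_l}` of a word. -/
def wordProd (l : List (ZMod n)) : W n := (l.map s).prod

/-- The length `ℓ(w)`: the minimal number of letters of a word for `w`. -/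
def length (w : W n) : ℕ := sInf {m | ∃ l : List (ZMod n), wordProd l = w ∧ l.length = m}

/-- `l` is a reduced word of `w`. -/
def IsReducedWord (l : List (ZMod n)) (w : W n) : Prop :=
  wordProd l = w ∧ l.length = length w

theorem s_mul_s (i : ZMod n) : s i * s i = 1 :=
  Subtype.ext (Equiv.ext (simpleFun_involutive n i))

theorem exists_word (w : W n) : ∃ l : List (ZMod n), wordProd l = w := by
  obtain ⟨w, hw⟩ := w
  suffices ∃ l : List (ZMod n), ((wordProd l : W n) : Equiv.Perm ℤ) = w by
    obtain ⟨l, hl⟩ := this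
    exact ⟨l, Subtype.ext hl⟩
  induction hw using Subgroup.closure_induction with
  | mem x hx =>
    obtain ⟨i, rfl⟩ := hx
    exact ⟨[i], by simp [wordProd, s]⟩
  | one => exact ⟨[], rfl⟩
  | mul x y _ _ hx hy =>
    obtain ⟨l, rfl⟩ := hx
    obtain ⟨m, rfl⟩ := hy
    exact ⟨l ++ m, by simp [wordProd]⟩
  | inv x _ hx =>
    obtain ⟨l, rfl⟩ := hx
    refine ⟨l.reverse, ?_⟩
    rw [← Subgroup.coe_inv, Subtype.coe_inj, wordProd, wordProd, List.prod_inv_reverse,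
      List.map_map, List.map_reverse]
    refine congrArg (fun L : List (W n) => L.reverse.prod) (List.map_congr_left fun i _ => ?_)
    exact eq_inv_of_mul_eq_one_left (s_mul_s i)

theorem exists_reducedWord (w : W n) : ∃ l : List (ZMod n), IsReducedWord l w := by
  obtain ⟨l, hl⟩ := exists_word w
  exact Nat.sInf_mem (s := {m | ∃ l : List (ZMod n), wordProd l = w ∧ l.length = m}) ⟨_, l, hl, rfl⟩

/-- A reduced word of `w`. -/
def reducedWord (w : W n) : List (ZMod n) := (exists_reducedWord w).choose

/-- The Bruhat (strong) order: some reduced word of `v` is a subword of some reduced word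
of `w`. -/
def BruhatLE (v w : W n) : Prop :=
  ∃ l m : List (ZMod n), IsReducedWord l v ∧ IsReducedWord m w ∧ l.Sublist m

/-- `v ⋖ w`: `v < w` in the Bruhat order and `ℓ(v) = ℓ(w) - 1`. -/
def BruhatCover (v w : W n) : Prop := BruhatLE v w ∧ length v + 1 = length w

/-- The Pieri element `ρ_i = s_{i-1} ⋯ s_1 s_0`, indices modulo `n`. -/
def rho (n : ℕ) [n.AtLeastTwo] : ℕ → W n
  | 0 => 1
  | i + 1 => s (i : ZMod n) * rho n i

/-! ### Strong strips -/

/-- For `i ≢ j` modulo `n`, the affine transposition `t_{ij}`: it exchanges `i + k n` and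
`j + k n` for all integers `k`, and fixes all other integers. -/
def transposition (n : ℕ) (i j k : ℤ) : ℤ :=
  if (k : ZMod n) = (i : ZMod n) then k + (j - i)
  else if (k : ZMod n) = (j : ZMod n) then k - (j - i) else k

/-- `(u, a, v)` is a marked strong cover `u → v` with marking `a`: `v ⋖ u`, and
`u = v t_{ij}`, `a = u(j) = v(i)` for some `i ≤ 0 < j`. -/
def MarkedStrongCover (u : W n) (a : ℤ) (v : W n) : Prop :=
  BruhatCover v u ∧ ∃ i j : ℤ, i ≤ 0 ∧ 0 < j ∧ (i : ZMod n) ≠ (j : ZMod n) ∧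
    (∀ k, value u k = value v (transposition n i j k)) ∧ a = value u j ∧ a = value v i

/-- A strong strip of length `i` from `w` to `u`: a path
`w = x_0 → x_1 → ⋯ → x_i = u` of marked strong covers with strictly decreasing markings
`a_1 > a_2 > ⋯ > a_i`. -/
structure StrongStrip (w u : W n) (i : ℕ) where
  vertex : Fin (i + 1) → W n
  mark : Fin i → ℤ
  vertex_zero : vertex 0 = w
  vertex_last : vertex (Fin.last i) = u
  cover : ∀ j : Fin i, MarkedStrongCover (vertex j.castSucc) (mark j) (vertex j.succ)
  mark_anti : StrictAnti mark

/-! ### Weights and the level zero action -/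

theorem value_add_period (w : W n) (k : ℤ) : value w (k + n) = value w k + n := by
  have hle : affineSymmetricGroup n ≤ Subgroup.centralizer {Equiv.addRight (n : ℤ)} := by
    refine (Subgroup.closure_le _).2 ?_
    rintro _ ⟨i, rfl⟩
    refine Subgroup.mem_centralizer_singleton_iff.2 (Equiv.ext fun k => ?_)
    change simpleFun n i (k + n) = simpleFun n i k + n
    simp only [simpleFun, Int.cast_add, Int.cast_natCast, CharP.cast_eq_zero, add_zero]
    split_ifs <;> ring
  have h := Subgroup.mem_centralizer_singleton_iff.1 (hle w.2)
  exact congrArg (fun e : Equiv.Perm ℤ => e k) h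

theorem value_add_mul_period (w : W n) (k m : ℤ) :
    value w (k + m * n) = value w k + m * n := by
  induction m using Int.induction_on with
  | zero => simp
  | succ m ih =>
    rw [show k + ((m : ℤ) + 1) * n = (k + m * n) + n by ring, value_add_period, ih]; ring
  | pred m ih =>
    have := value_add_period w (k + (-(m : ℤ) - 1) * n)
    rw [show k + (-(m : ℤ) - 1) * n + n = k + -(m : ℤ) * n by ring, ih] at this
    linarith

theorem value_cast_congr (w : W n) {k l : ℤ} (h : (k : ZMod n) = (l : ZMod n)) :
    (value w k : ZMod n) = (value w l : ZMod n) := by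
  obtain ⟨m, hm⟩ := (ZMod.intCast_eq_intCast_iff_dvd_sub k l n).1 h
  rw [show l = k + m * n by linarith, value_add_mul_period]
  simp

/-- The permutation of the residues modulo `n` induced by an affine permutation. -/
def residue (w : W n) (r : ZMod n) : ZMod n := (value w (r.val : ℤ) : ZMod n)

theorem residue_one (r : ZMod n) : residue (1 : W n) r = r := by
  simp [residue, value]

theorem residue_mul (v w : W n) (r : ZMod n) : residue (v * w) r = residue v (residue w r) := by
  change ((value v (value w _) : ℤ) : ZMod n) = _
  exact value_cast_congr v (by simp [residue])

/-- The group homomorphism to the permutations of the residues modulo `n`. -/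
def residueHom (n : ℕ) [n.AtLeastTwo] : W n →* Equiv.Perm (ZMod n) where
  toFun w :=
    { toFun := residue w
      invFun := residue w⁻¹
      left_inv := fun r => by rw [← residue_mul, inv_mul_cancel, residue_one]
      right_inv := fun r => by rw [← residue_mul, mul_inv_cancel, residue_one] }
  map_one' := Equiv.ext residue_one
  map_mul' v w := Equiv.ext (residue_mul v w)

/-- The span of `(1, …, 1)` in `ℤⁿ`. -/
def diagonal (n : ℕ) : Submodule ℤ (ZMod n → ℤ) := Submodule.span ℤ {fun _ => 1}

/-- The weight lattice `P` of `SL_n`: the quotient of `ℤⁿ` (with coordinates indexed by `ℤ/nℤ`) by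
`(1, …, 1)`. The fundamental weights are the classes of `e_1 + ⋯ + e_i`, `0 < i < n`. -/
abbrev P (n : ℕ) : Type := (ZMod n → ℤ) ⧸ diagonal n

/-- The image in `P` of the simple affine root `α_i`: the class of `e_i - e_{i+1}`. In
particular `α_0 = e_n - e_1 = -θ`, as the null root is sent to `0`. -/
def simpleRoot (n : ℕ) (i : ZMod n) : P n :=
  (diagonal n).mkQ (Pi.single i 1 - Pi.single (i + 1) 1)

theorem mem_diagonal {m : ℕ} {f : ZMod m → ℤ} : f ∈ diagonal m ↔ ∃ c : ℤ, ∀ r, f r = c := by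
  rw [diagonal, Submodule.mem_span_singleton]
  constructor
  · rintro ⟨c, rfl⟩
    exact ⟨c, fun r => by simp⟩
  · rintro ⟨c, hc⟩
    exact ⟨c, funext fun r => by simp [hc r]⟩

instance P_free : Module.Free ℤ (P n) := by
  have : Module.IsTorsionFree ℤ (P n) := by
    refine Module.isTorsionFree_iff_smul_eq_zero.2 ?_
    intro m x hx
    obtain ⟨f, rfl⟩ := (diagonal n).mkQ_surjective x
    rw [← map_smul] at hx
    simp only [Submodule.mkQ_apply, Submodule.Quotient.mk_eq_zero] at hx ⊢
    by_cases hm : m = 0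
    · exact Or.inl hm
    · obtain ⟨c, hc⟩ := mem_diagonal.1 hx
      refine Or.inr (mem_diagonal.2 ⟨f 0, fun r => ?_⟩)
      exact mul_left_cancel₀ hm ((hc r).trans (hc 0).symm)
  infer_instance

/-- The level zero action of `W n` on `P`: it sends the class of `e_r` to the class of
`e_{w(r)}`, so that `s_i` acts by `λ ↦ λ - ⟨α_i^∨, λ⟩ α_i` with `⟨α_i^∨, λ⟩ = λ_i - λ_{i+1}`. -/
def weightMap (w : W n) : P n →ₗ[ℤ] P n :=
  (diagonal n).mapQ (diagonal n) (LinearMap.funLeft ℤ ℤ (residueHom n w⁻¹)) (by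
    intro f hf
    obtain ⟨c, hc⟩ := mem_diagonal.1 hf
    exact mem_diagonal.2 ⟨c, fun r => hc _⟩)

theorem weightMap_one (x : P n) : weightMap (1 : W n) x = x := by
  obtain ⟨f, rfl⟩ := (diagonal n).mkQ_surjective x
  simp [weightMap, LinearMap.funLeft]

theorem weightMap_mul (v w : W n) (x : P n) :
    weightMap (v * w) x = weightMap v (weightMap w x) := by
  obtain ⟨f, rfl⟩ := (diagonal n).mkQ_surjective x
  simp [weightMap, LinearMap.funLeft, Function.comp_assoc]

/-- `S = Sym(P)`. -/
abbrev S (n : ℕ) : Type := SymmetricAlgebra ℤ (P n)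

/-- The evaluation `φ : S → ℤ` at `0` (the constant term). -/
def evalZero (n : ℕ) : S n →ₐ[ℤ] ℤ := SymmetricAlgebra.algebraMapInv

/-- The induced map on `S`. -/
def symMap (w : W n) : S n →ₐ[ℤ] S n :=
  SymmetricAlgebra.lift (SymmetricAlgebra.ι ℤ (P n) ∘ₗ weightMap w)

theorem symMap_one : symMap (1 : W n) = AlgHom.id ℤ (S n) :=
  SymmetricAlgebra.algHom_ext (LinearMap.ext fun x => by simp [symMap, weightMap_one])

theorem symMap_mul (v w : W n) : symMap (v * w) = (symMap v).comp (symMap w) :=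
  SymmetricAlgebra.algHom_ext (LinearMap.ext fun x => by simp [symMap, weightMap_mul])

/-- The level zero action on `S`, by ring automorphisms. -/
instance actionS : MulSemiringAction (W n) (S n) where
  smul w p := symMap w p
  one_smul p := congrArg (fun f : S n →ₐ[ℤ] S n => f p) symMap_one
  mul_smul v w p := congrArg (fun f : S n →ₐ[ℤ] S n => f p) (symMap_mul v w)
  smul_zero w := map_zero (symMap w)
  smul_add w := map_add (symMap w)
  smul_one w := map_one (symMap w)
  smul_mul w := map_mul (symMap w)

/-- `F = Frac(S)`. -/
abbrev F (n : ℕ) [n.AtLeastTwo] : Type := FractionRing (S n)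

/-- The level zero action on `F`, extending the one on `S`. -/
instance actionF : MulSemiringAction (W n) (F n) :=
  IsFractionRing.mulSemiringAction (W n) (S n) (F n)

/-! ### The nilHecke ring and its coproduct -/

/-- The twisted group algebra `F_W = ⨁ F w` with product `(p v)(q w) = p (v • q) v w`. -/
abbrev FW (n : ℕ) [n.AtLeastTwo] : Type := SkewMonoidAlgebra (F n) (W n)

/-- `A_i = α_i⁻¹ (1 - s_i)`. -/
def simpleA (i : ZMod n) : FW n :=
  (algebraMap (S n) (F n) (SymmetricAlgebra.ι ℤ (P n) (simpleRoot n i)))⁻¹ •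
    (1 - SkewMonoidAlgebra.single (s i) 1)

/-- `A_w = A_{i_1} ⋯ A_{i_l}` for a reduced word `s_{i_1} ⋯ s_{i_l}` of `w`. -/
def A (w : W n) : FW n := ((reducedWord w).map simpleA).prod

/-- The nilCoxeter ring `𝔸₀`: the subring of `F_W` generated by the `A_i`. -/
def nilCoxeter (n : ℕ) [n.AtLeastTwo] : Subring (FW n) :=
  Subring.closure (Set.range (simpleA (n := n)))

theorem A_mem (w : W n) : A w ∈ nilCoxeter n := by
  refine list_prod_mem fun x hx => ?_
  obtain ⟨i, -, rfl⟩ := List.mem_map.1 hx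
  exact Subring.subset_closure ⟨i, rfl⟩

/-- `A_w` as an element of the nilCoxeter ring. -/
def A0 (w : W n) : nilCoxeter n := ⟨A w, A_mem w⟩

/-- The left `F`-linear coproduct `Δ : F_W → F_W ⊗_F F_W` with `Δ(w) = w ⊗ w`. -/
def coproduct (n : ℕ) [n.AtLeastTwo] : FW n →ₗ[F n] FW n ⊗[F n] FW n :=
  SkewMonoidAlgebra.basisSingleOne.constr (F n) fun w : W n =>
    SkewMonoidAlgebra.single w (1 : F n) ⊗ₜ[F n] SkewMonoidAlgebra.single w (1 : F n)

/-- `Δ(A_w) = ∑ c(u, v) A_u ⊗ A_v`, a finite sum with coefficients in `S`. -/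
def IsCoproductExpansion (w : W n) (c : W n × W n →₀ S n) : Prop :=
  coproduct n (A w) = c.sum fun uv p => algebraMap (S n) (F n) p • (A uv.1 ⊗ₜ[F n] A uv.2)

open Classical in
/-- The equivariant Schubert structure constant `p^w_{u,v} ∈ S`, the coefficient of `A_u ⊗ A_v` in
the expansion of `Δ(A_w)`. -/
def structureConst (w u v : W n) : S n :=
  if h : ∃ c, IsCoproductExpansion w c then h.choose (u, v) else 0

/-! ### The operators -/

/-- `D` is the cap operator `D_u` on the nilCoxeter ring:
`D_u(A_w) = ∑_{ℓ(v) = ℓ(w) - ℓ(u)} p^w_{u,v} A_v`; these `p^w_{u,v}` are integer constants, which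
are read off by evaluation at `0`. -/
def IsCapOperator (u : W n) (D : nilCoxeter n →ₗ[ℤ] nilCoxeter n) : Prop :=
  ∀ w, D (A0 w) =
    ∑ᶠ (v : W n) (_ : length v + length u = length w), evalZero n (structureConst w u v) • A0 v

/-- `D` is the Pieri operator `D'_i` on the nilCoxeter ring: `D'_i(A_w)` is the sum of `A_u` over
all strong strips of length `i` from `w` to some `u`. -/
def IsPieriOperator (i : ℕ) (D : nilCoxeter n →ₗ[ℤ] nilCoxeter n) : Prop :=
  ∀ w, D (A0 w) = ∑ᶠ x : Σ u : W n, StrongStrip w u i, A0 x.1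

end AffinePieri

end

open scoped TensorProduct

set_option linter.unusedSectionVars false

noncomputable section

namespace AffinePieri

variable {n : ℕ} [n.AtLeastTwo]

/-! ### Positions and reflections -/

/-! The structure constants satisfy a recursion in `w`, and a product of explicit operators built
from marked covers satisfies the same one. Since A_i = α_i⁻¹(1 - s_i) and Δ(s_i x) = (s_i ⊗
s_i)Δ(x), one has α_i Δ(A_i x) = Δ(x) - (s_i ⊗ s_i)Δ(x). In the basis A_u ⊗ A_v this determines
D_m(s_i w), where D_m(w) = ∑_v p^w_{ρ_m,v} v, from the D's of `w` whenever ℓ(s_i w) > ℓ(w). The only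
left descent of ρ_{m+1} = s_m ρ_m is m, so D_{m+1}(s_i w) involves only D_{m+1}(w) and, when i ≡ m,
also D_m(w) (`isPieriRecursion_slices`).

Put y_r = 1 - t e_r. The generating function G_N(w) = ∑_{m ≤ N} t^m y_{m+1}⋯y_N D_m(w) absorbs the
exceptional term: if N ≢ i, then α_i G_N(s_i w) = G_N(w) - s_i·G_N(w), where s_i acts as 1 - α_i
A_i, twisted by its action on coefficients (`IsPieriRecursion.smul_genFun`).

On the combinatorial side, let Q_c project to the `w` in which the value c has positive position,
let X_c sum over the covers with marking c, and let K_c = 1 - t e_c Q_c + t X_c. In K_{-M+1}⋯K_N the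
rightmost factor acts first, so the product chooses markings in decreasing order. The heart of the
proof is that K_k K_{k+1} commutes with the twisted action of s_k (`kOp_pair_mul`). This rests on
relations between A_k, X_k, X_{k+1}, Q_k and Q_{k+1}, the most delicate of which uses
`not_cov_cov_succ`. Hence the long product commutes with s_i as soon as its ends separate no pair k,
k+1 with k ≡ i (`kProd_twist`), and applied to `w` it obeys the recursion of G_N.

Since K_c w = w for c ≤ -ℓ(w) and K_c w = y_c w for c > ℓ(w), the ends can be moved, and induction
on the length gives G_N(w) = K_{-M+1}⋯K_N w for large M, N (`IsPieriRecursion.genFun_eq_kProd`). The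
coefficient of t^j at `u`, for ℓ(u) + j = ℓ(w), is D_j(w)(u) on the left and the number of strong
strips on the right. The operators then agree because the A_w form a ℤ-basis of the nilCoxeter ring.
-/

theorem value_mul (v w : W n) (k : ℤ) : value (v * w) k = value v (value w k) := rfl

theorem value_one (k : ℤ) : value (1 : W n) k = k := rfl

theorem value_injective (w : W n) : Function.Injective (value w) := (w : Equiv.Perm ℤ).injective

theorem ext_value {v w : W n} (h : ∀ k, value v k = value w k) : v = w :=
  Subtype.ext (Equiv.ext h)

/-- The position of the value `a` in `w`. -/
def pos (w : W n) (a : ℤ) : ℤ := value w⁻¹ a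

theorem value_pos (w : W n) (a : ℤ) : value w (pos w a) = a := by
  rw [pos, ← value_mul, mul_inv_cancel, value_one]

theorem pos_value (w : W n) (a : ℤ) : pos w (value w a) = a := by
  rw [pos, ← value_mul, inv_mul_cancel, value_one]

theorem pos_mul (v w : W n) (a : ℤ) : pos (v * w) a = pos w (pos v a) := by
  rw [pos, mul_inv_rev, value_mul, pos, pos]

theorem pos_one (a : ℤ) : pos (1 : W n) a = a := by rw [pos, inv_one, value_one]

theorem pos_injective (w : W n) : Function.Injective (pos w) := value_injective _

theorem s_inv (i : ZMod n) : (s i)⁻¹ = s i := (eq_inv_of_mul_eq_one_left (s_mul_s i)).symm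

theorem s_mul_s_mul (i : ZMod n) (w : W n) : s i * (s i * w) = w := by
  rw [← mul_assoc, s_mul_s, one_mul]

theorem value_s (i : ZMod n) (k : ℤ) : value (s i) k = simpleFun n i k := rfl

theorem pos_s (i : ZMod n) (k : ℤ) : pos (s i) k = simpleFun n i k := by
  rw [pos, s_inv, value_s]

theorem pos_s_mul (i : ZMod n) (w : W n) (k : ℤ) :
    pos (s i * w) k = pos w (simpleFun n i k) := by rw [pos_mul, pos_s]

theorem simpleFun_left (k : ℤ) : simpleFun n (k : ZMod n) k = k + 1 := by simp [simpleFun]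

theorem simpleFun_right (k : ℤ) : simpleFun n (k : ZMod n) (k + 1) = k := by
  have := zmod_succ_ne (n := n) (k : ZMod n)
  simp [simpleFun, this]

theorem simpleFun_of_ne {i : ZMod n} {k : ℤ} (h : (k : ZMod n) ≠ i) (h' : (k : ZMod n) ≠ i + 1) :
    simpleFun n i k = k := by simp [simpleFun, h, h']

theorem cast_add_mul (k m : ℤ) : ((k + m * n : ℤ) : ZMod n) = k := by simp

theorem exists_eq_add_mul {k l : ℤ} (h : (k : ZMod n) = (l : ZMod n)) :
    ∃ m : ℤ, l = k + m * n := by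
  obtain ⟨m, hm⟩ := (ZMod.intCast_eq_intCast_iff_dvd_sub k l n).1 h
  exact ⟨m, by linarith⟩

theorem pos_add_mul (w : W n) (a m : ℤ) : pos w (a + m * n) = pos w a + m * n :=
  value_add_mul_period w⁻¹ a m

theorem value_cast_eq_iff (w : W n) {k l : ℤ} :
    (value w k : ZMod n) = (value w l : ZMod n) ↔ (k : ZMod n) = (l : ZMod n) := by
  refine ⟨fun h => ?_, value_cast_congr w⟩
  have := value_cast_congr w⁻¹ h
  rwa [← value_mul, ← value_mul, inv_mul_cancel, value_one, value_one] at this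

theorem pos_cast_eq_iff (w : W n) {k l : ℤ} :
    (pos w k : ZMod n) = (pos w l : ZMod n) ↔ (k : ZMod n) = (l : ZMod n) :=
  value_cast_eq_iff w⁻¹

theorem period_pos : (2 : ℤ) ≤ n := by exact_mod_cast (Nat.AtLeastTwo.prop : 2 ≤ n)

theorem ne_of_cast_ne {k l : ℤ} (h : (k : ZMod n) ≠ (l : ZMod n)) : k ≠ l := fun e => h (by rw [e])

/-- A simple reflection inverts only pairs of adjacent integers. -/
theorem simpleFun_inverts {i : ZMod n} {x y : ℤ} (h : x < y)
    (h' : simpleFun n i y < simpleFun n i x) : (x : ZMod n) = i ∧ y = x + 1 := by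
  have hx : simpleFun n i x ≤ x + 1 := by unfold simpleFun; split_ifs <;> omega
  have hy : y - 1 ≤ simpleFun n i y := by unfold simpleFun; split_ifs <;> omega
  obtain rfl : y = x + 1 := by omega
  refine ⟨?_, rfl⟩
  by_contra hne
  have hx' : simpleFun n i x ≤ x := by unfold simpleFun; split_ifs <;> omega
  have hy' : simpleFun n i (x + 1) = x := by omega
  have := (simpleFun_involutive n i) (x + 1)
  rw [hy'] at this
  omega

theorem transposition_left (i j m : ℤ) : transposition n i j (i + m * n) = j + m * n := by
  simp only [transposition, cast_add_mul, if_true]; ring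

theorem transposition_right {i j : ℤ} (h : (i : ZMod n) ≠ j) (m : ℤ) :
    transposition n i j (j + m * n) = i + m * n := by
  simp only [transposition, cast_add_mul, if_true, if_neg h.symm]; ring

theorem transposition_of_ne {i j k : ℤ} (hi : (k : ZMod n) ≠ i) (hj : (k : ZMod n) ≠ j) :
    transposition n i j k = k := by
  simp [transposition, hi, hj]

theorem transposition_involutive {i j : ℤ} (h : (i : ZMod n) ≠ j) :
    Function.Involutive (transposition n i j) := by
  intro k
  by_cases hi : (i : ZMod n) = k
  · obtain ⟨m, rfl⟩ := exists_eq_add_mul hi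
    rw [transposition_left, transposition_right h]
  by_cases hj : (j : ZMod n) = k
  · obtain ⟨m, rfl⟩ := exists_eq_add_mul hj
    rw [transposition_right h, transposition_left]
  rw [transposition_of_ne (Ne.symm hi) (Ne.symm hj), transposition_of_ne (Ne.symm hi) (Ne.symm hj)]

/-- Conjugating a reflection of positions by w gives the reflection of the corresponding values;
periodicity of w reduces this to the two residue classes that move. -/
theorem value_transposition (w : W n) {i j : ℤ} (h : (i : ZMod n) ≠ j) (k : ℤ) :
    value w (transposition n i j k) = transposition n (value w i) (value w j) (value w k) := by
  have h' : (value w i : ZMod n) ≠ value w j := fun e => h ((value_cast_eq_iff w).1 e)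
  by_cases hi : (i : ZMod n) = k
  · obtain ⟨m, rfl⟩ := exists_eq_add_mul hi
    rw [transposition_left, value_add_mul_period, value_add_mul_period, transposition_left]
  by_cases hj : (j : ZMod n) = k
  · obtain ⟨m, rfl⟩ := exists_eq_add_mul hj
    rw [transposition_right h, value_add_mul_period, value_add_mul_period, transposition_right h']
  rw [transposition_of_ne (Ne.symm hi) (Ne.symm hj), transposition_of_ne]
  · exact fun e => hi ((value_cast_eq_iff w).1 e).symm
  · exact fun e => hj ((value_cast_eq_iff w).1 e).symm

theorem transposition_comm {i j : ℤ} (h : (i : ZMod n) ≠ j) (k : ℤ) :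
    transposition n i j k = transposition n j i k := by
  by_cases hi : (i : ZMod n) = k
  · obtain ⟨m, rfl⟩ := exists_eq_add_mul hi
    rw [transposition_left, transposition_right h.symm]
  by_cases hj : (j : ZMod n) = k
  · obtain ⟨m, rfl⟩ := exists_eq_add_mul hj
    rw [transposition_right h, transposition_left]
  rw [transposition_of_ne (Ne.symm hi) (Ne.symm hj), transposition_of_ne (Ne.symm hj) (Ne.symm hi)]

/-- The distance j - i is reduced by conjugation: t_{ij} = s_{j-1} t_{i,j-1} s_{j-1}. If i ≡ j - 1
the inner reflection is undefined, but then s_i moves both ends at once and t_{ij} = s_i t_{i+1,j-1}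
s_i. -/
theorem exists_transposition_of_lt (d : ℕ) : ∀ i j : ℤ, i < j → j - i = d →
    (i : ZMod n) ≠ j → ∃ t : W n, ∀ k, value t k = transposition n i j k := by
  induction d using Nat.strong_induction_on with
  | _ d ih =>
    intro i j hij hd hne
    by_cases h1 : j = i + 1
    · subst h1
      refine ⟨s (i : ZMod n), fun k => ?_⟩
      rw [value_s]
      unfold simpleFun transposition
      push_cast
      split_ifs <;> ring
    by_cases h2 : (i : ZMod n) = ((j - 1 : ℤ) : ZMod n)
    · have hi1 : ((i + 1 : ℤ) : ZMod n) ≠ ((j - 1 : ℤ) : ZMod n) := by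
        rw [← h2]; push_cast; exact zmod_succ_ne _
      have hlt : i + 1 < j - 1 := by
        have := ne_of_cast_ne hi1
        omega
      obtain ⟨t, ht⟩ := ih (d - 2) (by omega) (i + 1) (j - 1) hlt (by omega) hi1
      refine ⟨s (i : ZMod n) * t * s (i : ZMod n), fun k => ?_⟩
      rw [value_mul, value_mul, ht, value_transposition _ hi1, ← value_mul, s_mul_s, value_one,
        value_s, value_s, simpleFun_right, h2, simpleFun_left]
      congr 1; ring
    · obtain ⟨t, ht⟩ := ih (d - 1) (by omega) i (j - 1) (by omega) (by omega) h2
      refine ⟨s ((j - 1 : ℤ) : ZMod n) * t * s ((j - 1 : ℤ) : ZMod n), fun k => ?_⟩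
      rw [value_mul, value_mul, ht, value_transposition _ h2, ← value_mul, s_mul_s, value_one,
        value_s, value_s, simpleFun_left, simpleFun_of_ne h2]
      · congr 1; ring
      · push_cast; rwa [sub_add_cancel]

theorem exists_transposition {i j : ℤ} (hne : (i : ZMod n) ≠ j) :
    ∃ t : W n, ∀ k, value t k = transposition n i j k := by
  rcases lt_or_gt_of_ne (ne_of_cast_ne hne) with h | h
  · exact exists_transposition_of_lt (j - i).toNat i j h (by omega) hne
  · obtain ⟨t, ht⟩ := exists_transposition_of_lt (i - j).toNat j i h (by omega) hne.symm
    exact ⟨t, fun k => by rw [ht, transposition_comm hne]⟩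

open Classical in
/-- The reflection `t_{ij}` as an element of the affine symmetric group (and `1` if
`i ≡ j` modulo `n`). -/
def refl (i j : ℤ) : W n :=
  if h : (i : ZMod n) ≠ j then (exists_transposition h).choose else 1

theorem value_refl {i j : ℤ} (h : (i : ZMod n) ≠ j) (k : ℤ) :
    value (refl i j : W n) k = transposition n i j k := by
  rw [refl, dif_pos h]
  exact (exists_transposition h).choose_spec k

theorem refl_of_eq {i j : ℤ} (h : (i : ZMod n) = j) : (refl i j : W n) = 1 := by
  rw [refl, dif_neg (not_not.2 h)]

theorem refl_comm (i j : ℤ) : (refl i j : W n) = refl j i := by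
  by_cases h : (i : ZMod n) = j
  · rw [refl_of_eq h, refl_of_eq h.symm]
  · exact ext_value fun k => by
      rw [value_refl h, value_refl (Ne.symm h), transposition_comm h]

theorem refl_mul_self (i j : ℤ) : (refl i j : W n) * refl i j = 1 := by
  by_cases h : (i : ZMod n) = j
  · rw [refl_of_eq h, one_mul]
  · exact ext_value fun k => by
      rw [value_mul, value_refl h, value_refl h, transposition_involutive h, value_one]

theorem refl_mul_refl_mul (i j : ℤ) (w : W n) : refl i j * (refl i j * w) = w := by
  rw [← mul_assoc, refl_mul_self, one_mul]

theorem refl_inv (i j : ℤ) : (refl i j : W n)⁻¹ = refl i j :=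
  (eq_inv_of_mul_eq_one_left (refl_mul_self i j)).symm

theorem refl_succ (k : ℤ) : (refl k (k + 1) : W n) = s (k : ZMod n) := by
  have h : (k : ZMod n) ≠ ((k + 1 : ℤ) : ZMod n) := by
    push_cast; exact (zmod_succ_ne _).symm
  refine ext_value fun l => ?_
  rw [value_refl h, value_s]
  unfold simpleFun transposition
  push_cast
  split_ifs <;> ring

theorem mul_refl (w : W n) (i j : ℤ) : w * refl i j = refl (value w i) (value w j) * w := by
  by_cases h : (i : ZMod n) = j
  · rw [refl_of_eq h, refl_of_eq ((value_cast_eq_iff w).2 h), one_mul, mul_one]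
  · refine ext_value fun k => ?_
    rw [value_mul, value_mul, value_refl h, value_refl (fun e => h ((value_cast_eq_iff w).1 e)),
      value_transposition w h]

theorem s_mul_refl (i : ZMod n) (a b : ℤ) :
    s i * refl a b = refl (simpleFun n i a) (simpleFun n i b) * s i := mul_refl _ _ _

theorem pos_refl_mul {a b : ℤ} (h : (a : ZMod n) ≠ b) (w : W n) (c : ℤ) :
    pos (refl a b * w) c = pos w (transposition n a b c) := by
  rw [pos_mul, pos.eq_1 (refl a b), refl_inv, value_refl h]

/-! ### Length and the strong exchange property -/

theorem wordProd_cons (i : ZMod n) (l : List (ZMod n)) : wordProd (i :: l) = s i * wordProd l := by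
  simp [wordProd]

theorem length_wordProd_le (l : List (ZMod n)) : length (wordProd l) ≤ l.length :=
  Nat.sInf_le ⟨l, rfl, rfl⟩

theorem length_one : length (1 : W n) = 0 := Nat.le_zero.1 (length_wordProd_le (n := n) [])

/-- Moving the reflection past the first letter s_i replaces a, b by s_i(a), s_i(b). If these are
still in increasing order, the rest of the word takes over. Otherwise s_i inverts a and b, so b = a
+ 1, the reflection is s_i itself, and the first letter is the one deleted. -/
theorem strong_exchange (l : List (ZMod n)) : ∀ a b : ℤ, a < b → (a : ZMod n) ≠ b →
    pos (wordProd l) b < pos (wordProd l) a →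
    ∃ l₁ i l₂, l = l₁ ++ i :: l₂ ∧ refl a b * wordProd l = wordProd (l₁ ++ l₂) := by
  induction l with
  | nil =>
    intro a b hab _ h
    change pos (1 : W n) b < pos (1 : W n) a at h
    rw [pos_one, pos_one] at h
    omega
  | cons i l ih =>
    intro a b hab hne h
    rw [wordProd_cons, pos_s_mul, pos_s_mul] at h
    have hne' : (simpleFun n i a : ZMod n) ≠ simpleFun n i b := fun e =>
      hne ((value_cast_eq_iff (s i)).1 e)
    rcases lt_or_gt_of_ne (ne_of_cast_ne hne') with hlt | hlt
    · obtain ⟨l₁, j, l₂, rfl, hl⟩ := ih _ _ hlt hne' h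
      refine ⟨i :: l₁, j, l₂, rfl, ?_⟩
      have := s_mul_refl i (simpleFun n i a) (simpleFun n i b)
      rw [simpleFun_involutive, simpleFun_involutive] at this
      rw [wordProd_cons, ← mul_assoc, ← this, mul_assoc, hl, List.cons_append, wordProd_cons]
    · obtain ⟨rfl, rfl⟩ := simpleFun_inverts hab hlt
      refine ⟨[], _, l, rfl, ?_⟩
      rw [wordProd_cons, refl_succ, s_mul_s_mul, List.nil_append]

theorem length_refl_mul_lt {w : W n} {a b : ℤ} (hab : a < b) (hne : (a : ZMod n) ≠ b)
    (h : pos w b < pos w a) : length (refl a b * w) < length w := by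
  obtain ⟨l, hl, hlen⟩ := exists_reducedWord w
  subst hl
  obtain ⟨l₁, i, l₂, rfl, e⟩ := strong_exchange l a b hab hne h
  rw [e, ← hlen]
  refine (length_wordProd_le _).trans_lt ?_
  simp

theorem lt_length_refl_mul {w : W n} {a b : ℤ} (hab : a < b) (hne : (a : ZMod n) ≠ b)
    (h : pos w a < pos w b) : length w < length (refl a b * w) := by
  have := length_refl_mul_lt (w := refl a b * w) hab hne (by
    have h1 := transposition_left (n := n) a b 0
    have h2 := transposition_right hne 0
    simp only [zero_mul, add_zero] at h1 h2
    rwa [pos_refl_mul hne, pos_refl_mul hne, h1, h2])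
  rwa [refl_mul_refl_mul] at this

theorem lt_length_mul_refl {w : W n} {p q : ℤ} (hpq : p < q) (hne : (p : ZMod n) ≠ q)
    (h : value w p < value w q) : length w < length (w * refl p q) := by
  rw [mul_refl]
  refine lt_length_refl_mul h (fun e => hne ((value_cast_eq_iff w).1 e)) ?_
  rwa [pos_value, pos_value]

theorem length_s_mul_le (i : ZMod n) (w : W n) : length (s i * w) ≤ length w + 1 := by
  obtain ⟨l, hl, hlen⟩ := exists_reducedWord w
  rw [← hl, ← wordProd_cons, hl, ← hlen]
  exact length_wordProd_le _

/-- `w` has no left descent at `i`, that is, `ℓ(s_i w) > ℓ(w)`. -/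
def Ascent (i : ZMod n) (w : W n) : Prop := length w < length (s i * w)

theorem ascent_iff (k : ℤ) (w : W n) : Ascent (k : ZMod n) w ↔ pos w k < pos w (k + 1) := by
  have hne : (k : ZMod n) ≠ ((k + 1 : ℤ) : ZMod n) := by push_cast; exact (zmod_succ_ne _).symm
  have hp : pos w k ≠ pos w (k + 1) := fun e => by have := pos_injective w e; omega
  rw [Ascent, ← refl_succ]
  refine ⟨fun h => ?_, lt_length_refl_mul (by omega) hne⟩
  by_contra hlt
  have := length_refl_mul_lt (w := w) (show k < k + 1 by omega) hne (by omega)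
  omega

theorem not_ascent_iff (k : ℤ) (w : W n) :
    ¬ Ascent (k : ZMod n) w ↔ pos w (k + 1) < pos w k := by
  have hp : pos w k ≠ pos w (k + 1) := fun e => by have := pos_injective w e; omega
  rw [ascent_iff]; omega

theorem exists_intCast (i : ZMod n) : ∃ k : ℤ, (k : ZMod n) = i := ZMod.intCast_surjective i

theorem ascent_s_mul_iff (i : ZMod n) (w : W n) : Ascent i (s i * w) ↔ ¬ Ascent i w := by
  obtain ⟨k, rfl⟩ := exists_intCast i
  rw [ascent_iff, not_ascent_iff, pos_s_mul, pos_s_mul, simpleFun_left, simpleFun_right]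

theorem length_of_ascent {i : ZMod n} {w : W n} (h : Ascent i w) :
    length (s i * w) = length w + 1 :=
  le_antisymm (length_s_mul_le i w) h

theorem length_of_not_ascent {i : ZMod n} {w : W n} (h : ¬ Ascent i w) :
    length (s i * w) + 1 = length w := by
  have := length_of_ascent ((ascent_s_mul_iff i w).2 h)
  rw [s_mul_s_mul] at this
  exact this.symm

theorem exists_not_ascent {w : W n} (h : w ≠ 1) : ∃ i, ¬ Ascent i w := by
  obtain ⟨l, hl, hlen⟩ := exists_reducedWord w
  cases l with
  | nil => exact absurd hl.symm h
  | cons i l =>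
    refine ⟨i, fun hi => ?_⟩
    have h1 := length_of_ascent hi
    rw [← hl, wordProd_cons, s_mul_s_mul, ← wordProd_cons, hl] at h1
    have h2 := length_wordProd_le l
    simp only [List.length_cons] at hlen
    omega

/-- Induction on the length, by multiplication by simple reflections from the left. -/
theorem length_induction {p : W n → Prop} (one : p 1)
    (step : ∀ (i : ZMod n) (w : W n), Ascent i w → p w → p (s i * w)) (w : W n) : p w := by
  induction hm : length w using Nat.strong_induction_on generalizing w with
  | _ m ih =>
    by_cases hw : w = 1
    · rwa [hw]
    · obtain ⟨i, hi⟩ := exists_not_ascent hw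
      have h := step i (s i * w) ((ascent_s_mul_iff i w).2 hi)
        (ih _ (by have := length_of_not_ascent hi; omega) _ rfl)
      rwa [s_mul_s_mul] at h

theorem cast_ne_of_cover {w : W n} {a b : ℤ} (h : length (refl a b * w) + 1 = length w) :
    (a : ZMod n) ≠ b := by
  intro e
  rw [refl_of_eq e, one_mul] at h
  omega

theorem strong_exchange_of_cover {w : W n} {a b : ℤ} (h : length (refl a b * w) + 1 = length w)
    {l : List (ZMod n)} (hl : wordProd l = w) :
    ∃ l₁ i l₂, l = l₁ ++ i :: l₂ ∧ refl a b * w = wordProd (l₁ ++ l₂) := by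
  have hne := cast_ne_of_cover h
  subst hl
  have hp : pos (wordProd l) a ≠ pos (wordProd l) b := fun e =>
    ne_of_cast_ne hne (pos_injective _ e)
  rcases lt_or_gt_of_ne (ne_of_cast_ne hne) with hab | hab
  · refine strong_exchange l a b hab hne ?_
    by_contra hlt
    have := lt_length_refl_mul (w := wordProd l) hab hne (by omega)
    omega
  · rw [refl_comm] at h ⊢
    refine strong_exchange l b a hab hne.symm ?_
    by_contra hlt
    have := lt_length_refl_mul (w := wordProd l) hab hne.symm (by omega)
    omega

/-- A special case of the lifting property. -/
theorem not_ascent_of_cover {i : ZMod n} {w : W n} {a b : ℤ} (hw : ¬ Ascent i w)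
    (h : length (refl a b * w) + 1 = length w) (hne : refl a b * w ≠ s i * w) :
    ¬ Ascent i (refl a b * w) := by
  obtain ⟨l, hl, hlen⟩ := exists_reducedWord (s i * w)
  have hw' := length_of_not_ascent hw
  have hil : wordProd (i :: l) = w := by rw [wordProd_cons, hl, s_mul_s_mul]
  obtain ⟨l₁, j, l₂, e, h2⟩ := strong_exchange_of_cover h hil
  cases l₁ with
  | nil =>
    simp only [List.nil_append, List.cons.injEq] at e h2
    rw [← e.2, hl] at h2
    exact absurd h2 hne
  | cons j' l₁ =>
    simp only [List.cons_append, List.cons.injEq] at e h2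
    obtain ⟨rfl, e⟩ := e
    -- If i were an ascent, s_i times the smaller element would have length ℓ(w), yet it is the
    -- product of `l₁ ++ l₂`, which has only ℓ(w) - 2 letters.
    intro hasc
    have h3 := length_of_ascent hasc
    rw [h2, wordProd_cons, s_mul_s_mul, ← wordProd_cons, ← List.cons_append] at h3
    have h4 := length_wordProd_le (l₁ ++ l₂)
    rw [e] at hlen
    simp only [List.length_append, List.length_cons] at h4 hlen
    rw [h2, ← List.cons_append] at h
    omega

/-- Each letter moves an integer by at most one. The resulting bound by the length makes all sets of
covers finite and confines markings to a window around 0. -/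
theorem abs_value_wordProd_sub_le (l : List (ZMod n)) (k : ℤ) :
    |value (wordProd l) k - k| ≤ l.length := by
  induction l with
  | nil => simp [wordProd, value_one]
  | cons i l ih =>
    rw [wordProd_cons, value_mul, value_s, List.length_cons]
    have h : ∀ x : ℤ, |simpleFun n i x - x| ≤ 1 := by
      intro x
      unfold simpleFun
      split_ifs <;> simp
    have := h (value (wordProd l) k)
    push_cast
    rw [abs_le] at *
    constructor <;> linarith

theorem abs_sub_pos_le (w : W n) (a : ℤ) : |a - pos w a| ≤ length w := by
  obtain ⟨l, hl, hlen⟩ := exists_reducedWord w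
  have := abs_value_wordProd_sub_le l (pos w a)
  rwa [hl, value_pos, hlen] at this

theorem pos_pos_of_length_lt {w : W n} {a : ℤ} (h : length w < a) : 0 < pos w a := by
  have := abs_le.1 (abs_sub_pos_le w a); omega

theorem pos_nonpos_of_le_neg_length {w : W n} {a : ℤ} (h : a ≤ -length w) : pos w a ≤ 0 := by
  have := abs_le.1 (abs_sub_pos_le w a); omega

/-! ### Bruhat covers -/

/-- Here t_{pj} = t_{pq} t_{qj} t_{pq}, and each of the three factors, multiplied successively on
the right of y, raises the length. -/
theorem length_add_three_le {y : W n} {p q j : ℤ} (hpq : p < q) (hqj : q < j)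
    (h1 : value y p < value y q) (h2 : value y q < value y j)
    (n1 : (p : ZMod n) ≠ q) (n2 : (q : ZMod n) ≠ j) (n3 : (p : ZMod n) ≠ j) :
    length y + 3 ≤ length (y * refl p j) := by
  have t1 := transposition_left (n := n) p q 0
  have t2 := transposition_right n1 0
  have t3 := transposition_left (n := n) q j 0
  have t4 := transposition_right n2 0
  have t5 : transposition n p q j = j := transposition_of_ne n3.symm n2.symm
  have t6 : transposition n q j p = p := transposition_of_ne n1 n3
  simp only [zero_mul, add_zero] at t1 t2 t3 t4
  have a1 := lt_length_mul_refl hpq n1 h1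
  have a2 : length (y * refl p q) < length (y * refl p q * refl q j) := by
    refine lt_length_mul_refl hqj n2 ?_
    rw [value_mul, value_mul, value_refl n1, value_refl n1, t2, t5]
    exact h1.trans h2
  have a3 : length (y * refl p q * refl q j) < length (y * refl p q * refl q j * refl p q) := by
    refine lt_length_mul_refl hpq n1 ?_
    rw [value_mul, value_mul, value_mul, value_mul, value_refl n2, value_refl n2, t3, t6,
      value_refl n1, value_refl n1, t1, t5]
    exact h2
  have e : (refl p q * refl q j * refl p q : W n) = refl p j := by
    rw [mul_refl (refl p q) q j, value_refl n1, value_refl n1, t2, t5, mul_assoc,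
      refl_mul_self, mul_one]
  rw [mul_assoc, mul_assoc y (_ * _), e] at a3
  rw [mul_assoc] at a2
  omega

/-- A substitute for t_{pq} t_{qj} t_{pq} = t_{pj} when q is congruent to p or j: all factors
exchange the same two residue classes. -/
theorem refl_mul_refl_mul_refl {p j : ℤ} (h : (p : ZMod n) ≠ j) (x : ℤ) :
    (refl p (j - n) * refl p (j + x * n) * refl p (j + (x + 1) * n) : W n) = refl p j := by
  have c1 : ((j - n : ℤ) : ZMod n) = j := by simp
  have c2 : ∀ y : ℤ, ((j + y * n : ℤ) : ZMod n) = j := fun y => by simp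
  refine ext_value fun k => ?_
  rw [value_mul, value_mul, value_refl (by rwa [c1]), value_refl (by rwa [c2]),
    value_refl (by rwa [c2]), value_refl h]
  by_cases hp : (p : ZMod n) = k
  · obtain ⟨m, rfl⟩ := exists_eq_add_mul hp
    rw [transposition_left, transposition_left,
      show j + (x + 1) * n + m * n = j + x * n + (m + 1) * (n : ℤ) by ring,
      transposition_right (by rwa [c2]), transposition_left]
    ring
  by_cases hj : (j : ZMod n) = k
  · obtain ⟨m, rfl⟩ := exists_eq_add_mul hj
    rw [transposition_right h,
      show j + m * n = j + (x + 1) * n + (m - x - 1) * (n : ℤ) by ring,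
      transposition_right (by rwa [c2]), transposition_left,
      show j + x * n + (m - x - 1) * n = (j - n) + m * (n : ℤ) by ring,
      transposition_right (by rwa [c1])]
  · have hp' := Ne.symm hp
    have hj' := Ne.symm hj
    have e : ∀ y : ℤ, transposition n p (j + y * n) k = k := fun y =>
      transposition_of_ne hp' (by rwa [c2])
    rw [e, e, transposition_of_ne hp' hj', transposition_of_ne hp' (by rwa [c1])]

theorem length_add_three_le_of_period_lt {y : W n} {p j : ℤ} (hpj : (n : ℤ) < j - p)
    (h : (n : ℤ) < value y j - value y p) (h3 : (p : ZMod n) ≠ j) :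
    length y + 3 ≤ length (y * refl p j) := by
  have hn := period_pos (n := n)
  have c1 : ((j - n : ℤ) : ZMod n) = j := by simp
  have c2 : ∀ y : ℤ, ((j + y * n : ℤ) : ZMod n) = j := fun y => by simp
  have v3 : (value y p : ZMod n) ≠ value y j := fun e => h3 ((value_cast_eq_iff y).1 e)
  -- The factorization `refl_mul_refl_mul_refl` is used with this x. The lower bound makes its
  -- second factor raise the length, the upper bound its third. Such an x exists because n does not
  -- divide the difference of the values.
  obtain ⟨x, hx0, hx1, hx2⟩ : ∃ x : ℤ, 0 ≤ x ∧ value y j - value y p - 2 * n < x * n ∧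
      x * n < value y j - value y p - n := by
    set D := value y j - value y p with hD
    have hm := Int.emod_add_mul_ediv D n
    have hr : D % n ≠ 0 := by
      intro h0
      have hd : (n : ℤ) ∣ value y j - value y p := Int.dvd_of_emod_eq_zero h0
      exact v3 ((ZMod.intCast_eq_intCast_iff_dvd_sub _ _ n).2 hd)
    have hr0 := Int.emod_nonneg D (show (n : ℤ) ≠ 0 by omega)
    have hr1 := Int.emod_lt_of_pos D (show (0 : ℤ) < n by omega)
    refine ⟨D / n - 1, ?_, ?_, ?_⟩
    · have : 1 ≤ D / n := (Int.le_ediv_iff_mul_le (by omega)).2 (by omega)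
      omega
    · nlinarith
    · have : 0 < D % n := by omega
      nlinarith
  have a1 : length y < length (y * refl p (j - n)) := by
    refine lt_length_mul_refl (by omega) (by rwa [c1]) ?_
    have := value_add_mul_period y j (-1)
    rw [show j + -1 * (n : ℤ) = j - n by ring] at this
    rw [this]; linarith
  have hxn : 0 ≤ x * n := mul_nonneg hx0 (by omega)
  have t1 := transposition_left (n := n) p (j - n) 0
  simp only [zero_mul, add_zero] at t1
  have t2 : ∀ z : ℤ, transposition n p (j - n) (j + z * n) = p + (z + 1) * n := fun z => by
    have := transposition_right (n := n) (i := p) (j := j - n) (by rwa [c1]) (z + 1)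
    rwa [show j - n + (z + 1) * n = j + z * (n : ℤ) by ring] at this
  have t3 := transposition_left (n := n) p (j + x * n) 0
  simp only [zero_mul, add_zero] at t3
  have t4 : transposition n p (j + x * n) (j + (x + 1) * n) = p + 1 * n := by
    rw [← transposition_right (n := n) (i := p) (j := j + x * n) (by rwa [c2]) 1]; congr 1; ring
  have vj : value y (j - n) = value y j - n := by
    have := value_add_mul_period y j (-1)
    rw [show j + -1 * (n : ℤ) = j - n by ring] at this
    rw [this]; ring
  have a2 : length (y * refl p (j - n)) < length (y * refl p (j - n) * refl p (j + x * n)) := by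
    refine lt_length_mul_refl (by linarith) (by rwa [c2]) ?_
    rw [value_mul, value_mul, value_refl (by rwa [c1]), value_refl (by rwa [c1]), t1, t2,
      value_add_mul_period, vj]
    linarith
  have a3 : length (y * refl p (j - n) * refl p (j + x * n)) <
      length (y * refl p (j - n) * refl p (j + x * n) * refl p (j + (x + 1) * n)) := by
    refine lt_length_mul_refl (by linarith) (by rwa [c2]) ?_
    have r1 : ∀ k, value (refl p (j - n) : W n) k = _ := value_refl (by rwa [c1])
    have r2 : ∀ k, value (refl p (j + x * n) : W n) k = _ := value_refl (by rwa [c2])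
    rw [value_mul, value_mul, value_mul, value_mul, r2, r2, t3, t4, r1, r1, t2, transposition_left,
      value_add_mul_period, value_add_mul_period, vj]
    linarith
  have e := refl_mul_refl_mul_refl h3 x
  rw [mul_assoc, mul_assoc y (_ * _), e] at a3
  rw [mul_assoc] at a2
  omega

/-- If `y = t_{ab} w` is covered by `w`, then no value of `y` between `a` and `b` has its position
between those of `a` and `b`. -/
theorem not_between_of_cover {w : W n} {a b q : ℤ}
    (h : length (refl a b * w) + 1 = length w) (hq1 : pos w b < q) (hq2 : q < pos w a)
    (hv1 : a < value (refl a b * w) q) (hv2 : value (refl a b * w) q < b) : False := by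
  have hne := cast_ne_of_cover h
  set y := refl a b * w with hy
  have hpy : ∀ c, pos y c = pos w (transposition n a b c) := fun c => pos_refl_mul hne w c
  have t1 := transposition_left (n := n) a b 0
  have t2 := transposition_right hne 0
  simp only [zero_mul, add_zero] at t1 t2
  have hp : pos y a = pos w b := by rw [hpy, t1]
  have hj : pos y b = pos w a := by rw [hpy, t2]
  have hvp : value y (pos w b) = a := by rw [← hp, value_pos]
  have hvj : value y (pos w a) = b := by rw [← hj, value_pos]
  have hw : y * refl (pos w b) (pos w a) = w := by
    rw [mul_refl, hvp, hvj, hy, refl_mul_refl_mul]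
  have n3 : (pos w b : ZMod n) ≠ pos w a := fun e => hne ((pos_cast_eq_iff w).1 e).symm
  have hn := period_pos (n := n)
  have key : (n : ℤ) < pos w a - pos w b → (n : ℤ) < b - a → False := by
    intro h1 h2
    have := length_add_three_le_of_period_lt (y := y) h1 (by rwa [hvp, hvj]) n3
    rw [hw] at this
    omega
  -- A position strictly between the ends and congruent to one of them forces the gaps in position
  -- and in value both to exceed n, which is the case settled by `key`.
  by_cases e1 : (pos w b : ZMod n) = q
  · obtain ⟨m, rfl⟩ := exists_eq_add_mul e1
    rw [value_add_mul_period, hvp] at hv1 hv2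
    have hm : 0 < m := by nlinarith
    exact key (by nlinarith) (by nlinarith)
  by_cases e2 : (q : ZMod n) = pos w a
  · obtain ⟨m, hm⟩ := exists_eq_add_mul e2.symm
    rw [hm, value_add_mul_period, hvj] at hv1 hv2
    have hm : m < 0 := by nlinarith
    exact key (by nlinarith) (by nlinarith)
  have := length_add_three_le (y := y) hq1 hq2 (by rwa [hvp]) (by rwa [hvj]) e1 e2 n3
  rw [hw] at this
  omega

/-! ### Marked covers in terms of values -/

/-- `y = t_{cb} w` is covered by `w`, the value `c` has positive position in `w`, and `b` has
non-positive position. -/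
def Cov (c : ℤ) (w y : W n) : Prop :=
  ∃ b, 0 < pos w c ∧ pos w b ≤ 0 ∧ y = refl c b * w ∧ length (refl c b * w) + 1 = length w

theorem transposition_left_self (a b : ℤ) : transposition n a b a = b := by
  simpa using transposition_left (n := n) a b 0

theorem transposition_right_self {a b : ℤ} (h : (a : ZMod n) ≠ b) : transposition n a b b = a := by
  simpa using transposition_right h 0

theorem pos_refl_mul_left {w : W n} {a b : ℤ} (h : (a : ZMod n) ≠ b) :
    pos (refl a b * w) a = pos w b := by
  rw [pos_refl_mul h, transposition_left_self]

theorem pos_refl_mul_right {w : W n} {a b : ℤ} (h : (a : ZMod n) ≠ b) :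
    pos (refl a b * w) b = pos w a := by
  rw [pos_refl_mul h, transposition_right_self h]

theorem pos_refl_mul_of_ne {w : W n} {a b c : ℤ} (h : (a : ZMod n) ≠ b) (ha : (c : ZMod n) ≠ a)
    (hb : (c : ZMod n) ≠ b) : pos (refl a b * w) c = pos w c := by
  rw [pos_refl_mul h, transposition_of_ne ha hb]

theorem lt_of_cover {w : W n} {c b : ℤ} (hc : 0 < pos w c) (hb : pos w b ≤ 0)
    (h : length (refl c b * w) + 1 = length w) : c < b := by
  have hne := cast_ne_of_cover h
  by_contra hlt
  have hlt' : b < c := lt_of_le_of_ne (not_lt.1 hlt) (ne_of_cast_ne hne).symm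
  have := lt_length_refl_mul (w := w) hlt' hne.symm (by omega)
  rw [refl_comm] at this
  omega

theorem bruhatCover_of_refl {w : W n} {a b : ℤ} (h : length (refl a b * w) + 1 = length w) :
    BruhatCover (refl a b * w) w := by
  obtain ⟨l, hl⟩ := exists_reducedWord w
  obtain ⟨l₁, i, l₂, rfl, e⟩ := strong_exchange_of_cover h hl.1
  refine ⟨⟨l₁ ++ l₂, _, ⟨e.symm, ?_⟩, hl, ?_⟩, h⟩
  · have := hl.2
    simp only [List.length_append, List.length_cons] at this ⊢
    omega
  · exact List.Sublist.append_left (List.sublist_cons_self i l₂) l₁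

/-- The indices i ≤ 0 < j are the positions in w of b and c. In terms of values, a cover with
marking c carries c from a positive to a non-positive position, and left multiplication by s_i acts
directly on such data. -/
theorem markedStrongCover_iff {c : ℤ} {w y : W n} : MarkedStrongCover w c y ↔ Cov c w y := by
  constructor
  · rintro ⟨⟨-, hlen⟩, i, j, hi, hj, hij, hv, h1, h2⟩
    have e : w = y * refl i j := ext_value fun k => by rw [value_mul, value_refl hij, hv]
    have e1 : y = refl (value w j) (value w i) * w := by
      rw [← mul_refl, e, mul_assoc, refl_comm j i, refl_mul_self, mul_one]
    rw [h1]
    exact ⟨value w i, by rwa [pos_value], by rwa [pos_value], e1, by rwa [← e1]⟩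
  · rintro ⟨b, hc, hb, rfl, h⟩
    have hne := cast_ne_of_cover h
    refine ⟨bruhatCover_of_refl h, pos w b, pos w c, hb, hc, ?_, ?_, ?_, ?_⟩
    · exact fun e => hne ((pos_cast_eq_iff w).1 e).symm
    · intro k
      rw [value_mul, value_transposition w (fun e => hne ((pos_cast_eq_iff w).1 e).symm),
        value_pos, value_pos, value_refl hne, transposition_comm hne.symm,
        transposition_involutive hne]
    · rw [value_pos]
    · rw [value_mul, value_pos, value_refl hne, transposition_right_self hne]

theorem Cov.pos_pos {c : ℤ} {w y : W n} (h : Cov c w y) : 0 < pos w c := h.choose_spec.1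

theorem Cov.length_eq {c : ℤ} {w y : W n} (h : Cov c w y) : length y + 1 = length w := by
  obtain ⟨b, -, -, rfl, h⟩ := h
  exact h

theorem Cov.pos_nonpos {c : ℤ} {w y : W n} (h : Cov c w y) : pos y c ≤ 0 := by
  obtain ⟨b, -, hb, rfl, h⟩ := h
  rwa [pos_refl_mul_left (cast_ne_of_cover h)]

theorem Cov.lt_length {c : ℤ} {w y : W n} (h : Cov c w y) : c < length w := by
  obtain ⟨b, hc, hb, rfl, h⟩ := h
  have h1 := lt_of_cover hc hb h
  by_contra hlt
  have := pos_pos_of_length_lt (w := w) (a := b) (by omega)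
  omega

theorem Cov.neg_length_lt {c : ℤ} {w y : W n} (h : Cov c w y) : -length w < c := by
  by_contra hlt
  have := pos_nonpos_of_le_neg_length (w := w) (a := c) (by omega)
  have := h.pos_pos
  omega

theorem finite_cov (c : ℤ) (w : W n) : {y | Cov c w y}.Finite := by
  refine ((Set.finite_Icc c (length w)).image fun b => refl c b * w).subset ?_
  rintro y ⟨b, hc, hb, rfl, h⟩
  have h1 := lt_of_cover hc hb h
  refine ⟨b, ⟨h1.le, ?_⟩, rfl⟩
  by_contra hlt
  have := pos_pos_of_length_lt (w := w) (a := b) (by omega)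
  omega

/-- The finite set of all `y` covered by `w` with marking `c`. -/
def covers (c : ℤ) (w : W n) : Finset (W n) := (finite_cov c w).toFinset

theorem mem_covers {c : ℤ} {w y : W n} : y ∈ covers c w ↔ Cov c w y := by simp [covers]

/-! ### Marked covers under left multiplication by a simple reflection -/

theorem cov_s_mul_self_iff {c : ℤ} {i : ZMod n} {w : W n} :
    Cov c w (s i * w) ↔ (c : ZMod n) = i ∧ 0 < pos w c ∧ pos w (c + 1) ≤ 0 := by
  constructor
  · rintro ⟨b, hc, hb, e, h⟩
    have hne := cast_ne_of_cover h
    have hlt := lt_of_cover hc hb h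
    have e' : s i = refl c b := mul_right_cancel e
    have hv := congrArg (fun v : W n => value v c) e'
    simp only [value_s, value_refl hne, transposition_left_self] at hv
    unfold simpleFun at hv
    split_ifs at hv with h1 h2
    · subst hv; exact ⟨h1, hc, hb⟩
    · omega
    · omega
  · rintro ⟨rfl, hc, hb⟩
    refine ⟨c + 1, hc, hb, by rw [refl_succ], ?_⟩
    rw [refl_succ]
    exact length_of_not_ascent ((not_ascent_iff c w).2 (by omega))

theorem cov_of_not_ascent {c : ℤ} {i : ZMod n} {w y : W n} (h : Cov c w y) (hw : ¬ Ascent i w)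
    (hy : Ascent i y) : y = s i * w := by
  obtain ⟨b, -, -, rfl, h⟩ := h
  by_contra hne
  exact not_ascent_of_cover hw h hne hy

/-- Multiplication by s_i matches covers of s_i w with covers of w, the marking changing from c to
s_i(c). By the lifting property the only cover of s_i w that can escape is w itself. -/
theorem cov_s_mul_iff {c : ℤ} {i : ZMod n} {w y : W n} (hw : Ascent i w) :
    (Cov c (s i * w) y ∧ y ≠ w) ↔ (Cov (simpleFun n i c) w (s i * y) ∧ Ascent i (s i * y)) := by
  have hl := length_of_ascent hw
  constructor
  · rintro ⟨h, hne⟩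
    have hy : ¬ Ascent i y := fun hy => hne (by
      rw [cov_of_not_ascent h ((ascent_s_mul_iff i _).not.2 (not_not.2 hw)) hy, s_mul_s_mul])
    refine ⟨?_, (ascent_s_mul_iff i y).2 hy⟩
    obtain ⟨b, hc, hb, rfl, h⟩ := h
    have e : s i * (refl c b * (s i * w)) =
        refl (simpleFun n i c) (simpleFun n i b) * w := by
      rw [← mul_assoc, s_mul_refl, mul_assoc, s_mul_s_mul]
    have h2 := length_of_not_ascent hy
    rw [pos_s_mul] at hc hb
    refine ⟨simpleFun n i b, hc, hb, e, ?_⟩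
    rw [← e]; omega
  · rintro ⟨⟨b, hc, hb, e, h⟩, hy⟩
    have e' : y = refl c (simpleFun n i b) * (s i * w) := by
      have := congrArg (fun v => s i * v) e
      simp only [s_mul_s_mul] at this
      rw [this, ← mul_assoc, s_mul_refl, simpleFun_involutive, mul_assoc]
    refine ⟨⟨simpleFun n i b, ?_, ?_, e', ?_⟩, ?_⟩
    · rwa [pos_s_mul]
    · rwa [pos_s_mul, simpleFun_involutive]
    · have h2 := length_of_ascent hy
      rw [s_mul_s_mul] at h2
      rw [← e', h2, e, h, hl]
    · rintro rfl
      exact (ascent_s_mul_iff i y).1 hy hw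

/-- In w the value k + 1 stands to the right of k, hence at a positive position, and usually the
cover does not move it. If b ≡ k + 1, then k + 1 = b + mn, and the order of k and k + 1 in w forces
m > 0, so its new position pos(k) + mn is again positive. -/
theorem pos_succ_pos_of_cov {k : ℤ} {w y : W n} (h : Cov k w y) (hw : Ascent (k : ZMod n) w) :
    0 < pos y (k + 1) := by
  rw [ascent_iff] at hw
  obtain ⟨b, hc, hb, rfl, h⟩ := h
  have hne := cast_ne_of_cover h
  by_cases hb' : (b : ZMod n) = ((k + 1 : ℤ) : ZMod n)
  · obtain ⟨m, hm⟩ := exists_eq_add_mul hb'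
    rw [pos_refl_mul hne, hm, transposition_right hne, pos_add_mul]
    rw [hm, pos_add_mul] at hw
    omega
  · rw [pos_refl_mul_of_ne hne _ (Ne.symm hb')]
    · omega
    · push_cast; exact zmod_succ_ne _

/-- In y the value k stands to the left of k + 1, which has just become non-positive. If k were
positive in w, the cover would have to move it, so b ≡ k; periodicity then gives k a positive
position in y, a contradiction. -/
theorem pos_nonpos_of_cov_succ {k : ℤ} {w y : W n} (h : Cov (k + 1) w y)
    (hy : Ascent (k : ZMod n) y) : pos y k ≤ 0 ∧ pos w k ≤ 0 := by
  have h1 := h.pos_nonpos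
  have hy' := (ascent_iff k y).1 hy
  refine ⟨by omega, ?_⟩
  have hw : Ascent (k : ZMod n) w := by
    by_contra hw
    have e := cov_of_not_ascent h hw hy
    rw [e, cov_s_mul_self_iff] at h
    have := h.1
    push_cast at this
    exact zmod_succ_ne _ this
  rw [ascent_iff] at hw
  by_contra hk
  obtain ⟨b, hc, hb, rfl, h⟩ := h
  have hne := cast_ne_of_cover h
  rw [pos_refl_mul_left hne] at hy' h1
  by_cases hb' : (b : ZMod n) = (k : ZMod n)
  · obtain ⟨m, hm⟩ := exists_eq_add_mul hb'
    have ht := transposition_right hne m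
    rw [← hm] at ht
    rw [pos_refl_mul hne, ht, pos_add_mul] at hy'
    rw [hm, pos_add_mul] at hk
    omega
  · rw [pos_refl_mul_of_ne hne _ (Ne.symm hb')] at hy'
    · omega
    · push_cast; exact (zmod_succ_ne _).symm

/-- Let b₁ and b₂ be the values exchanged with k and k + 1. If b₂ < b₁, the value b₂ lies between k
and b₁ in y, both in size and in position, so the first step is not a cover. If b₁ < b₂, the value
b₁ obstructs the second step in the same way. -/
theorem not_cov_cov_succ {k : ℤ} {w y z : W n} (h1 : Cov k w y) (h2 : Cov (k + 1) y z)
    (hw : Ascent (k : ZMod n) w) (hz : Ascent (k : ZMod n) z) : False := by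
  have hn := period_pos (n := n)
  have hkk : ((k + 1 : ℤ) : ZMod n) ≠ (k : ZMod n) := by push_cast; exact zmod_succ_ne _
  have hw' := (ascent_iff k w).1 hw
  have hz' := (ascent_iff k z).1 hz
  obtain ⟨b₁, hc1, hb1, rfl, h1⟩ := h1
  have ne1 := cast_ne_of_cover h1
  have lt1 := lt_of_cover hc1 hb1 h1
  set y := refl k b₁ * w with hy
  have yk : pos y k = pos w b₁ := pos_refl_mul_left ne1
  have yb : pos y b₁ = pos w k := pos_refl_mul_right ne1
  obtain ⟨b₂, hc2, hb2, rfl, h2⟩ := h2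
  have ne2 := cast_ne_of_cover h2
  have lt2 := lt_of_cover hc2 hb2 h2
  rw [pos_refl_mul_left ne2] at hz'
  -- The ascent of z at k says exactly this unless k ≡ b₂; in that case b₂ is a positive translate
  -- of k, and y has k at position `pos w b₁`.
  have hp : pos w b₁ < pos y b₂ := by
    by_cases e : (k : ZMod n) = (b₂ : ZMod n)
    · obtain ⟨m, hm⟩ := exists_eq_add_mul e
      rw [hm, pos_add_mul, yk]
      omega
    · rw [pos_refl_mul_of_ne ne2 hkk.symm e, yk] at hz'
      exact hz'
  have hbb : b₂ < b₁ := by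
    by_cases e : (b₂ : ZMod n) = (b₁ : ZMod n)
    · obtain ⟨m, hm⟩ := exists_eq_add_mul e
      rw [hm, pos_add_mul] at yb
      omega
    · by_contra hlt
      have hlt : b₁ < b₂ := lt_of_le_of_ne (not_lt.1 hlt) (ne_of_cast_ne e).symm
      have e1 : (b₁ : ZMod n) ≠ ((k + 1 : ℤ) : ZMod n) := by
        intro e1
        obtain ⟨m, hm⟩ := exists_eq_add_mul e1
        rw [hm, pos_add_mul] at hw'
        omega
      have yk1 : pos y (k + 1) = pos w (k + 1) := pos_refl_mul_of_ne ne1 hkk e1.symm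
      have zb : pos (refl (k + 1) b₂ * y) b₁ = pos w k := by
        rw [pos_refl_mul_of_ne ne2 e1 (Ne.symm e), yb]
      have zv : value (refl (k + 1) b₂ * y) (pos w k) = b₁ := by rw [← zb, value_pos]
      have hb1k := ne_of_cast_ne e1
      exact not_between_of_cover h2 (q := pos w k) (by omega) (by rw [yk1]; exact hw')
        (by rw [zv]; omega) (by rw [zv]; exact hlt)
  have yv : value y (pos y b₂) = b₂ := value_pos _ _
  exact not_between_of_cover h1 (q := pos y b₂) hp (by omega) (by rw [yv]; omega)
    (by rw [yv]; exact hbb)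

/-! ### Operators on the free module with basis the affine symmetric group -/

variable {R : Type*} [CommRing R]

/-- The basis element of `w`. -/
def bas (R : Type*) [CommRing R] (w : W n) : W n →₀ R := Finsupp.single w 1

theorem end_ext {f g : Module.End R (W n →₀ R)} (h : ∀ w, f (bas R w) = g (bas R w)) : f = g := by
  refine Finsupp.lhom_ext' fun w => LinearMap.ext_ring ?_
  exact h w

/-- The linear endomorphism with prescribed values on the basis. -/
def opOf (f : W n → (W n →₀ R)) : Module.End R (W n →₀ R) := Finsupp.linearCombination R f

theorem opOf_bas (f : W n → (W n →₀ R)) (w : W n) : opOf f (bas R w) = f w := by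
  simp [opOf, bas]

open Classical in
/-- Left multiplication by `A_i` in the basis of the `A_w`. -/
def upOp (R : Type*) [CommRing R] (i : ZMod n) : Module.End R (W n →₀ R) :=
  opOf fun w => if Ascent i w then bas R (s i * w) else 0

/-- The projection to the span of all `w` in which the value `c` has positive position. -/
def posOp (n : ℕ) [n.AtLeastTwo] (R : Type*) [CommRing R] (c : ℤ) :
    Module.End R (W n →₀ R) :=
  opOf fun w => if 0 < pos w c then bas R w else 0

/-- The sum over all covers with marking `c`. -/
def covOp (n : ℕ) [n.AtLeastTwo] (R : Type*) [CommRing R] (c : ℤ) :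
    Module.End R (W n →₀ R) :=
  opOf fun w => ∑ y ∈ covers c w, bas R y

theorem upOp_of_ascent {i : ZMod n} {w : W n} (h : Ascent i w) :
    upOp R i (bas R w) = bas R (s i * w) := by rw [upOp, opOf_bas, if_pos h]

theorem upOp_of_not_ascent {i : ZMod n} {w : W n} (h : ¬ Ascent i w) :
    upOp R i (bas R w) = 0 := by rw [upOp, opOf_bas, if_neg h]

theorem posOp_of_pos {c : ℤ} {w : W n} (h : 0 < pos w c) : posOp n R c (bas R w) = bas R w := by
  rw [posOp, opOf_bas, if_pos h]

theorem posOp_of_nonpos {c : ℤ} {w : W n} (h : pos w c ≤ 0) : posOp n R c (bas R w) = 0 := by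
  rw [posOp, opOf_bas, if_neg (not_lt.2 h)]

theorem covOp_bas (c : ℤ) (w : W n) : covOp n R c (bas R w) = ∑ y ∈ covers c w, bas R y := by
  rw [covOp, opOf_bas]

theorem covOp_of_nonpos {c : ℤ} {w : W n} (h : pos w c ≤ 0) : covOp n R c (bas R w) = 0 := by
  rw [covOp_bas]
  refine Finset.sum_eq_zero fun y hy => ?_
  have := (mem_covers.1 hy).pos_pos
  omega

theorem upOp_mul_upOp (i : ZMod n) : upOp R i * upOp R i = 0 := by
  refine end_ext fun w => ?_
  rw [Module.End.mul_apply]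
  by_cases h : Ascent i w
  · rw [upOp_of_ascent h, upOp_of_not_ascent ((ascent_s_mul_iff i w).not.2 (not_not.2 h))]; rfl
  · rw [upOp_of_not_ascent h, map_zero]; rfl

theorem posOp_comm (c d : ℤ) : posOp n R c * posOp n R d = posOp n R d * posOp n R c := by
  refine end_ext fun w => ?_
  simp only [Module.End.mul_apply]
  rcases lt_or_ge 0 (pos w c) with h | h <;> rcases lt_or_ge 0 (pos w d) with h' | h' <;>
    simp [posOp_of_pos, posOp_of_nonpos, h, h']

theorem posOp_mul_self (c : ℤ) : posOp n R c * posOp n R c = posOp n R c := by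
  refine end_ext fun w => ?_
  simp only [Module.End.mul_apply]
  rcases lt_or_ge 0 (pos w c) with h | h <;> simp [posOp_of_pos, posOp_of_nonpos, h]

theorem covOp_mul_posOp (c : ℤ) : covOp n R c * posOp n R c = covOp n R c := by
  refine end_ext fun w => ?_
  simp only [Module.End.mul_apply]
  rcases lt_or_ge 0 (pos w c) with h | h
  · rw [posOp_of_pos h]
  · rw [posOp_of_nonpos h, covOp_of_nonpos h, map_zero]

theorem posOp_mul_covOp (c : ℤ) : posOp n R c * covOp n R c = 0 := by
  refine end_ext fun w => ?_
  rw [Module.End.mul_apply, covOp_bas, map_sum]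
  refine Finset.sum_eq_zero fun y hy => ?_
  exact posOp_of_nonpos (mem_covers.1 hy).pos_nonpos

theorem posOp_mul_upOp (c : ℤ) (i : ZMod n) :
    posOp n R c * upOp R i = upOp R i * posOp n R (simpleFun n i c) := by
  refine end_ext fun w => ?_
  simp only [Module.End.mul_apply]
  by_cases h : Ascent i w
  · rcases lt_or_ge 0 (pos w (simpleFun n i c)) with h' | h'
    · rw [upOp_of_ascent h, posOp_of_pos (by rwa [pos_s_mul]), posOp_of_pos h', upOp_of_ascent h]
    · rw [upOp_of_ascent h, posOp_of_nonpos (by rwa [pos_s_mul]), posOp_of_nonpos h', map_zero]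
  · rw [upOp_of_not_ascent h, map_zero]
    rcases lt_or_ge 0 (pos w (simpleFun n i c)) with h' | h'
    · rw [posOp_of_pos h', upOp_of_not_ascent h]
    · rw [posOp_of_nonpos h', map_zero]

/-- The projection to the span of all `w` with `pos w c ≤ 0 < pos w d`. -/
def sepOp (n : ℕ) [n.AtLeastTwo] (R : Type*) [CommRing R] (c d : ℤ) : Module.End R (W n →₀ R) :=
  (1 - posOp n R c) * posOp n R d

theorem sepOp_of {c d : ℤ} {w : W n} (hc : pos w c ≤ 0) (hd : 0 < pos w d) :
    sepOp n R c d (bas R w) = bas R w := by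
  simp [sepOp, Module.End.mul_apply, posOp_of_pos hd, posOp_of_nonpos hc]

theorem sepOp_of_not {c d : ℤ} {w : W n} (h : ¬ (pos w c ≤ 0 ∧ 0 < pos w d)) :
    sepOp n R c d (bas R w) = 0 := by
  rcases lt_or_ge 0 (pos w d) with hd | hd
  · have hc : 0 < pos w c := by by_contra hc; exact h ⟨by omega, hd⟩
    simp [sepOp, Module.End.mul_apply, posOp_of_pos hd, posOp_of_pos hc]
  · simp [sepOp, Module.End.mul_apply, posOp_of_nonpos hd]

open Classical in
theorem upOp_covOp_bas (i : ZMod n) (c : ℤ) (w : W n) :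
    upOp R i (covOp n R c (bas R w)) =
      ∑ y ∈ covers c w with Ascent i y, bas R (s i * y) := by
  rw [covOp_bas, map_sum, Finset.sum_filter]
  refine Finset.sum_congr rfl fun y _ => ?_
  by_cases h : Ascent i y
  · rw [upOp_of_ascent h, if_pos h]
  · rw [upOp_of_not_ascent h, if_neg h]

theorem upOp_covOp_of_not_ascent {i : ZMod n} {c : ℤ} {w : W n} (hw : ¬ Ascent i w)
    (h : ¬ Cov c w (s i * w)) : upOp R i (covOp n R c (bas R w)) = 0 := by
  classical
  rw [upOp_covOp_bas]
  refine Finset.sum_eq_zero fun y hy => ?_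
  rw [Finset.mem_filter, mem_covers] at hy
  have e := cov_of_not_ascent hy.1 hw hy.2
  exact absurd (e ▸ hy.1) h

theorem upOp_covOp_of_cov {i : ZMod n} {c : ℤ} {w : W n} (h : Cov c w (s i * w)) :
    upOp R i (covOp n R c (bas R w)) = bas R w := by
  classical
  have hw : ¬ Ascent i w := fun hw => by
    have := length_of_ascent hw
    have := h.length_eq
    omega
  rw [upOp_covOp_bas, Finset.sum_eq_single (s i * w), s_mul_s_mul]
  · intro y hy hne
    rw [Finset.mem_filter, mem_covers] at hy
    exact absurd (cov_of_not_ascent hy.1 hw hy.2) hne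
  · intro hn
    exact absurd (Finset.mem_filter.2 ⟨mem_covers.2 h, (ascent_s_mul_iff i w).2 hw⟩) hn

-- Apart from the correction terms this is the matching `cov_s_mul_iff`. If w has an ascent at i,
-- the cover from s_i w back to w is the unmatched term on the left (c ≡ i). If w has a descent, A_i
-- kills w, while the cover s_i w of w may still contribute on the right (c ≡ i + 1).
open Classical in
theorem covOp_mul_upOp (c : ℤ) (i : ZMod n) :
    covOp n R c * upOp R i = upOp R i * covOp n R (simpleFun n i c)
      + (if (c : ZMod n) = i then sepOp n R c (c + 1) else 0)
      - (if (c : ZMod n) = i + 1 then sepOp n R c (c - 1) else 0) := by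
  refine end_ext fun w => ?_
  simp only [Module.End.mul_apply, LinearMap.add_apply, LinearMap.sub_apply]
  by_cases hw : Ascent i w
  · have h2 : (if (c : ZMod n) = i + 1 then sepOp n R c (c - 1) else 0) (bas R w) = 0 := by
      split_ifs with hc
      · refine sepOp_of_not fun h => ?_
        have : i = ((c - 1 : ℤ) : ZMod n) := by push_cast; rw [hc]; ring
        rw [this, ascent_iff, sub_add_cancel] at hw
        omega
      · rfl
    have h1 : (if (c : ZMod n) = i then sepOp n R c (c + 1) else 0) (bas R w) =
        if Cov c (s i * w) w then bas R w else 0 := by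
      have hiff := cov_s_mul_self_iff (c := c) (i := i) (w := s i * w)
      rw [s_mul_s_mul, pos_s_mul, pos_s_mul] at hiff
      by_cases hc : (c : ZMod n) = i
      · rw [if_pos hc]
        rw [← hc, simpleFun_left, simpleFun_right] at hiff
        by_cases hs : pos w c ≤ 0 ∧ 0 < pos w (c + 1)
        · rw [sepOp_of hs.1 hs.2, if_pos]
          rw [← hc]; exact hiff.2 ⟨rfl, hs.2, hs.1⟩
        · rw [sepOp_of_not hs, if_neg]
          rw [← hc, hiff]; tauto
      · rw [if_neg hc, if_neg (fun h => hc (hiff.1 h).1)]; rfl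
    rw [h1, h2, sub_zero, upOp_of_ascent hw, covOp_bas, upOp_covOp_bas]
    have h3 : ∑ y ∈ (covers c (s i * w)).erase w, bas R y =
        ∑ y ∈ covers (simpleFun n i c) w with Ascent i y, bas R (s i * y) := by
      refine Finset.sum_nbij' (fun y => s i * y) (fun y => s i * y) ?_ ?_ ?_ ?_ ?_
      · intro y hy
        rw [Finset.mem_erase, mem_covers] at hy
        rw [Finset.mem_filter, mem_covers]
        exact (cov_s_mul_iff hw).1 hy.symm
      · intro y hy
        rw [Finset.mem_filter, mem_covers] at hy
        rw [Finset.mem_erase, mem_covers]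
        refine ((cov_s_mul_iff hw).2 ?_).symm
        rwa [s_mul_s_mul]
      · intro y _; exact s_mul_s_mul i y
      · intro y _; exact s_mul_s_mul i y
      · intro y _; rw [s_mul_s_mul]
    rw [← h3]
    split_ifs with hc
    · rw [add_comm, Finset.add_sum_erase _ _ (mem_covers.2 hc)]
    · rw [Finset.erase_eq_of_notMem (fun h => hc (mem_covers.1 h)), add_zero]
  · rw [upOp_of_not_ascent hw, map_zero]
    have h1 : (if (c : ZMod n) = i then sepOp n R c (c + 1) else 0) (bas R w) = 0 := by
      split_ifs with hc
      · refine sepOp_of_not fun h => ?_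
        rw [← hc, not_ascent_iff] at hw
        omega
      · rfl
    rw [h1, add_zero, eq_comm, sub_eq_zero]
    have hiff := cov_s_mul_self_iff (c := simpleFun n i c) (i := i) (w := w)
    by_cases hc : (c : ZMod n) = i + 1
    · have hi : i = ((c - 1 : ℤ) : ZMod n) := by push_cast; rw [hc]; ring
      have hf : simpleFun n i c = c - 1 := by
        have := simpleFun_right (n := n) (c - 1)
        rwa [sub_add_cancel, ← hi] at this
      rw [hf, sub_add_cancel] at hiff
      rw [if_pos hc, hf]
      by_cases hs : pos w c ≤ 0 ∧ 0 < pos w (c - 1)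
      · rw [sepOp_of hs.1 hs.2, upOp_covOp_of_cov (hiff.2 ⟨hi.symm, hs.2, hs.1⟩)]
      · rw [sepOp_of_not hs, upOp_covOp_of_not_ascent hw]
        rw [hiff]; tauto
    · rw [if_neg hc, upOp_covOp_of_not_ascent hw]
      · rfl
      · rw [hiff]
        rintro ⟨h, -⟩
        have h' : (simpleFun n i (simpleFun n i c) : ZMod n) = i + 1 := by
          have := value_cast_eq_iff (s i) (k := simpleFun n i c) (l := simpleFun n i c)
          unfold simpleFun at h ⊢
          split_ifs at h ⊢ <;> simp_all
        rw [simpleFun_involutive] at h'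
        exact hc h'

/-- Both sides reduce to a x₂. With a = A_k this gives the relation a x₂ x₁ = (1 - q₂) x₁ on the
image of a, hence on all basis elements with a descent at k, without further study of covers. -/
theorem mul_mul_mul_eq_of_relations {E : Type*} [Ring E] {a x₁ x₂ q₁ q₂ : E} (haa : a * a = 0)
    (h₁ : x₁ * a = a * x₂ + (1 - q₁) * q₂) (h₂ : x₂ * a = a * x₁ - (1 - q₂) * q₁)
    (h₃ : q₂ * a = a * q₁) (h₄ : a * ((1 - q₂) * q₁) = 0) (hq : q₁ * q₂ = q₂ * q₁)
    (hqq : q₂ * q₂ = q₂) (hx : x₂ * q₂ = x₂) (h₅ : a * x₂ * q₁ = 0) (h₆ : a * q₁ * x₂ = 0) :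
    a * x₂ * x₁ * a = (1 - q₂) * x₁ * a := by
  have e₁ : a * x₂ * x₁ * a = a * x₂ := by
    calc a * x₂ * x₁ * a = a * (x₂ * a) * x₂ + a * (x₂ * q₂) - a * x₂ * (q₁ * q₂) := by
          rw [mul_assoc _ x₁ a, h₁]; noncomm_ring
      _ = a * a * x₁ * x₂ - a * ((1 - q₂) * q₁) * x₂ + a * (x₂ * q₂)
          - a * (x₂ * q₂) * q₁ := by
          rw [h₂, hq]; noncomm_ring
      _ = a * x₂ := by rw [haa, h₄, hx, h₅]; noncomm_ring
  have e₂ : (1 - q₂) * x₁ * a = a * x₂ := by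
    calc (1 - q₂) * x₁ * a = a * x₂ - q₂ * a * x₂ + (1 - q₁) * q₂ - q₂ * q₂ + q₂ * q₁ * q₂ := by
          rw [mul_assoc, h₁]; noncomm_ring
      _ = a * x₂ - a * q₁ * x₂ - q₁ * q₂ + q₁ * (q₂ * q₂) := by
          rw [← hq, h₃, hqq]; rw [mul_assoc q₁, hqq]; noncomm_ring
      _ = a * x₂ := by rw [h₆, hqq]; noncomm_ring
  rw [e₁, e₂]

/-! ### Relations between the operators for adjacent values k and k + 1 -/

section Adjacent

variable (k : ℤ)

theorem upOp_mul_sepOp : upOp R (k : ZMod n) * sepOp n R (k + 1) k = 0 := by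
  refine end_ext fun w => ?_
  rw [Module.End.mul_apply]
  by_cases h : pos w (k + 1) ≤ 0 ∧ 0 < pos w k
  · rw [sepOp_of h.1 h.2, upOp_of_not_ascent ((not_ascent_iff k w).2 (by omega))]; rfl
  · rw [sepOp_of_not h, map_zero]; rfl

/-- On an ascent w every cover with marking k keeps k + 1 at a positive position. On a descent A_k
Q_{k+1} = Q_k A_k, and among the covers of w only s_k w survives A_k, which accounts for the extra
projection. -/
theorem upOp_mul_posOp_succ_mul_covOp :
    upOp R (k : ZMod n) * posOp n R (k + 1) * covOp n R k =
      upOp R (k : ZMod n) * covOp n R k * posOp n R (k + 1) + sepOp n R (k + 1) k := by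
  refine end_ext fun w => ?_
  simp only [Module.End.mul_apply, LinearMap.add_apply]
  by_cases hw : Ascent (k : ZMod n) w
  · have hw' := (ascent_iff k w).1 hw
    rw [sepOp_of_not (by omega), add_zero]
    rcases lt_or_ge 0 (pos w k) with hk | hk
    · rw [posOp_of_pos (show 0 < pos w (k + 1) by omega), covOp_bas, map_sum]
      congr 1
      exact Finset.sum_congr rfl fun y hy => posOp_of_pos (pos_succ_pos_of_cov (mem_covers.1 hy) hw)
    · rw [covOp_of_nonpos hk, map_zero, map_zero]
      rcases lt_or_ge 0 (pos w (k + 1)) with h | h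
      · rw [posOp_of_pos h, covOp_of_nonpos hk, map_zero]
      · rw [posOp_of_nonpos h, map_zero, map_zero]
  · have hw' := (not_ascent_iff k w).1 hw
    rw [← Module.End.mul_apply (upOp R _) (posOp n R (k + 1))]
    have e := posOp_mul_upOp (n := n) (R := R) k (k : ZMod n)
    rw [simpleFun_left] at e
    rw [← e, Module.End.mul_apply]
    by_cases h : pos w (k + 1) ≤ 0 ∧ 0 < pos w k
    · rw [sepOp_of h.1 h.2, posOp_of_nonpos h.1, map_zero, map_zero, zero_add,
        upOp_covOp_of_cov (cov_s_mul_self_iff.2 ⟨rfl, h.2, h.1⟩), posOp_of_pos h.2]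
    · have h0 : upOp R (k : ZMod n) (covOp n R k (bas R w)) = 0 :=
        upOp_covOp_of_not_ascent hw (by rw [cov_s_mul_self_iff]; tauto)
      rw [sepOp_of_not h, h0, map_zero, add_zero]
      rcases lt_or_ge 0 (pos w (k + 1)) with h | h
      · rw [posOp_of_pos h, h0]
      · rw [posOp_of_nonpos h, map_zero, map_zero]

theorem upOp_mul_covOp_succ_mul_posOp :
    upOp R (k : ZMod n) * covOp n R (k + 1) * posOp n R k = 0 := by
  classical
  refine end_ext fun w => ?_
  simp only [Module.End.mul_apply]
  rcases lt_or_ge 0 (pos w k) with h | h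
  · rw [posOp_of_pos h, upOp_covOp_bas]
    refine Finset.sum_eq_zero fun y hy => ?_
    rw [Finset.mem_filter, mem_covers] at hy
    have := (pos_nonpos_of_cov_succ hy.1 hy.2).2
    omega
  · rw [posOp_of_nonpos h, map_zero, map_zero]; rfl

theorem upOp_mul_posOp_mul_covOp_succ :
    upOp R (k : ZMod n) * posOp n R k * covOp n R (k + 1) = 0 := by
  refine end_ext fun w => ?_
  simp only [Module.End.mul_apply]
  rw [covOp_bas, map_sum, map_sum]
  refine Finset.sum_eq_zero fun y hy => ?_
  rw [mem_covers] at hy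
  rcases lt_or_ge 0 (pos y k) with h | h
  · rw [posOp_of_pos h, upOp_of_not_ascent]
    intro hy'
    have := (pos_nonpos_of_cov_succ hy hy').1
    omega
  · rw [posOp_of_nonpos h, map_zero]

/-- After a cover with marking k + 1 that value is at a non-positive position. If k is still at a
positive position, then k is a descent of y whose simple cover s_k y has marking k, and A_k X_k
returns y; otherwise X_k kills y. -/
theorem upOp_mul_covOp_mul_covOp_succ :
    upOp R (k : ZMod n) * covOp n R k * covOp n R (k + 1) = posOp n R k * covOp n R (k + 1) := by
  refine end_ext fun w => ?_
  simp only [Module.End.mul_apply]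
  rw [covOp_bas (k + 1), map_sum, map_sum, map_sum]
  refine Finset.sum_congr rfl fun y hy => ?_
  rw [mem_covers] at hy
  rcases lt_or_ge 0 (pos y k) with h | h
  · rw [posOp_of_pos h, upOp_covOp_of_cov (cov_s_mul_self_iff.2 ⟨rfl, h, hy.pos_nonpos⟩)]
  · rw [posOp_of_nonpos h, covOp_of_nonpos h, map_zero]

theorem covOp_mul_upOp_left : covOp n R k * upOp R (k : ZMod n) =
    upOp R (k : ZMod n) * covOp n R (k + 1) + sepOp n R k (k + 1) := by
  rw [covOp_mul_upOp, simpleFun_left, if_pos rfl, if_neg (zmod_succ_ne _).symm]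
  exact sub_zero (G := Module.End R (W n →₀ R)) _

theorem covOp_mul_upOp_right : covOp n R (k + 1) * upOp R (k : ZMod n) =
    upOp R (k : ZMod n) * covOp n R k - sepOp n R (k + 1) k := by
  rw [covOp_mul_upOp, simpleFun_right, if_neg, if_pos, add_zero, add_sub_cancel_right]
  · push_cast; rfl
  · push_cast; exact zmod_succ_ne _

theorem posOp_mul_upOp_left : posOp n R k * upOp R (k : ZMod n) =
    upOp R (k : ZMod n) * posOp n R (k + 1) := by
  rw [posOp_mul_upOp, simpleFun_left]

theorem posOp_mul_upOp_right : posOp n R (k + 1) * upOp R (k : ZMod n) =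
    upOp R (k : ZMod n) * posOp n R k := by
  rw [posOp_mul_upOp, simpleFun_right]

theorem upOp_mul_covOp_succ_mul_covOp_mul_upOp :
    upOp R (k : ZMod n) * covOp n R (k + 1) * covOp n R k * upOp R (k : ZMod n) =
      (1 - posOp n R (k + 1)) * covOp n R k * upOp R (k : ZMod n) :=
  mul_mul_mul_eq_of_relations (E := Module.End R (W n →₀ R)) (upOp_mul_upOp _)
    (covOp_mul_upOp_left k) (covOp_mul_upOp_right k)
    (posOp_mul_upOp_right k) (upOp_mul_sepOp k) (posOp_comm _ _) (posOp_mul_self _)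
    (covOp_mul_posOp _) (upOp_mul_covOp_succ_mul_posOp k) (upOp_mul_posOp_mul_covOp_succ k)

theorem upOp_mul_covOp_succ_mul_covOp :
    upOp R (k : ZMod n) * covOp n R (k + 1) * covOp n R k =
      (1 - posOp n R (k + 1)) * covOp n R k := by
  classical
  refine end_ext fun w => ?_
  by_cases hw : Ascent (k : ZMod n) w
  · simp only [Module.End.mul_apply]
    rw [covOp_bas k, map_sum, map_sum, map_sum]
    refine Finset.sum_congr rfl fun y hy => ?_
    rw [mem_covers] at hy
    rw [LinearMap.sub_apply, posOp_of_pos (pos_succ_pos_of_cov hy hw), Module.End.one_apply,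
      sub_self, upOp_covOp_bas]
    refine Finset.sum_eq_zero fun z hz => ?_
    rw [Finset.mem_filter, mem_covers] at hz
    exact (not_cov_cov_succ hy hz.1 hw hz.2).elim
  -- A descent lies in the image of A_k, where the identity is a formal consequence of the other
  -- relations. Only ascents need `not_cov_cov_succ`, and there both sides vanish.
  · have e : bas R w = upOp R (k : ZMod n) (bas R (s (k : ZMod n) * w)) := by
      rw [upOp_of_ascent ((ascent_s_mul_iff _ w).2 hw), s_mul_s_mul]
    rw [e, ← Module.End.mul_apply, upOp_mul_covOp_succ_mul_covOp_mul_upOp, Module.End.mul_apply]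

end Adjacent

/-! ### The operators `K_c` and the twisted action of simple reflections -/

/-- The operator `K_c = 1 - t e Q_c + t X_c`. -/
def kOp (n : ℕ) [n.AtLeastTwo] (t e : R) (c : ℤ) : Module.End R (W n →₀ R) :=
  1 - (t * e) • posOp n R c + t • covOp n R c

/-- The relations `g₁` to `g₄`, together with the hypotheses, rewrite the words in which a stands
last. After expansion, both sides become the same linear combination of words. -/
theorem pair_mul_eq_of_relations {E : Type*} [Ring E] [Algebra R E] {a x₁ x₂ q₁ q₂ : E}
    (h₁ : x₁ * a = a * x₂ + (1 - q₁) * q₂) (h₂ : x₂ * a = a * x₁ - (1 - q₂) * q₁)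
    (h₃ : q₁ * a = a * q₂) (h₃' : q₂ * a = a * q₁) (hq : q₁ * q₂ = q₂ * q₁) (hqq : q₁ * q₁ = q₁)
    (hx : x₁ * q₁ = x₁) (hx' : q₁ * x₁ = 0)
    (h₄ : a * q₂ * x₁ = a * x₁ * q₂ + (1 - q₂) * q₁)
    (h₅ : a * x₂ * q₁ = 0) (h₆ : a * q₁ * x₂ = 0)
    (h₇ : a * x₁ * x₂ = q₁ * x₂) (h₈ : a * x₂ * x₁ = (1 - q₂) * x₁) (t e₁ e₂ : R) :
    (1 - (t * e₁) • q₁ + t • x₁) * (1 - (t * e₂) • q₂ + t • x₂) * (1 - (e₁ - e₂) • a) =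
      (1 - (e₁ - e₂) • a) *
        ((1 - (t * e₂) • q₁ + t • x₁) * (1 - (t * e₁) • q₂ + t • x₂)) := by
  have g₁ : x₁ * x₂ * a = x₁ * q₂ := by
    calc x₁ * x₂ * a = x₁ * a * x₁ - x₁ * q₁ + x₁ * (q₂ * q₁) := by
          rw [mul_assoc, h₂]; noncomm_ring
      _ = a * x₂ * x₁ + q₂ * x₁ - q₁ * q₂ * x₁ - x₁ * q₁ + x₁ * q₁ * q₂ := by
          rw [h₁, ← hq]; noncomm_ring
      _ = x₁ * q₂ - q₂ * (q₁ * x₁) := by rw [h₈, hx, hq]; noncomm_ring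
      _ = x₁ * q₂ := by rw [hx', mul_zero, sub_zero]
  have g₂ : q₁ * x₂ * a = a * x₁ * q₂ := by
    calc q₁ * x₂ * a = q₁ * a * x₁ - q₁ * q₁ + q₁ * q₂ * q₁ := by
          rw [mul_assoc, h₂]; noncomm_ring
      _ = a * q₂ * x₁ - q₁ * q₁ + q₂ * (q₁ * q₁) := by rw [h₃, hq]; noncomm_ring
      _ = a * x₁ * q₂ := by rw [hqq, h₄]; noncomm_ring
  have g₃ : x₁ * q₂ * a = 0 := by
    calc x₁ * q₂ * a = x₁ * a * q₁ := by rw [mul_assoc, h₃', mul_assoc]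
      _ = a * x₂ * q₁ + q₂ * q₁ - q₁ * q₂ * q₁ := by rw [h₁]; noncomm_ring
      _ = q₂ * q₁ - q₂ * (q₁ * q₁) := by rw [h₅, hq]; noncomm_ring
      _ = 0 := by rw [hqq, sub_self]
  have g₄ : q₁ * q₂ * a = a * q₁ * q₂ := by
    rw [mul_assoc, h₃', ← mul_assoc, h₃, mul_assoc, mul_assoc, hq]
  have h₁' : x₁ * a = a * x₂ + q₂ - q₁ * q₂ := by rw [h₁]; noncomm_ring
  have h₂' : x₂ * a = a * x₁ - q₁ + q₁ * q₂ := by rw [h₂, hq]; noncomm_ring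
  simp only [mul_add, add_mul, sub_mul, mul_sub, smul_mul_assoc, mul_smul_comm, one_mul, mul_one,
    ← mul_assoc, g₁, g₂, g₃, g₄, h₁', h₂', h₃, h₃', h₆, h₇, smul_zero]
  module

/-- With e₁ = e_k and e₂ = e_{k+1}, the factor 1 - (e₁ - e₂)A_k is left multiplication by s_k, and
the exchange of e₁ and e₂ is its action on coefficients. The corrections in the commutation of the
two factors cancel in their product. -/
theorem kOp_pair_mul (k : ℤ) (t e₁ e₂ : R) :
    kOp n t e₁ k * kOp n t e₂ (k + 1) * (1 - (e₁ - e₂) • upOp R (k : ZMod n)) =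
      (1 - (e₁ - e₂) • upOp R (k : ZMod n)) * (kOp n t e₂ k * kOp n t e₁ (k + 1)) :=
  pair_mul_eq_of_relations (E := Module.End R (W n →₀ R)) (covOp_mul_upOp_left k)
    (covOp_mul_upOp_right k) (posOp_mul_upOp_left k) (posOp_mul_upOp_right k) (posOp_comm _ _)
    (posOp_mul_self _) (covOp_mul_posOp _) (posOp_mul_covOp _) (upOp_mul_posOp_succ_mul_covOp k)
    (upOp_mul_covOp_succ_mul_posOp k) (upOp_mul_posOp_mul_covOp_succ k)
    (upOp_mul_covOp_mul_covOp_succ k) (upOp_mul_covOp_succ_mul_covOp k) t e₁ e₂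

theorem single_mul_eq_of_relations {E : Type*} [Ring E] [Algebra R E] {a x q : E}
    (h₁ : x * a = a * x) (h₂ : q * a = a * q) (t e α : R) :
    (1 - (t * e) • q + t • x) * (1 - α • a) = (1 - α • a) * (1 - (t * e) • q + t • x) := by
  simp only [mul_add, add_mul, sub_mul, mul_sub, smul_mul_assoc, mul_smul_comm, one_mul, mul_one,
    h₁, h₂]
  module

theorem kOp_mul {i : ZMod n} {c : ℤ} (h₁ : (c : ZMod n) ≠ i) (h₂ : (c : ZMod n) ≠ i + 1)
    (t e α : R) : kOp n t e c * (1 - α • upOp R i) = (1 - α • upOp R i) * kOp n t e c := by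
  refine single_mul_eq_of_relations (E := Module.End R (W n →₀ R)) ?_ ?_ t e α
  · rw [covOp_mul_upOp, simpleFun_of_ne h₁ h₂, if_neg h₁, if_neg h₂, add_zero]
    exact sub_zero (G := Module.End R (W n →₀ R)) _
  · rw [posOp_mul_upOp, simpleFun_of_ne h₁ h₂]

/-- Application of a ring endomorphism to the coefficients. -/
def coeffMap (σ : R →+* R) : (W n →₀ R) →+ (W n →₀ R) :=
  Finsupp.mapRange.addMonoidHom (σ : R →+ R)

theorem coeffMap_single (σ : R →+* R) (w : W n) (r : R) :
    coeffMap σ (Finsupp.single w r) = Finsupp.single w (σ r) := by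
  simp [coeffMap]

theorem coeffMap_bas (σ : R →+* R) (w : W n) : coeffMap σ (bas R w) = bas R w := by
  rw [bas, coeffMap_single, map_one]

theorem coeffMap_smul (σ : R →+* R) (r : R) (m : W n →₀ R) :
    coeffMap σ (r • m) = σ r • coeffMap σ m := by
  ext w; simp [coeffMap]

theorem coeffMap_opOf (σ : R →+* R) {f : W n → (W n →₀ R)} (hf : ∀ w, coeffMap σ (f w) = f w)
    (m : W n →₀ R) : coeffMap σ (opOf f m) = opOf f (coeffMap σ m) := by
  induction m using Finsupp.induction_linear with
  | zero => simp
  | add x y hx hy => simp [hx, hy]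
  | single w r =>
    have e : Finsupp.single w r = r • bas R w := by simp [bas]
    rw [e, map_smul, coeffMap_smul, coeffMap_smul, map_smul, opOf_bas, hf, coeffMap_bas, opOf_bas]

theorem coeffMap_covOp (σ : R →+* R) (c : ℤ) (m : W n →₀ R) :
    coeffMap σ (covOp n R c m) = covOp n R c (coeffMap σ m) :=
  coeffMap_opOf σ (fun w => by simp [coeffMap_bas]) m

theorem coeffMap_posOp (σ : R →+* R) (c : ℤ) (m : W n →₀ R) :
    coeffMap σ (posOp n R c m) = posOp n R c (coeffMap σ m) :=
  coeffMap_opOf σ (fun w => by split_ifs <;> simp [coeffMap_bas]) m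

theorem coeffMap_kOp (σ : R →+* R) (t e : R) (c : ℤ) (m : W n →₀ R) :
    coeffMap σ (kOp n t e c m) = kOp n (σ t) (σ e) c (coeffMap σ m) := by
  simp only [kOp, LinearMap.add_apply, LinearMap.sub_apply, LinearMap.smul_apply, map_add, map_sub,
    coeffMap_smul, coeffMap_posOp, coeffMap_covOp, Module.End.one_apply, map_mul]

/-- The left multiplication by `s_i = 1 - α_i A_i`, twisted by its action `σ` on coefficients. -/
def twist (σ : R →+* R) (α : R) (i : ZMod n) : (W n →₀ R) →+ (W n →₀ R) :=
  (1 - α • upOp R i : Module.End R (W n →₀ R)).toAddMonoidHom.comp (coeffMap σ)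

theorem twist_apply (σ : R →+* R) (α : R) (i : ZMod n) (m : W n →₀ R) :
    twist σ α i m = (1 - α • upOp R i : Module.End R (W n →₀ R)) (coeffMap σ m) := rfl

theorem twist_smul (σ : R →+* R) (α : R) (i : ZMod n) (r : R) (m : W n →₀ R) :
    twist σ α i (r • m) = σ r • twist σ α i m := by
  rw [twist_apply, coeffMap_smul, map_smul, twist_apply]

theorem twist_bas (σ : R →+* R) (α : R) {i : ZMod n} {w : W n} (h : Ascent i w) :
    twist σ α i (bas R w) = bas R w - α • bas R (s i * w) := by
  rw [twist_apply, coeffMap_bas, LinearMap.sub_apply, LinearMap.smul_apply, upOp_of_ascent h]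
  rfl

/-- The product `K_{c+1} K_{c+2} ⋯ K_{c+m}`. -/
def kProd (t : R) (e : ZMod n → R) : ℤ → ℕ → Module.End R (W n →₀ R)
  | _, 0 => 1
  | c, m + 1 => kOp n t (e ((c + 1 : ℤ) : ZMod n)) (c + 1) * kProd t e (c + 1) m

theorem kProd_succ_right (t : R) (e : ZMod n → R) (c : ℤ) (m : ℕ) :
    kProd t e c (m + 1) =
      kProd t e c m * kOp n t (e ((c + m + 1 : ℤ) : ZMod n)) (c + m + 1) := by
  induction m generalizing c with
  | zero => simp [kProd]
  | succ m ih =>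
    rw [kProd, ih, kProd, mul_assoc]
    congr 3 <;> push_cast <;> ring_nf

/-- The congruence conditions say that neither end of the range c + 1, …, c + m separates k from k +
1 for any k ≡ i. The product then splits into pairs, handled by `kOp_pair_mul`, and single factors,
handled by `kOp_mul`; removing a pair is why the induction is strong. -/
theorem kProd_twist {σ : R →+* R} {t : R} {e : ZMod n → R} {i : ZMod n} (ht : σ t = t)
    (he : ∀ r, r ≠ i → r ≠ i + 1 → σ (e r) = e r) (h₁ : σ (e i) = e (i + 1))
    (h₂ : σ (e (i + 1)) = e i) (m : ℕ) : ∀ c : ℤ, (c : ZMod n) ≠ i →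
    ((c + m : ℤ) : ZMod n) ≠ i → ∀ v, twist σ (e i - e (i + 1)) i (kProd t e c m v) =
      kProd t e c m (twist σ (e i - e (i + 1)) i v) := by
  induction m using Nat.strong_induction_on with
  | _ m ih =>
    intro c hc hcm v
    match m with
    | 0 => rfl
    | m + 1 =>
      by_cases hi : ((c + 1 : ℤ) : ZMod n) = i
      · match m with
        | 0 => exact absurd hi (by simpa using hcm)
        | m + 1 =>
          have hi2 : ((c + 1 + 1 : ℤ) : ZMod n) = i + 1 := by rw [← hi]; push_cast; ring
          have hcomm := kOp_pair_mul (n := n) (c + 1) t (e i) (e (i + 1))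
          rw [hi] at hcomm
          have := ih m (by omega) (c + 1 + 1) (by rw [hi2]; exact zmod_succ_ne i)
            (by convert hcm using 2; push_cast; ring) v
          rw [kProd, kProd, ← mul_assoc, hi, hi2]
          simp only [Module.End.mul_apply]
          rw [← this, twist_apply, coeffMap_kOp, coeffMap_kOp, ht, h₁, h₂,
            twist_apply, ← Module.End.mul_apply (kOp n t (e (i + 1)) (c + 1)),
            ← Module.End.mul_apply (1 - _), ← hcomm]
          rfl
      · have hi2 : ((c + 1 : ℤ) : ZMod n) ≠ i + 1 := by
          push_cast; exact fun h => hc (add_right_cancel h)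
        have hcomm := kOp_mul hi hi2 t (e ((c + 1 : ℤ) : ZMod n)) (e i - e (i + 1))
        have := ih m (by omega) (c + 1) hi (by convert hcm using 2; push_cast; ring) v
        rw [kProd, Module.End.mul_apply, Module.End.mul_apply, ← this, twist_apply, coeffMap_kOp, ht,
          he _ hi hi2, twist_apply, ← Module.End.mul_apply (1 - _), ← hcomm]
        rfl

theorem kOp_bas_of_pos (t e : R) {c : ℤ} {w : W n} (h : 0 < pos w c) :
    kOp n t e c (bas R w) = (1 - t * e) • bas R w + t • ∑ y ∈ covers c w, bas R y := by
  rw [kOp, LinearMap.add_apply, LinearMap.sub_apply, LinearMap.smul_apply, LinearMap.smul_apply,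
    posOp_of_pos h, covOp_bas, Module.End.one_apply, sub_smul, one_smul]

theorem kOp_bas_of_nonpos (t e : R) {c : ℤ} {w : W n} (h : pos w c ≤ 0) :
    kOp n t e c (bas R w) = bas R w := by
  rw [kOp, LinearMap.add_apply, LinearMap.sub_apply, LinearMap.smul_apply, LinearMap.smul_apply,
    posOp_of_nonpos h, covOp_of_nonpos h, Module.End.one_apply, smul_zero, sub_zero, smul_zero,
    add_zero]

theorem kOp_bas_of_length_lt (t e : R) {c : ℤ} {w : W n} (h : length w < c) :
    kOp n t e c (bas R w) = (1 - t * e) • bas R w := by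
  rw [kOp_bas_of_pos t e (pos_pos_of_length_lt h), Finset.sum_eq_zero, smul_zero, add_zero]
  intro y hy
  have := (mem_covers.1 hy).lt_length
  omega

/-- Enlarging the range of markings to the right. -/
theorem kProd_succ_bas (t : R) (e : ZMod n → R) {c : ℤ} {m : ℕ} {w : W n}
    (h : length w ≤ c + m) : kProd t e c (m + 1) (bas R w) =
      (1 - t * e ((c + m + 1 : ℤ) : ZMod n)) • kProd t e c m (bas R w) := by
  rw [kProd_succ_right, Module.End.mul_apply, kOp_bas_of_length_lt _ _ (by omega), map_smul]

/-- The submodule spanned by the `w` of length at most `l`. -/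
def lengthLE (n : ℕ) [n.AtLeastTwo] (R : Type*) [CommRing R] (l : ℕ) :
    Submodule R (W n →₀ R) := Submodule.span R (bas R '' {w | length w ≤ l})

theorem bas_mem_lengthLE {w : W n} {l : ℕ} (h : length w ≤ l) : bas R w ∈ lengthLE n R l :=
  Submodule.subset_span ⟨w, h, rfl⟩

theorem kOp_mem_lengthLE (t e : R) (c : ℤ) {l : ℕ} {v : W n →₀ R} (hv : v ∈ lengthLE n R l) :
    kOp n t e c v ∈ lengthLE n R l := by
  induction hv using Submodule.span_induction with
  | mem x hx =>
    obtain ⟨w, hw, rfl⟩ := hx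
    rcases lt_or_ge 0 (pos w c) with h | h
    · rw [kOp_bas_of_pos t e h]
      refine add_mem (Submodule.smul_mem _ _ (bas_mem_lengthLE hw))
        (Submodule.smul_mem _ _ (sum_mem fun y hy => bas_mem_lengthLE ?_))
      have := (mem_covers.1 hy).length_eq
      have hw' : length w ≤ l := hw
      omega
    · rw [kOp_bas_of_nonpos t e h]
      exact bas_mem_lengthLE hw
  | zero => rw [map_zero]; exact zero_mem _
  | add x y _ _ hx hy => rw [map_add]; exact add_mem hx hy
  | smul r x _ hx => rw [map_smul]; exact Submodule.smul_mem _ _ hx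

theorem kProd_mem_lengthLE (t : R) (e : ZMod n → R) (m : ℕ) : ∀ (c : ℤ) {l : ℕ} {v : W n →₀ R},
    v ∈ lengthLE n R l → kProd t e c m v ∈ lengthLE n R l := by
  induction m with
  | zero => intro c l v hv; exact hv
  | succ m ih =>
    intro c l v hv
    rw [kProd, Module.End.mul_apply]
    exact kOp_mem_lengthLE _ _ _ (ih _ hv)

/-- The leftmost factor of the product acts last, on whatever the other factors made of w, so its
triviality is needed on the whole span of elements of bounded length. -/
theorem kOp_of_mem_lengthLE (t e : R) {c : ℤ} {l : ℕ} (hc : c ≤ -l) {v : W n →₀ R}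
    (hv : v ∈ lengthLE n R l) : kOp n t e c v = v := by
  induction hv using Submodule.span_induction with
  | mem x hx =>
    obtain ⟨w, hw, rfl⟩ := hx
    have hw' : length w ≤ l := hw
    exact kOp_bas_of_nonpos t e (pos_nonpos_of_le_neg_length (by omega))
  | zero => rw [map_zero]
  | add x y _ _ hx hy => rw [map_add, hx, hy]
  | smul r x _ hx => rw [map_smul, hx]

/-- Enlarging the range of markings to the left. -/
theorem kProd_succ_bas_left (t : R) (e : ZMod n → R) {c : ℤ} {m : ℕ} {w : W n}
    (h : c + 1 ≤ -length w) :
    kProd t e c (m + 1) (bas R w) = kProd t e (c + 1) m (bas R w) := by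
  rw [kProd, Module.End.mul_apply]
  exact kOp_of_mem_lengthLE _ _ h (kProd_mem_lengthLE _ _ _ _ (bas_mem_lengthLE le_rfl))

/-! ### Strong strips -/

theorem StrongStrip.ext_data {w u : W n} {l : ℕ} {x y : StrongStrip w u l}
    (h₁ : x.vertex = y.vertex) (h₂ : x.mark = y.mark) : x = y := by
  cases x; cases y; cases h₁; cases h₂; rfl

theorem StrongStrip.cov {w u : W n} {l : ℕ} (x : StrongStrip w u l) (j : Fin l) :
    Cov (x.mark j) (x.vertex j.castSucc) (x.vertex j.succ) :=
  markedStrongCover_iff.1 (x.cover j)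

theorem StrongStrip.length_vertex {w u : W n} {l : ℕ} (x : StrongStrip w u l) (j : Fin (l + 1)) :
    length (x.vertex j) + j = length w := by
  induction j using Fin.induction with
  | zero => rw [x.vertex_zero]; simp
  | succ j ih =>
    have := (x.cov j).length_eq
    simp only [Fin.val_castSucc, Fin.val_succ] at ih ⊢
    omega

theorem StrongStrip.length_add {w u : W n} {l : ℕ} (x : StrongStrip w u l) :
    length u + l = length w := by
  have := x.length_vertex (Fin.last l)
  rwa [x.vertex_last, Fin.val_last] at this

theorem StrongStrip.mark_mem {w u : W n} {l : ℕ} (x : StrongStrip w u l) (j : Fin l) :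
    x.mark j ∈ Set.Icc (-(length w : ℤ)) (length w) := by
  have h1 := (x.cov j).lt_length
  have h2 := (x.cov j).neg_length_lt
  have h3 := x.length_vertex j.castSucc
  constructor <;> omega

theorem finite_length_le (l : ℕ) : {w : W n | length w ≤ l}.Finite := by
  have : NeZero n := ⟨by have := (Nat.AtLeastTwo.prop : 2 ≤ n); omega⟩
  refine ((List.finite_length_le (ZMod n) l).image wordProd).subset ?_
  intro w hw
  obtain ⟨m, hm, hlen⟩ := exists_reducedWord w
  exact ⟨m, by simpa [hlen] using hw, hm⟩

/-- A strip is determined by its vertices, whose lengths are at most ℓ(w), and its markings, which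
lie between -ℓ(w) and ℓ(w). -/
instance finite_strongStrip (w : W n) (i : ℕ) : Finite (Σ u : W n, StrongStrip w u i) := by
  have h1 : Finite {v : W n | length v ≤ length w} := (finite_length_le (length w)).to_subtype
  have h2 : Finite (Set.Icc (-(length w : ℤ)) (length w)) := (Set.finite_Icc _ _).to_subtype
  let f : (Σ u : W n, StrongStrip w u i) →
      (Fin (i + 1) → {v : W n | length v ≤ length w}) ×
        (Fin i → Set.Icc (-(length w : ℤ)) (length w)) := fun x =>
    (fun j => ⟨x.2.vertex j, by have := x.2.length_vertex j; simp only [Set.mem_ofPred_eq]; omega⟩,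
      fun j => ⟨x.2.mark j, x.2.mark_mem j⟩)
  refine Finite.of_injective f ?_
  rintro ⟨u, x⟩ ⟨v, y⟩ h
  have hv : x.vertex = y.vertex := funext fun j =>
    congrArg Subtype.val (congrFun (congrArg Prod.fst h) j)
  have hm : x.mark = y.mark := funext fun j =>
    congrArg Subtype.val (congrFun (congrArg Prod.snd h) j)
  obtain rfl : u = v := by rw [← x.vertex_last, ← y.vertex_last, hv]
  rw [StrongStrip.ext_data hv hm]

instance finite_strongStrip_to (w u : W n) (i : ℕ) : Finite (StrongStrip w u i) :=
  Finite.of_injective (fun x => (⟨u, x⟩ : Σ u : W n, StrongStrip w u i))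
    (fun x y h => by simpa using h)

/-- Strong strips with all markings at most `b`. -/
abbrev StripLE (w u : W n) (l : ℕ) (b : ℤ) : Type :=
  {x : StrongStrip w u l // ∀ j, x.mark j ≤ b}

/-- Prepending a marked strong cover to a strip. -/
def StrongStrip.cons {w y u : W n} {l : ℕ} {a : ℤ} (h : Cov a w y) (x : StrongStrip y u l)
    (hx : ∀ j, x.mark j < a) : StrongStrip w u (l + 1) where
  vertex := Fin.cons w x.vertex
  mark := Fin.cons a x.mark
  vertex_zero := rfl
  vertex_last := by rw [← Fin.succ_last, Fin.cons_succ, x.vertex_last]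
  cover j := by
    refine Fin.cases ?_ (fun j => ?_) j
    · rw [Fin.castSucc_zero, Fin.cons_zero, Fin.cons_succ, x.vertex_zero, Fin.cons_zero]
      exact markedStrongCover_iff.2 h
    · rw [← Fin.succ_castSucc, Fin.cons_succ, Fin.cons_succ, Fin.cons_succ]
      exact x.cover j
  mark_anti := by
    intro i j hij
    induction j using Fin.cases with
    | zero => exact absurd hij (Fin.not_lt_zero i)
    | succ j =>
      induction i using Fin.cases with
      | zero => exact hx j
      | succ i => exact x.mark_anti (Fin.succ_lt_succ_iff.1 hij)

/-- Removing the first cover of a strip. -/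
def StrongStrip.tail {w u : W n} {l : ℕ} (x : StrongStrip w u (l + 1)) :
    StrongStrip (x.vertex 1) u l where
  vertex j := x.vertex j.succ
  mark j := x.mark j.succ
  vertex_zero := rfl
  vertex_last := x.vertex_last
  cover j := x.cover j.succ
  mark_anti := fun _ _ h => x.mark_anti (Fin.succ_lt_succ_iff.2 h)

theorem StrongStrip.cov_zero {w u : W n} {l : ℕ} (x : StrongStrip w u (l + 1)) :
    Cov (x.mark 0) w (x.vertex 1) := by
  have := x.cov 0
  rwa [Fin.castSucc_zero, x.vertex_zero] at this

theorem StrongStrip.cons_tail {w u : W n} {l : ℕ} (x : StrongStrip w u (l + 1))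
    (h : ∀ j, x.tail.mark j < x.mark 0) : StrongStrip.cons x.cov_zero x.tail h = x := by
  refine StrongStrip.ext_data ?_ ?_
  · conv_rhs => rw [← Fin.cons_self_tail x.vertex, x.vertex_zero]
    rfl
  · exact Fin.cons_self_tail x.mark

/-- The map of `card_stripLE_succ`. -/
def stripSplit (w u : W n) (l : ℕ) (b : ℤ) :
    (StripLE w u (l + 1) (b - 1) ⊕ Σ y : covers b w, StripLE y.1 u l (b - 1)) →
      StripLE w u (l + 1) b
  | .inl x => ⟨x.1, fun j => by have := x.2 j; omega⟩
  | .inr ⟨y, x⟩ => ⟨StrongStrip.cons (mem_covers.1 y.2) x.1 fun j => by have := x.2 j; omega,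
      fun j => by
        refine Fin.cases le_rfl (fun j => ?_) j
        have := x.2 j
        simp only [StrongStrip.cons, Fin.cons_succ]
        omega⟩

theorem stripSplit_bijective (w u : W n) (l : ℕ) (b : ℤ) :
    Function.Bijective (stripSplit w u l b) := by
  constructor
  · rintro (x | ⟨⟨y, hy⟩, x⟩) (x' | ⟨⟨y', hy'⟩, x'⟩) h
    · congr 1
      exact Subtype.ext (congrArg (fun z => z.1) h)
    · have h1 := congrArg (fun z => z.1.mark 0) h
      have h2 := x.2 0
      simp only [stripSplit, StrongStrip.cons, Fin.cons_zero] at h1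
      omega
    · have h1 := congrArg (fun z => z.1.mark 0) h
      have h2 := x'.2 0
      simp only [stripSplit, StrongStrip.cons, Fin.cons_zero] at h1
      omega
    · have hv : ∀ j, x.1.vertex j = x'.1.vertex j := fun j => by
        have := congrArg (fun z => z.1.vertex j.succ) h
        simpa only [stripSplit, StrongStrip.cons, Fin.cons_succ] using this
      have hm : ∀ j, x.1.mark j = x'.1.mark j := fun j => by
        have := congrArg (fun z => z.1.mark j.succ) h
        simpa only [stripSplit, StrongStrip.cons, Fin.cons_succ] using this
      obtain rfl : y = y' := by
        have := hv 0
        rwa [x.1.vertex_zero, x'.1.vertex_zero] at this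
      obtain rfl : x = x' := Subtype.ext (StrongStrip.ext_data (funext hv) (funext hm))
      rfl
  · rintro ⟨x, hx⟩
    have hlt : ∀ j : Fin l, x.mark j.succ < x.mark 0 := fun j => x.mark_anti (Fin.succ_pos j)
    by_cases h0 : x.mark 0 = b
    · subst h0
      refine ⟨.inr ⟨⟨x.vertex 1, mem_covers.2 x.cov_zero⟩,
        ⟨x.tail, fun j => Int.le_sub_one_of_lt (hlt j)⟩⟩, Subtype.ext ?_⟩
      exact x.cons_tail hlt
    · refine ⟨.inl ⟨x, fun j => ?_⟩, rfl⟩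
      have h1 := hx 0
      refine Fin.cases (by omega) (fun j => ?_) j
      have := hlt j
      omega

/-- The first marking is the largest: either it is less than b, or it equals b and the rest is a
strip with markings at most b - 1. This is the recursion produced by the factor K_b. -/
theorem card_stripLE_succ (w u : W n) (l : ℕ) (b : ℤ) :
    Nat.card (StripLE w u (l + 1) b) = Nat.card (StripLE w u (l + 1) (b - 1)) +
      ∑ y ∈ covers b w, Nat.card (StripLE y u l (b - 1)) := by
  rw [← Nat.card_congr (Equiv.ofBijective _ (stripSplit_bijective w u l b)), Nat.card_sum,
    Nat.card_sigma, Finset.sum_coe_sort (covers b w) fun y => Nat.card (StripLE y u l (b - 1))]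

theorem card_stripLE_zero_self (w : W n) (b : ℤ) : Nat.card (StripLE w w 0 b) = 1 := by
  refine Nat.card_eq_one_iff_unique.2 ⟨⟨fun x y => Subtype.ext (StrongStrip.ext_data ?_ ?_)⟩,
    ⟨⟨⟨fun _ => w, fun j => j.elim0, rfl, rfl, fun j => j.elim0, fun j => j.elim0⟩,
      fun j => j.elim0⟩⟩⟩
  · funext j
    obtain rfl : j = 0 := Fin.ext (by omega)
    rw [x.1.vertex_zero, y.1.vertex_zero]
  · exact funext fun j => j.elim0

theorem card_stripLE_eq_zero_of_length {w u : W n} {l : ℕ} {b : ℤ}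
    (h : length u + l ≠ length w) : Nat.card (StripLE w u l b) = 0 := by
  have : IsEmpty (StripLE w u l b) := ⟨fun x => h x.1.length_add⟩
  exact Nat.card_of_isEmpty

theorem card_stripLE_zero_of_ne {w u : W n} {b : ℤ} (h : w ≠ u) :
    Nat.card (StripLE w u 0 b) = 0 := by
  have : IsEmpty (StripLE w u 0 b) := ⟨fun x => h (x.1.vertex_zero.symm.trans x.1.vertex_last)⟩
  exact Nat.card_of_isEmpty

theorem card_stripLE_eq_zero {w u : W n} {l : ℕ} {b : ℤ} (h : b ≤ -length w) :
    Nat.card (StripLE w u (l + 1) b) = 0 := by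
  have : IsEmpty (StripLE w u (l + 1) b) := ⟨fun x => by
    have h1 := x.1.cov_zero.neg_length_lt
    have h2 := x.2 0
    omega⟩
  exact Nat.card_of_isEmpty

theorem card_stripLE_of_length_le {w u : W n} {l : ℕ} {b : ℤ} (h : length w ≤ b) :
    Nat.card (StripLE w u l b) = Nat.card (StrongStrip w u l) :=
  Nat.card_congr (Equiv.subtypeUnivEquiv fun x j => (x.mark_mem j).2.trans h)

theorem card_stripLE_zero_eq (w u : W n) (b b' : ℤ) :
    Nat.card (StripLE w u 0 b) = Nat.card (StripLE w u 0 b') := by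
  by_cases h : w = u
  · subst h; rw [card_stripLE_zero_self, card_stripLE_zero_self]
  · rw [card_stripLE_zero_of_ne h, card_stripLE_zero_of_ne h]

open Polynomial in
/-- The lowest coefficients of the product of the `K_c` count strong strips. -/
theorem coeff_kProd_bas {B : Type*} [CommRing B] (ε : ZMod n → B) (m : ℕ) :
    ∀ (c : ℤ) (w u : W n) (j : ℕ), c ≤ -length w → length u + j ≤ length w →
      (kProd (X : B[X]) (fun r => C (ε r)) c m (bas B[X] w) u).coeff j =
        (Nat.card (StripLE w u j (c + m)) : B) := by
  induction m with
  | zero =>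
    intro c w u j hc hj
    simp only [kProd, Module.End.one_apply, bas, Nat.cast_zero, add_zero]
    by_cases h : w = u
    · subst h
      obtain rfl : j = 0 := by omega
      rw [card_stripLE_zero_self, Finsupp.single_eq_same]
      simp
    · rw [Finsupp.single_eq_of_ne (Ne.symm h)]
      cases j with
      | zero => rw [card_stripLE_zero_of_ne h]; simp
      | succ j => rw [card_stripLE_eq_zero hc]; simp
  | succ m ih =>
    intro c w u j hc hj
    have hb : c + ((m + 1 : ℕ) : ℤ) - 1 = c + m := by push_cast; ring
    have hb' : c + ((m + 1 : ℕ) : ℤ) = c + m + 1 := by push_cast; ring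
    rw [kProd_succ_right, Module.End.mul_apply, ← hb']
    set b : ℤ := c + ((m + 1 : ℕ) : ℤ) with hbdef
    have ih1 := ih c w u j hc hj
    cases j with
    | zero =>
      rw [card_stripLE_zero_eq w u b (c + m), ← ih1]
      rcases lt_or_ge 0 (pos w b) with h | h
      · rw [kOp_bas_of_pos _ _ h, map_add, map_smul, map_smul, Finsupp.add_apply,
          Finsupp.smul_apply, Finsupp.smul_apply, smul_eq_mul, smul_eq_mul]
        simp [sub_mul, mul_assoc]
      · rw [kOp_bas_of_nonpos _ _ h]
    | succ j =>
      rw [card_stripLE_succ, hb]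
      rcases lt_or_ge 0 (pos w b) with h | h
      -- The term -t e_b contributes a multiple of the number of strips of length j from w to u,
      -- which is zero since ℓ(u) + j < ℓ(w). This is where only the lowest coefficients are under
      -- control.
      · rw [kOp_bas_of_pos _ _ h, map_add, map_smul, map_smul, Finsupp.add_apply,
          Finsupp.smul_apply, Finsupp.smul_apply, smul_eq_mul, smul_eq_mul, sub_mul, one_mul,
          mul_assoc, coeff_add, coeff_sub, coeff_X_mul, coeff_X_mul, coeff_C_mul, ih1,
          ih c w u j hc (by omega), card_stripLE_eq_zero_of_length (l := j) (by omega)]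
        rw [map_sum, Finsupp.finsetSum_apply, finsetSum_coeff]
        push_cast
        rw [mul_zero, sub_zero]
        congr 1
        refine Finset.sum_congr rfl fun y hy => ?_
        have := (mem_covers.1 hy).length_eq
        rw [ih c y u j (by omega) (by omega)]
      · rw [kOp_bas_of_nonpos _ _ h, ih1, Finset.sum_eq_zero, add_zero]
        intro y hy
        have := (mem_covers.1 hy).pos_pos
        omega

/-! ### The action on weights -/

theorem residue_intCast (w : W n) (k : ℤ) : residue w (k : ZMod n) = (value w k : ZMod n) :=
  value_cast_congr w (by simp)

theorem residue_s_left (i : ZMod n) : residue (s i) i = i + 1 := by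
  obtain ⟨k, rfl⟩ := exists_intCast i
  rw [residue_intCast, value_s, simpleFun_left]; push_cast; rfl

theorem residue_s_right (i : ZMod n) : residue (s i) (i + 1) = i := by
  obtain ⟨k, rfl⟩ := exists_intCast i
  rw [show (k : ZMod n) + 1 = ((k + 1 : ℤ) : ZMod n) by push_cast; rfl, residue_intCast, value_s,
    simpleFun_right]

theorem residue_s_of_ne {i r : ZMod n} (h : r ≠ i) (h' : r ≠ i + 1) : residue (s i) r = r := by
  obtain ⟨k, rfl⟩ := exists_intCast r
  rw [residue_intCast, value_s, simpleFun_of_ne h h']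

/-- The class of `e_r` in `S`. -/
def ep (r : ZMod n) : S n := SymmetricAlgebra.ι ℤ (P n) ((diagonal n).mkQ (Pi.single r 1))

/-- The image of the simple root `α_i` in `S`. -/
def root (i : ZMod n) : S n := ep i - ep (i + 1)

theorem root_eq (i : ZMod n) : SymmetricAlgebra.ι ℤ (P n) (simpleRoot n i) = root i := by
  rw [simpleRoot, map_sub, map_sub]; rfl

theorem smul_ι (w : W n) (x : P n) :
    w • SymmetricAlgebra.ι ℤ (P n) x = SymmetricAlgebra.ι ℤ (P n) (weightMap w x) :=
  SymmetricAlgebra.lift_ι_apply _ _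

theorem smul_ep (w : W n) (r : ZMod n) : w • ep r = ep (residue w r) := by
  rw [ep, smul_ι, ep]
  congr 1
  rw [weightMap, Submodule.mkQ_apply, Submodule.mapQ_apply, Submodule.mkQ_apply]
  congr 1
  funext q
  have : (residueHom n w⁻¹ q = r) ↔ q = residue w r := by
    rw [map_inv, Equiv.Perm.inv_eq_iff_eq]; rfl
  simp only [LinearMap.funLeft_apply, Pi.single_apply, this]

theorem smul_ep_left (i : ZMod n) : s i • ep i = ep (i + 1) := by rw [smul_ep, residue_s_left]

theorem smul_ep_right (i : ZMod n) : s i • ep (i + 1) = ep i := by rw [smul_ep, residue_s_right]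

theorem smul_ep_of_ne {i r : ZMod n} (h : r ≠ i) (h' : r ≠ i + 1) : s i • ep r = ep r := by
  rw [smul_ep, residue_s_of_ne h h']

theorem root_ne_zero (i : ZMod n) : root i ≠ 0 := by
  -- This is the coroot of α_i; it vanishes on the diagonal and takes the value 2 on α_i, also for n
  -- = 2.
  let g : (ZMod n → ℤ) →ₗ[ℤ] ℤ :=
    { toFun := fun x => x i - x (i + 1)
      map_add' := fun x y => by simp only [Pi.add_apply]; ring
      map_smul' := fun c x => by simp only [Pi.smul_apply, smul_eq_mul, RingHom.id_apply]; ring }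
  let f : P n →ₗ[ℤ] ℤ := (diagonal n).liftQ g (by
    intro x hx
    obtain ⟨c, hc⟩ := mem_diagonal.1 hx
    change x i - x (i + 1) = 0
    rw [hc, hc, sub_self])
  intro h
  have h2 := congrArg (SymmetricAlgebra.lift f) h
  rw [← root_eq, SymmetricAlgebra.lift_ι_apply, map_zero, simpleRoot, Submodule.mkQ_apply,
    Submodule.liftQ_apply] at h2
  have h1 := zmod_succ_ne i
  simp [g, h1, h1.symm] at h2

/-- True on the generators e_r, and passed to products by the twisted Leibniz rule. It is what keeps
the structure constants in S rather than in F. -/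
theorem root_dvd_sub_smul (i : ZMod n) (p : S n) : root i ∣ p - s i • p := by
  induction p using SymmetricAlgebra.induction with
  | algebraMap r =>
    have : s i • algebraMap ℤ (S n) r = algebraMap ℤ (S n) r := (symMap (s i)).commutes r
    rw [this, sub_self]; exact dvd_zero _
  | ι x =>
    obtain ⟨f, rfl⟩ := (diagonal n).mkQ_surjective x
    have : NeZero n := ⟨by have := (Nat.AtLeastTwo.prop : 2 ≤ n); omega⟩
    have hf : SymmetricAlgebra.ι ℤ (P n) ((diagonal n).mkQ f) = ∑ r, f r • ep r := by
      conv_lhs => rw [← Finset.univ_sum_single f]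
      rw [map_sum, map_sum]
      refine Finset.sum_congr rfl fun r _ => ?_
      rw [ep, ← map_zsmul, ← map_zsmul]
      congr 2
      rw [← Pi.single_smul]; simp
    rw [hf, Finset.smul_sum, ← Finset.sum_sub_distrib]
    refine Finset.dvd_sum fun r _ => ?_
    rw [smul_comm (s i) (f r), ← smul_sub, zsmul_eq_mul]
    refine Dvd.dvd.mul_left ?_ _
    by_cases h : r = i
    · subst h; rw [smul_ep_left, root]
    by_cases h' : r = i + 1
    · subst h'; rw [smul_ep_right, root, ← neg_sub (ep i)]; exact (dvd_neg (α := S n)).2 dvd_rfl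
    · rw [smul_ep_of_ne h h', sub_self]; exact dvd_zero _
  | mul a b ha hb =>
    rw [smul_mul', show a * b - s i • a * s i • b = (a - s i • a) * b + s i • a * (b - s i • b) by
      ring]
    exact dvd_add (ha.mul_right _) (hb.mul_left _)
  | add a b ha hb =>
    rw [smul_add, add_sub_add_comm]; exact dvd_add ha hb

/-! ### The simple generators of the nilHecke ring -/

theorem smul_algebraMap (w : W n) (p : S n) :
    w • algebraMap (S n) (F n) p = algebraMap (S n) (F n) (w • p) :=
  (algebraMap.smul' w p (F n)).symm

/-- The image of `e_r` in `F`. -/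
def epF (r : ZMod n) : F n := algebraMap (S n) (F n) (ep r)

theorem smul_epF (w : W n) (r : ZMod n) : w • epF r = epF (residue w r) := by
  rw [epF, smul_algebraMap, smul_ep, epF]

theorem algebraMap_root (i : ZMod n) :
    algebraMap (S n) (F n) (root i) = epF i - epF (i + 1) := by rw [root, map_sub]; rfl

theorem epF_sub_ne_zero (i : ZMod n) : epF i - epF (i + 1) ≠ (0 : F n) := by
  rw [← algebraMap_root]
  exact (map_ne_zero_iff _ (IsFractionRing.injective (S n) (F n))).2 (root_ne_zero i)

/-- The element `w` of `F_W`. -/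
abbrev σ (w : W n) : FW n := SkewMonoidAlgebra.single w (1 : F n)

theorem σ_mul_σ (v w : W n) : σ v * σ w = σ (v * w) := by
  rw [SkewMonoidAlgebra.single_mul_single, smul_one, one_mul]

theorem σ_one : σ (1 : W n) = 1 := rfl

theorem single_eq (w : W n) (f : F n) : SkewMonoidAlgebra.single w f = f • σ w := by
  rw [SkewMonoidAlgebra.smul_single, smul_eq_mul, mul_one]

theorem smul_mul_FW (f : F n) (x y : FW n) : (f • x) * y = f • (x * y) := smul_mul_assoc f x y

theorem σ_mul_smul (w : W n) (f : F n) (x : FW n) : σ w * (f • x) = (w • f) • (σ w * x) := by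
  induction x using SkewMonoidAlgebra.induction_on with
  | zero => simp
  | single g a =>
    rw [SkewMonoidAlgebra.smul_single, SkewMonoidAlgebra.single_mul_single,
      SkewMonoidAlgebra.single_mul_single, SkewMonoidAlgebra.smul_single]
    simp [smul_mul']
  | add x y hx hy => rw [smul_add, mul_add, hx, hy, mul_add, smul_add]

theorem simpleA_eq (i : ZMod n) : simpleA i = (epF i - epF (i + 1))⁻¹ • (1 - σ (s i)) := by
  rw [simpleA, root_eq, algebraMap_root]

/-! ### Braid relations and the basis `A_w` -/

theorem simpleA_mul (i : ZMod n) (x : FW n) :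
    simpleA i * x = (epF i - epF (i + 1))⁻¹ • (x - σ (s i) * x) := by
  rw [simpleA_eq, smul_mul_FW, sub_mul, one_mul]

theorem smul_inv_F (w : W n) (f : F n) : w • f⁻¹ = (w • f)⁻¹ :=
  map_inv₀ (MulSemiringAction.toRingHom (W n) (F n) w) f

theorem smul_epF_left (i : ZMod n) : s i • epF i = epF (i + 1) := by rw [smul_epF, residue_s_left]

theorem smul_epF_right (i : ZMod n) : s i • epF (i + 1) = epF i := by
  rw [smul_epF, residue_s_right]

theorem smul_epF_of_ne {i r : ZMod n} (h : r ≠ i) (h' : r ≠ i + 1) : s i • epF r = epF r := by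
  rw [smul_epF, residue_s_of_ne h h']

theorem σ_mul_simpleA_self (i : ZMod n) : σ (s i) * simpleA i = simpleA i := by
  rw [simpleA_eq, σ_mul_smul, smul_inv_F, smul_sub, smul_epF_left, smul_epF_right, mul_sub, mul_one,
    σ_mul_σ, s_mul_s, σ_one, ← neg_sub (epF i), inv_neg, neg_smul, ← smul_neg, neg_sub]

theorem simpleA_mul_self (i : ZMod n) : simpleA i * simpleA i = 0 := by
  rw [simpleA_mul, σ_mul_simpleA_self, sub_self, smul_zero]

theorem s_comm {i j : ZMod n} (h : j ≠ i) (h₁ : j ≠ i + 1) (h₂ : i ≠ j + 1) :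
    s i * s j = s j * s i := by
  have h₃ : i + 1 ≠ j + 1 := fun e => h (add_right_cancel e).symm
  refine ext_value fun k => ?_
  simp only [value_mul, value_s]
  by_cases hi : (k : ZMod n) = i
  · rw [simpleFun_of_ne (i := j) (by rw [hi]; exact h.symm) (by rw [hi]; exact h₂), ← hi,
      simpleFun_left, simpleFun_of_ne]
    · push_cast; rw [hi]; exact h₁.symm
    · push_cast; rw [hi]; exact h₃
  by_cases hi' : (k : ZMod n) = i + 1
  · have hk : ((k - 1 : ℤ) : ZMod n) = i := by push_cast; rw [hi']; ring
    rw [simpleFun_of_ne (i := j) (by rw [hi']; exact h₁.symm) (by rw [hi']; exact h₃), ← hk]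
    have := simpleFun_right (n := n) (k - 1)
    rw [sub_add_cancel] at this
    rw [this, simpleFun_of_ne]
    · rw [hk]; exact h.symm
    · rw [hk]; exact h₂
  rw [simpleFun_of_ne hi hi']
  by_cases hj : (k : ZMod n) = j
  · rw [← hj, simpleFun_left, simpleFun_of_ne]
    · push_cast; rw [hj]; exact h₂.symm
    · push_cast; rw [hj]; exact h₃.symm
  by_cases hj' : (k : ZMod n) = j + 1
  · have hk : ((k - 1 : ℤ) : ZMod n) = j := by push_cast; rw [hj']; ring
    rw [← hk]
    have := simpleFun_right (n := n) (k - 1)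
    rw [sub_add_cancel] at this
    rw [this, simpleFun_of_ne]
    · rw [hk]; exact h
    · rw [hk]; exact h₁
  rw [simpleFun_of_ne hj hj', simpleFun_of_ne hi hi']

/-- Both sides are the reflection t_{k,k+2}, obtained by conjugating s_{k+1} by s_k or s_k by
s_{k+1}. -/
theorem s_braid {i : ZMod n} (h : i + 1 + 1 ≠ i) :
    s i * (s (i + 1) * s i) = s (i + 1) * (s i * s (i + 1)) := by
  have h₁ := s_mul_s i
  obtain ⟨k, rfl⟩ := exists_intCast i
  have hne : (k : ZMod n) ≠ ((k + 1 : ℤ) : ZMod n) := by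
    push_cast; exact (zmod_succ_ne _).symm
  have e₁ : s (k : ZMod n) * refl (k + 1) (k + 1 + 1) = refl k (k + 1 + 1) * s (k : ZMod n) := by
    rw [s_mul_refl, simpleFun_right, simpleFun_of_ne (k := k + 1 + 1)]
    · push_cast; exact h
    · push_cast; exact zmod_succ_ne _
  have hc : ((k : ZMod n) + 1) = ((k + 1 : ℤ) : ZMod n) := by push_cast; rfl
  have e₂ : s ((k + 1 : ℤ) : ZMod n) * refl k (k + 1) =
      refl k (k + 1 + 1) * s ((k + 1 : ℤ) : ZMod n) := by
    rw [s_mul_refl, simpleFun_left, simpleFun_of_ne hne]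
    push_cast; exact h.symm
  rw [hc]
  rw [refl_succ] at e₁ e₂
  calc _ = s (k : ZMod n) * s ((k + 1 : ℤ) : ZMod n) * s (k : ZMod n) := (mul_assoc _ _ _).symm
    _ = refl k (k + 1 + 1) := by rw [e₁, mul_assoc, s_mul_s, mul_one]
    _ = s ((k + 1 : ℤ) : ZMod n) * s (k : ZMod n) * s ((k + 1 : ℤ) : ZMod n) := by
      rw [e₂, mul_assoc, s_mul_s, mul_one]
    _ = _ := mul_assoc _ _ _

/-! ### Commutation and braid relations of divided differences -/

theorem demazure_comm {K M : Type*} [Field K] [AddCommGroup M] [Module K M] {p q : M →+ M}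
    {p' q' : K →+* K} (hp : ∀ f m, p (f • m) = p' f • p m) (hq : ∀ f m, q (f • m) = q' f • q m)
    (hpq : ∀ m, p (q m) = q (p m)) {a b : K} (ha : q' a = a) (hb : p' b = b) (m : M) :
    a⁻¹ • (b⁻¹ • (m - q m) - p (b⁻¹ • (m - q m))) =
      b⁻¹ • (a⁻¹ • (m - p m) - q (a⁻¹ • (m - p m))) := by
  rw [hp, hq, map_inv₀, map_inv₀, ha, hb, map_sub, map_sub, hpq]
  module

theorem demazure_braid {K M : Type*} [Field K] [AddCommGroup M] [Module K M] {p q : M →+ M}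
    {p' q' : K →+* K} (hp : ∀ f m, p (f • m) = p' f • p m) (hq : ∀ f m, q (f • m) = q' f • q m)
    (hpp : ∀ m, p (p m) = m) (hqq : ∀ m, q (q m) = m) (hpq : ∀ m, p (q (p m)) = q (p (q m)))
    {x y z : K} (h₁ : p' x = y) (h₂ : p' y = x) (h₃ : p' z = z) (h₄ : q' x = x) (h₅ : q' y = z)
    (h₆ : q' z = y) (hxy : x - y ≠ 0) (hyz : y - z ≠ 0) {A B : M → M}
    (hA : ∀ m, A m = (x - y)⁻¹ • (m - p m)) (hB : ∀ m, B m = (y - z)⁻¹ • (m - q m)) (m : M) :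
    A (B (A m)) = B (A (B m)) := by
  have hxz : x - z ≠ 0 := by
    have := (map_ne_zero p').2 hyz
    rwa [map_sub, h₂, h₃] at this
  have hyx : y - x ≠ 0 := by rw [← neg_sub]; exact neg_ne_zero.2 hxy
  have hzy : z - y ≠ 0 := by rw [← neg_sub]; exact neg_ne_zero.2 hyz
  have key : ∀ m, A (B (A m)) = ((x - y) * (y - z) * (x - z))⁻¹ •
      (m - p m - q m + p (q m) + q (p m) - p (q (p m))) := by
    intro m
    rw [hA, hA, hB]
    simp only [hp, hq, map_sub, map_inv₀, h₁, h₂, h₃, h₄, h₅, hpp]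
    match_scalars <;> field_simp <;> ring
  have key' : ∀ m, B (A (B m)) = ((x - y) * (y - z) * (x - z))⁻¹ •
      (m - p m - q m + p (q m) + q (p m) - q (p (q m))) := by
    intro m
    rw [hB, hB, hA]
    simp only [hp, hq, map_sub, map_inv₀, h₂, h₃, h₄, h₅, h₆, hqq]
    match_scalars <;> field_simp <;> ring
  rw [key, key', hpq]

theorem simpleA_comm {i j : ZMod n} (h : j ≠ i) (h₁ : j ≠ i + 1) (h₂ : i ≠ j + 1) :
    simpleA i * simpleA j = simpleA j * simpleA i := by
  have h₃ : i + 1 ≠ j + 1 := fun e => h (add_right_cancel e).symm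
  have := demazure_comm (p := AddMonoidHom.mulLeft (σ (s i))) (q := AddMonoidHom.mulLeft (σ (s j)))
    (p' := MulSemiringAction.toRingHom (W n) (F n) (s i))
    (q' := MulSemiringAction.toRingHom (W n) (F n) (s j)) (σ_mul_smul _) (σ_mul_smul _)
    (fun m => by
      simp only [AddMonoidHom.coe_mulLeft]
      rw [← mul_assoc, ← mul_assoc, σ_mul_σ, σ_mul_σ, s_comm h h₁ h₂])
    (a := epF i - epF (i + 1)) (b := epF j - epF (j + 1))
    (by rw [MulSemiringAction.toRingHom_apply, smul_sub, smul_epF_of_ne h.symm h₂,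
      smul_epF_of_ne h₁.symm h₃])
    (by rw [MulSemiringAction.toRingHom_apply, smul_sub, smul_epF_of_ne h h₁,
      smul_epF_of_ne h₂.symm h₃.symm]) 1
  simp only [AddMonoidHom.coe_mulLeft, ← simpleA_mul, mul_one, ← simpleA_eq] at this
  exact this

theorem simpleA_braid {i : ZMod n} (h : i + 1 + 1 ≠ i) :
    simpleA i * (simpleA (i + 1) * simpleA i) =
      simpleA (i + 1) * (simpleA i * simpleA (i + 1)) := by
  have h₁ : i + 1 + 1 ≠ i + 1 := zmod_succ_ne _
  have h₂ := zmod_succ_ne i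
  have := demazure_braid (p := AddMonoidHom.mulLeft (σ (s i)))
    (q := AddMonoidHom.mulLeft (σ (s (i + 1))))
    (p' := MulSemiringAction.toRingHom (W n) (F n) (s i))
    (q' := MulSemiringAction.toRingHom (W n) (F n) (s (i + 1))) (σ_mul_smul _) (σ_mul_smul _)
    (fun m => by
      simp only [AddMonoidHom.coe_mulLeft]
      rw [← mul_assoc, σ_mul_σ, s_mul_s, σ_one, one_mul])
    (fun m => by
      simp only [AddMonoidHom.coe_mulLeft]
      rw [← mul_assoc, σ_mul_σ, s_mul_s, σ_one, one_mul])
    (fun m => by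
      simp only [AddMonoidHom.coe_mulLeft]
      rw [← mul_assoc, ← mul_assoc, ← mul_assoc, ← mul_assoc, mul_assoc (σ (s i)), σ_mul_σ, σ_mul_σ,
        σ_mul_σ, mul_assoc (s (i + 1)), s_braid h])
    (x := epF i) (y := epF (i + 1)) (z := epF (i + 1 + 1)) (smul_epF_left i) (smul_epF_right i)
    (smul_epF_of_ne h h₁) (smul_epF_of_ne h₂.symm h.symm) (smul_epF_left _) (smul_epF_right _)
    (epF_sub_ne_zero i) (epF_sub_ne_zero (i + 1)) (A := fun m => simpleA i * m)
    (B := fun m => simpleA (i + 1) * m) (simpleA_mul i) (simpleA_mul (i + 1)) 1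
  simpa only [mul_one] using this

/-- `A_{i_1} ⋯ A_{i_l}` for a word. -/
def wordA (l : List (ZMod n)) : FW n := (l.map simpleA).prod

theorem wordA_cons (i : ZMod n) (l : List (ZMod n)) : wordA (i :: l) = simpleA i * wordA l := by
  simp [wordA]

theorem IsReducedWord.tail {i : ZMod n} {l : List (ZMod n)} {w : W n}
    (h : IsReducedWord (i :: l) w) : IsReducedWord l (s i * w) ∧ ¬ Ascent i w := by
  obtain ⟨rfl, hlen⟩ := h
  have e : s i * wordProd (i :: l) = wordProd l := by rw [wordProd_cons, s_mul_s_mul]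
  have h1 := length_wordProd_le l
  have h2 := length_s_mul_le i (wordProd l)
  rw [← wordProd_cons, ← hlen, List.length_cons] at h2
  refine ⟨⟨e.symm, by rw [e]; omega⟩, ?_⟩
  rw [Ascent, e, ← hlen, List.length_cons]
  omega

theorem IsReducedWord.cons {i : ZMod n} {l : List (ZMod n)} {w : W n}
    (h : IsReducedWord l (s i * w)) (hw : ¬ Ascent i w) : IsReducedWord (i :: l) w := by
  obtain ⟨h1, h2⟩ := h
  refine ⟨by rw [wordProd_cons, h1, s_mul_s_mul], ?_⟩
  rw [List.length_cons, h2, length_of_not_ascent hw]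

theorem not_ascent_comm {i j : ZMod n} (h : j ≠ i) (h₁ : j ≠ i + 1) (h₂ : i ≠ j + 1) {w : W n}
    (hj : ¬ Ascent j w) : ¬ Ascent j (s i * w) := by
  obtain ⟨k, rfl⟩ := exists_intCast j
  rw [not_ascent_iff] at hj ⊢
  have h₃ : ((k + 1 : ℤ) : ZMod n) ≠ i + 1 := by
    push_cast; exact fun e => h (add_right_cancel e)
  rw [pos_s_mul, pos_s_mul, simpleFun_of_ne h h₁, simpleFun_of_ne _ h₃]
  · exact hj
  · push_cast; exact h₂.symm

/-- Two adjacent descents mean that k + 2, k + 1, k occur in this order from left to right, so both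
sides of the braid relation can begin a reduced word. For n = 2 this is impossible, as k + n always
stands to the right of k. -/
theorem not_ascent_braid {k : ℤ} {w : W n} (h₀ : ¬ Ascent (k : ZMod n) w)
    (h₁ : ¬ Ascent ((k + 1 : ℤ) : ZMod n) w) :
    (k : ZMod n) + 1 + 1 ≠ k ∧ ¬ Ascent ((k + 1 : ℤ) : ZMod n) (s (k : ZMod n) * w) ∧
      ¬ Ascent (k : ZMod n) (s ((k + 1 : ℤ) : ZMod n) * (s (k : ZMod n) * w)) ∧
      ¬ Ascent (k : ZMod n) (s ((k + 1 : ℤ) : ZMod n) * w) ∧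
      ¬ Ascent ((k + 1 : ℤ) : ZMod n) (s (k : ZMod n) * (s ((k + 1 : ℤ) : ZMod n) * w)) := by
  rw [not_ascent_iff] at h₀ h₁
  have hne : (k : ZMod n) + 1 + 1 ≠ k := by
    intro e
    have e' : ((k : ℤ) : ZMod n) = ((k + 1 + 1 : ℤ) : ZMod n) := by push_cast; exact e.symm
    obtain ⟨m, hm⟩ := exists_eq_add_mul e'
    rw [hm, pos_add_mul] at h₁
    have : 0 < m * (n : ℤ) := by omega
    omega
  have e1 : simpleFun n (k : ZMod n) (k + 1 + 1) = k + 1 + 1 := by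
    refine simpleFun_of_ne ?_ ?_
    · push_cast; exact hne
    · push_cast; exact zmod_succ_ne _
  have e2 : simpleFun n ((k + 1 : ℤ) : ZMod n) k = k := by
    refine simpleFun_of_ne ?_ ?_
    · push_cast; exact (zmod_succ_ne _).symm
    · push_cast; exact hne.symm
  refine ⟨hne, ?_, ?_, ?_, ?_⟩ <;>
  · rw [not_ascent_iff]
    simp only [pos_s_mul, simpleFun_left, simpleFun_right, e1, e2]
    omega

/-- Matsumoto's argument. If the first letters differ, both are descents of w, so w also has two
reduced words that begin with the two sides of a braid or commutation relation and agree afterwards.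
Each given word is compared by induction with the one sharing its first letter. -/
theorem wordA_eq (m : ℕ) : ∀ {l l' : List (ZMod n)} {w : W n}, length w = m →
    IsReducedWord l w → IsReducedWord l' w → wordA l = wordA l' := by
  induction m using Nat.strong_induction_on with
  | _ m ih =>
    intro l l' w hm hl hl'
    have step : ∀ {i : ZMod n} {l l' : List (ZMod n)}, ¬ Ascent i w →
        IsReducedWord l (s i * w) → IsReducedWord l' (s i * w) → wordA l = wordA l' :=
      fun h h1 h2 => ih _ (by have := length_of_not_ascent h; omega) rfl h1 h2
    have braid : ∀ {k : ℤ} {l l' : List (ZMod n)}, ¬ Ascent (k : ZMod n) w →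
        ¬ Ascent ((k + 1 : ℤ) : ZMod n) w → IsReducedWord l (s (k : ZMod n) * w) →
        IsReducedWord l' (s ((k + 1 : ℤ) : ZMod n) * w) →
        wordA ((k : ZMod n) :: l) = wordA (((k + 1 : ℤ) : ZMod n) :: l') := by
      intro k l l' h₀ h₁ hl hl'
      obtain ⟨hne, a₁, a₂, b₁, b₂⟩ := not_ascent_braid h₀ h₁
      obtain ⟨r, hr⟩ := exists_reducedWord
        (s (k : ZMod n) * (s ((k + 1 : ℤ) : ZMod n) * (s (k : ZMod n) * w)))
      have hc : ((k + 1 : ℤ) : ZMod n) = (k : ZMod n) + 1 := by push_cast; rfl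
      have hr' : IsReducedWord r
          (s ((k + 1 : ℤ) : ZMod n) * (s (k : ZMod n) * (s ((k + 1 : ℤ) : ZMod n) * w))) := by
        have := s_braid hne
        convert hr using 1
        rw [← mul_assoc, ← mul_assoc, ← mul_assoc, ← mul_assoc, hc]
        rw [← mul_assoc, ← mul_assoc] at this
        rw [this]
      rw [wordA_cons, step h₀ hl ((hr.cons a₂).cons a₁), wordA_cons _ l',
        step h₁ hl' ((hr'.cons b₂).cons b₁)]
      simp only [wordA_cons, hc]
      have := simpleA_braid hne
      rw [← mul_assoc, ← mul_assoc] at this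
      rw [← mul_assoc, ← mul_assoc, this, mul_assoc, mul_assoc]
    cases l with
    | nil =>
      have h0 : length w = 0 := by rw [← hl.2]; rfl
      cases l' with
      | nil => rfl
      | cons j l' => exact absurd hl'.2 (by rw [h0]; simp)
    | cons i l =>
      cases l' with
      | nil => exact absurd hl.2 (by rw [← hl'.2]; simp)
      | cons j l' =>
        obtain ⟨h1, hi⟩ := hl.tail
        obtain ⟨h1', hj⟩ := hl'.tail
        by_cases hij : j = i
        · subst hij
          rw [wordA_cons, wordA_cons, step hi h1 h1']
        by_cases hij₁ : j = i + 1
        · obtain ⟨k, rfl⟩ := exists_intCast i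
          obtain rfl : j = ((k + 1 : ℤ) : ZMod n) := by rw [hij₁]; push_cast; rfl
          exact braid hi hj h1 h1'
        by_cases hij₂ : i = j + 1
        · obtain ⟨k, rfl⟩ := exists_intCast j
          obtain rfl : i = ((k + 1 : ℤ) : ZMod n) := by rw [hij₂]; push_cast; rfl
          exact (braid hj hi h1' h1).symm
        have a₁ := not_ascent_comm hij hij₁ hij₂ hj
        have b₁ := not_ascent_comm (Ne.symm hij) hij₂ hij₁ hi
        obtain ⟨r, hr⟩ := exists_reducedWord (s j * (s i * w))
        have hr' : IsReducedWord r (s i * (s j * w)) := by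
          rwa [← mul_assoc, s_comm hij hij₁ hij₂, mul_assoc]
        rw [wordA_cons, step hi h1 (hr.cons a₁), wordA_cons _ l', step hj h1' (hr'.cons b₁),
          wordA_cons, wordA_cons, ← mul_assoc, simpleA_comm hij hij₁ hij₂, mul_assoc]

theorem A_eq_wordA {l : List (ZMod n)} {w : W n} (h : IsReducedWord l w) : A w = wordA l :=
  wordA_eq _ rfl (exists_reducedWord w).choose_spec h

theorem A_one : A (1 : W n) = 1 :=
  A_eq_wordA (l := []) ⟨rfl, length_one.symm⟩

theorem simpleA_mul_A_of_ascent {i : ZMod n} {w : W n} (h : Ascent i w) :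
    simpleA i * A w = A (s i * w) := by
  obtain ⟨l, hl⟩ := exists_reducedWord w
  have hl' : IsReducedWord l (s i * (s i * w)) := by rwa [s_mul_s_mul]
  have : ¬ Ascent i (s i * w) := by rw [ascent_s_mul_iff]; exact not_not.2 h
  rw [A_eq_wordA hl, A_eq_wordA (hl'.cons this), wordA_cons]

theorem simpleA_mul_A_of_not_ascent {i : ZMod n} {w : W n} (h : ¬ Ascent i w) :
    simpleA i * A w = 0 := by
  rw [← s_mul_s_mul i w, ← simpleA_mul_A_of_ascent ((ascent_s_mul_iff i w).2 h), ← mul_assoc,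
    simpleA_mul_self, zero_mul]

theorem coeff_σ_mul (v w : W n) (x : FW n) : (σ v * x).coeff w = v • x.coeff (v⁻¹ * w) := by
  rw [SkewMonoidAlgebra.coeff_single_mul, one_mul]

/-- Triangularity: A_w has a nonzero coefficient at w, and all its other terms are shorter. Linear
independence follows by looking at an element of maximal length in the support. -/
theorem coeff_A (w : W n) : (A w).coeff w ≠ 0 ∧
    ∀ v, length w ≤ length v → v ≠ w → (A w).coeff v = 0 := by
  induction w using length_induction with
  | one =>
    rw [A_one]
    refine ⟨by simp, fun v _ hv => ?_⟩
    rw [SkewMonoidAlgebra.coeff_one, Finsupp.single_eq_of_ne hv]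
  | step i w hi ih =>
    have hlen := length_of_ascent hi
    have key : ∀ v, (A (s i * w)).coeff v =
        (epF i - epF (i + 1))⁻¹ * ((A w).coeff v - s i • (A w).coeff (s i * v)) := by
      intro v
      rw [← simpleA_mul_A_of_ascent hi, simpleA_mul, SkewMonoidAlgebra.coeff_smul, Finsupp.smul_apply,
        SkewMonoidAlgebra.coeff_sub, Finsupp.sub_apply, coeff_σ_mul, s_inv, smul_eq_mul]
    constructor
    · rw [key, s_mul_s_mul, ih.2 (s i * w) (by omega) (fun e => by rw [e] at hlen; omega), zero_sub]
      refine mul_ne_zero (inv_ne_zero (epF_sub_ne_zero i)) (neg_ne_zero.2 ?_)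
      exact (smul_ne_zero_iff_ne _).2 ih.1
    · intro v hv hne
      have h1 := length_s_mul_le i (s i * v)
      rw [s_mul_s_mul] at h1
      rw [key, ih.2 v (by omega) (fun e => by rw [e] at hv; omega),
        ih.2 (s i * v) (by omega) (fun e => hne (by rw [← e, s_mul_s_mul])), smul_zero, sub_zero,
        mul_zero]

theorem linearIndependent_A : LinearIndependent (F n) (A (n := n)) := by
  rw [linearIndependent_iff]
  intro c hc
  by_contra hne
  obtain ⟨w, hw, hmax⟩ := c.support.exists_max_image length (Finsupp.support_nonempty_iff.2 hne)
  have h := congrArg (fun x : FW n => SkewMonoidAlgebra.coeffLinearEquiv (S := F n) x w) hc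
  simp only [Finsupp.linearCombination_apply, Finsupp.sum, map_sum, map_smul,
    Finsupp.finsetSum_apply, Finsupp.smul_apply, map_zero, Finsupp.zero_apply] at h
  rw [Finset.sum_eq_single_of_mem w hw] at h
  · exact (mul_ne_zero (Finsupp.mem_support_iff.1 hw) (coeff_A w).1) h
  · intro v hv hvw
    have : (SkewMonoidAlgebra.coeffLinearEquiv (S := F n) (A v)) w = 0 :=
      (coeff_A v).2 w (hmax v hv) hvw.symm
    rw [this, smul_zero]

/-! ### Expansions in a family indexed by `W` and in its tensor square -/

section Expansions

variable {R K M : Type*} [CommRing R] [Field K] [Algebra R K] [AddCommGroup M] [Module K M]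

/-- `∑ x_v v ↦ ∑ x_v a_v`. -/
def sumA (K : Type*) [Field K] [Algebra R K] [Module K M] (a : W n → M) : (W n →₀ R) →+ M :=
  Finsupp.liftAddHom fun v => (AddMonoidHom.flip (smulAddHom K M) (a v)).comp
    (algebraMap R K).toAddMonoidHom

theorem sumA_single (a : W n → M) (v : W n) (p : R) :
    sumA K a (Finsupp.single v p) = algebraMap R K p • a v := by
  simp [sumA]

theorem sumA_bas (a : W n → M) (w : W n) : sumA K a (bas R w) = a w := by
  rw [bas, sumA_single, map_one, one_smul]

theorem sumA_smul (a : W n → M) (p : R) (x : W n →₀ R) :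
    sumA K a (p • x) = algebraMap R K p • sumA K a x := by
  induction x using Finsupp.induction_linear with
  | zero => simp
  | add x y hx hy => rw [smul_add, map_add, hx, hy, map_add, smul_add]
  | single v q => rw [Finsupp.smul_single, sumA_single, sumA_single, smul_eq_mul, map_mul, mul_smul]

/-- `∑ x_{uv} (u, v) ↦ ∑ x_{uv} a_u ⊗ a_v`. -/
def sumAA (K : Type*) [Field K] [Algebra R K] [Module K M] (a : W n → M) :
    (W n →₀ W n →₀ R) →+ M ⊗[K] M :=
  Finsupp.liftAddHom fun u => (TensorProduct.mk K M M (a u)).toAddMonoidHom.comp (sumA K a)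

theorem sumAA_single (a : W n → M) (u : W n) (x : W n →₀ R) :
    sumAA K a (Finsupp.single u x) = a u ⊗ₜ[K] sumA K a x := by
  simp [sumAA]

theorem sumAA_smul (a : W n → M) (p : R) (x : W n →₀ W n →₀ R) :
    sumAA K a (p • x) = algebraMap R K p • sumAA K a x := by
  induction x using Finsupp.induction_linear with
  | zero => simp
  | add x y hx hy => rw [smul_add, map_add, hx, hy, map_add, smul_add]
  | single v q => rw [Finsupp.smul_single, sumAA_single, sumAA_single, sumA_smul,
      TensorProduct.tmul_smul]

theorem sumAA_curry (a : W n → M) (c : W n × W n →₀ R) :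
    sumAA K a c.curry = c.sum fun uv p => algebraMap R K p • (a uv.1 ⊗ₜ[K] a uv.2) := by
  have h : sumAA K a c.curry = ((sumAA K a).comp
      (Finsupp.curryAddEquiv (α := W n) (β := W n) (M := R)).toAddMonoidHom) c := rfl
  have h' : (c.sum fun uv p => algebraMap R K p • (a uv.1 ⊗ₜ[K] a uv.2)) =
      (Finsupp.liftAddHom fun uv : W n × W n =>
        (AddMonoidHom.flip (smulAddHom K (M ⊗[K] M)) (a uv.1 ⊗ₜ[K] a uv.2)).comp
          (algebraMap R K).toAddMonoidHom) c := rfl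
  rw [h, h']
  congr 1
  refine Finsupp.addHom_ext fun uv p => ?_
  rw [Finsupp.liftAddHom_apply_single]
  change sumAA K a (Finsupp.single uv p).curry = _
  rw [Finsupp.curry_single, sumAA_single, sumA_single, TensorProduct.tmul_smul]
  rfl

theorem sum_tmul_injective {a : W n → M} (ha : LinearIndependent K a)
    (hinj : Function.Injective (algebraMap R K)) {c c' : W n × W n →₀ R}
    (h : (c.sum fun uv p => algebraMap R K p • (a uv.1 ⊗ₜ[K] a uv.2)) =
      c'.sum fun uv p => algebraMap R K p • (a uv.1 ⊗ₜ[K] a uv.2)) : c = c' := by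
  have key : ∀ c : W n × W n →₀ R,
      (c.sum fun uv p => algebraMap R K p • (a uv.1 ⊗ₜ[K] a uv.2)) =
        Finsupp.linearCombination K (fun uv : W n × W n => a uv.1 ⊗ₜ[K] a uv.2)
          (c.mapRange (algebraMap R K) (map_zero _)) := by
    intro c
    rw [Finsupp.linearCombination_apply, Finsupp.sum_mapRange_index]
    intro a
    rw [zero_smul]
  rw [key, key] at h
  exact Finsupp.mapRange_injective _ (map_zero _) hinj (ha.tmul_of_isDomain ha h)

theorem sumAA_injective {a : W n → M} (ha : LinearIndependent K a)
    (hinj : Function.Injective (algebraMap R K)) :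
    Function.Injective (sumAA (R := R) K a) := by
  intro c c' h
  rw [← Finsupp.curry_uncurry c, ← Finsupp.curry_uncurry c', sumAA_curry, sumAA_curry] at h
  rw [← Finsupp.curry_uncurry c, sum_tmul_injective ha hinj h, Finsupp.curry_uncurry]

/-- The diagonal map `x ⊗ y ↦ p x ⊗ p y` of a semilinear map `p`. -/
def diagMap (p : M →+ M) (p' : K → K) (hp : ∀ k m, p (k • m) = p' k • p m) :
    M ⊗[K] M →+ M ⊗[K] M :=
  TensorProduct.liftAddHom
    { toFun := fun x => (TensorProduct.mk K M M (p x)).toAddMonoidHom.comp p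
      map_zero' := by ext; simp
      map_add' := fun x y => by ext; simp }
    (fun k x y => by
      change p (k • x) ⊗ₜ[K] p y = p x ⊗ₜ[K] p (k • y)
      rw [hp, hp, TensorProduct.smul_tmul])

variable {σ' : R →+* R} {α : R} {i : ZMod n}

open Classical in
theorem sumA_twist {a : W n → M} {p : M →+ M} {p' : K → K} (hp : ∀ k m, p (k • m) = p' k • p m)
    (hp' : ∀ r, p' (algebraMap R K r) = algebraMap R K (σ' r))
    (hpa : ∀ w, p (a w) = a w - algebraMap R K α • (if Ascent i w then a (s i * w) else 0))
    (x : W n →₀ R) : sumA K a (twist σ' α i x) = p (sumA K a x) := by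
  induction x using Finsupp.induction_linear with
  | zero => simp
  | add x y hx hy => rw [map_add, map_add, hx, hy, map_add, map_add]
  | single w r =>
    have e : Finsupp.single w r = r • bas R w := by simp [bas]
    rw [e, twist_smul, sumA_smul, twist_apply, coeffMap_bas, sumA_smul, sumA_bas, hp, hp', hpa,
      LinearMap.sub_apply, map_sub, LinearMap.smul_apply, sumA_smul, Module.End.one_apply, sumA_bas]
    split_ifs with h
    · rw [upOp_of_ascent h, sumA_bas]
    · rw [upOp_of_not_ascent h, map_zero]

open Classical in
/-- The operator corresponding to a diagonal map in the basis `a_u ⊗ a_v`. -/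
def twist₂ (σ' : R →+* R) (α : R) (i : ZMod n) : (W n →₀ W n →₀ R) →+ (W n →₀ W n →₀ R) :=
  Finsupp.liftAddHom fun u => AddMonoidHom.comp
    { toFun := fun x => Finsupp.single u x - if Ascent i u then Finsupp.single (s i * u) (α • x) else 0
      map_zero' := by simp only [smul_zero, Finsupp.single_zero, ite_self]; abel
      map_add' := fun x y => by
        split_ifs
        · simp only [smul_add, Finsupp.single_add]; abel
        · simp only [Finsupp.single_add]; abel } (twist σ' α i)

open Classical in
theorem twist₂_single (u : W n) (x : W n →₀ R) :
    twist₂ σ' α i (Finsupp.single u x) = Finsupp.single u (twist σ' α i x) -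
      if Ascent i u then Finsupp.single (s i * u) (α • twist σ' α i x) else 0 := by
  rw [twist₂, Finsupp.liftAddHom_apply_single]
  rfl

-- The slice at u receives a contribution from the slice at u, and one from the slice at s_i u
-- exactly when s_i u ascends to u.
open Classical in
theorem twist₂_apply (c : W n →₀ W n →₀ R) (u : W n) :
    twist₂ σ' α i c u = twist σ' α i (c u) -
      if Ascent i u then 0 else α • twist σ' α i (c (s i * u)) := by
  induction c using Finsupp.induction_linear with
  | zero => simp
  | add x y hx hy =>
    rw [map_add, Finsupp.add_apply, hx, hy]
    split_ifs
    · simp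
    · simp only [Finsupp.add_apply, map_add, smul_add]; abel
  | single v x =>
    rw [twist₂_single, Finsupp.sub_apply]
    congr 1
    · by_cases h : u = v
      · subst h; simp
      · simp [Ne.symm h]
    · by_cases h : s i * u = v
      · subst h
        have := ascent_s_mul_iff i u
        by_cases hu : Ascent i u
        · simp [this, hu]
        · simp [this, hu, s_mul_s_mul]
      · have h' : s i * v ≠ u := fun e => h (by rw [← e, s_mul_s_mul])
        split_ifs <;> simp [h', Ne.symm h]

open Classical in
theorem sumAA_twist₂ {a : W n → M} {p : M →+ M} {p' : K → K} (hp : ∀ k m, p (k • m) = p' k • p m)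
    (hp' : ∀ r, p' (algebraMap R K r) = algebraMap R K (σ' r))
    (hpa : ∀ w, p (a w) = a w - algebraMap R K α • (if Ascent i w then a (s i * w) else 0))
    (c : W n →₀ W n →₀ R) : sumAA K a (twist₂ σ' α i c) = diagMap p p' hp (sumAA K a c) := by
  induction c using Finsupp.induction_linear with
  | zero => simp
  | add x y hx hy => rw [map_add, map_add, hx, hy, map_add, map_add]
  | single u x =>
    have : diagMap p p' hp (sumAA K a (Finsupp.single u x)) = p (a u) ⊗ₜ[K] p (sumA K a x) := by
      rw [sumAA_single]; rfl
    rw [this, twist₂_single]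
    refine (map_sub (sumAA (R := R) K a) _ _).trans ?_
    rw [sumAA_single, sumA_twist hp hp' hpa, hpa, TensorProduct.sub_tmul]
    congr 1
    split_ifs with h
    · rw [sumAA_single, sumA_smul, sumA_twist hp hp' hpa, TensorProduct.smul_tmul]
    · rw [map_zero, smul_zero, TensorProduct.zero_tmul]

/-- Coefficientwise, c - s_i·c is r - σ'(r) plus visible multiples of α. -/
theorem exists_smul_eq_sub_twist₂ (hσ : ∀ r, α ∣ r - σ' r) (c : W n →₀ W n →₀ R) :
    ∃ d : W n →₀ W n →₀ R, α • d = c - twist₂ σ' α i c := by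
  classical
  have hdvd : ∀ u v, ∃ q, α * q = (c - twist₂ σ' α i c) u v := by
    intro u v
    obtain ⟨q, hq⟩ := hσ (c u v)
    rw [Finsupp.sub_apply, twist₂_apply, twist_apply]
    refine ⟨q + upOp R i (coeffMap σ' (c u)) v +
      (if Ascent i u then 0 else twist σ' α i (c (s i * u))) v, ?_⟩
    rw [mul_add, mul_add, ← hq]
    have : (coeffMap σ' (c u)) v = σ' (c u v) := by simp [coeffMap]
    simp only [LinearMap.sub_apply, LinearMap.smul_apply, Module.End.one_apply, Finsupp.sub_apply,
      Finsupp.smul_apply, this, smul_eq_mul]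
    split_ifs <;> simp <;> ring
  -- Quotients by α are merely chosen; sending 0 to 0 is needed for the result to keep finite
  -- support.
  let div : R → R := fun p => if h : p ≠ 0 ∧ ∃ q, α * q = p then h.2.choose else 0
  have div_zero : div 0 = 0 := by simp [div]
  have hdiv : ∀ p, (∃ q, α * q = p) → α * div p = p := by
    intro p hp
    by_cases h0 : p = 0
    · rw [h0, div_zero, mul_zero]
    · have h : p ≠ 0 ∧ ∃ q, α * q = p := ⟨h0, hp⟩
      simp only [div, dif_pos h]
      exact h.2.choose_spec
  refine ⟨(c - twist₂ σ' α i c).mapRange (Finsupp.mapRange div div_zero) Finsupp.mapRange_zero, ?_⟩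
  ext u v
  rw [Finsupp.smul_apply, Finsupp.smul_apply, Finsupp.mapRange_apply, Finsupp.mapRange_apply,
    smul_eq_mul]
  exact hdiv _ (hdvd u v)

end Expansions

/-! ### The coproduct expansion of `A_w` -/

/-- The action of `w` on `S`. -/
abbrev actHom (w : W n) : S n →+* S n := MulSemiringAction.toRingHom (W n) (S n) w

/-- Left multiplication by `w` on `F_W`. -/
abbrev leftMul (w : W n) : FW n →+ FW n := AddMonoidHom.mulLeft (σ w)

/-- The diagonal left multiplication by `w`. -/
def diagMul (w : W n) : FW n ⊗[F n] FW n →+ FW n ⊗[F n] FW n :=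
  diagMap (leftMul w) (fun f => w • f) (σ_mul_smul w)

theorem diagMul_tmul (w : W n) (x y : FW n) :
    diagMul w (x ⊗ₜ[F n] y) = (σ w * x) ⊗ₜ[F n] (σ w * y) := rfl

theorem coproduct_single (w : W n) (f : F n) :
    coproduct n (SkewMonoidAlgebra.single w f) = f • (σ w ⊗ₜ[F n] σ w) := by
  rw [single_eq, map_smul, coproduct]
  congr 1
  exact Module.Basis.constr_basis _ _ _ _

theorem coproduct_σ_mul (w : W n) (x : FW n) :
    coproduct n (σ w * x) = diagMul w (coproduct n x) := by
  induction x using SkewMonoidAlgebra.induction_on with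
  | zero => rw [mul_zero, LinearMap.map_zero, AddMonoidHom.map_zero]
  | single g a =>
    have h : a • (σ g ⊗ₜ[F n] σ g) = (a • σ g) ⊗ₜ[F n] σ g := TensorProduct.smul_tmul' _ _ _
    rw [SkewMonoidAlgebra.single_mul_single, one_mul, coproduct_single, coproduct_single, h,
      diagMul_tmul, σ_mul_smul, σ_mul_σ, ← TensorProduct.smul_tmul']
  | add x y hx hy =>
    rw [mul_add, LinearMap.map_add, hx, hy, LinearMap.map_add, AddMonoidHom.map_add]

theorem coproduct_simpleA_mul (i : ZMod n) (x : FW n) :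
    algebraMap (S n) (F n) (root i) • coproduct n (simpleA i * x) =
      coproduct n x - diagMul (s i) (coproduct n x) := by
  rw [simpleA_mul, LinearMap.map_smul, smul_smul, algebraMap_root,
    mul_inv_cancel₀ (epF_sub_ne_zero i), one_smul]
  refine (map_sub (coproduct n) x (σ (s i) * x)).trans ?_
  rw [coproduct_σ_mul]

open Classical in
theorem leftMul_A (i : ZMod n) (w : W n) :
    leftMul (s i) (A w) =
      A w - algebraMap (S n) (F n) (root i) • (if Ascent i w then A (s i * w) else 0) := by
  have : (if Ascent i w then A (s i * w) else 0) = simpleA i * A w := by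
    split_ifs with h
    · exact (simpleA_mul_A_of_ascent h).symm
    · exact (simpleA_mul_A_of_not_ascent h).symm
  rw [this, simpleA_mul, smul_smul, algebraMap_root, mul_inv_cancel₀ (epF_sub_ne_zero i), one_smul,
    sub_sub_cancel]
  rfl

theorem isCoproductExpansion_iff {w : W n} {c : W n × W n →₀ S n} :
    IsCoproductExpansion w c ↔ sumAA (F n) A c.curry = coproduct n (A w) := by
  rw [IsCoproductExpansion, sumAA_curry, eq_comm]

theorem sumAA_A_injective : Function.Injective (sumAA (R := S n) (F n) (A (n := n))) :=
  sumAA_injective linearIndependent_A (IsFractionRing.injective (S n) (F n))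

theorem isCoproductExpansion_unique {w : W n} {c c' : W n × W n →₀ S n}
    (h : IsCoproductExpansion w c) (h' : IsCoproductExpansion w c') : c = c' := by
  have := sumAA_A_injective
    ((isCoproductExpansion_iff.1 h).trans (isCoproductExpansion_iff.1 h').symm)
  rw [← Finsupp.uncurry_curry c, this, Finsupp.uncurry_curry]

theorem smul_left_cancel_of_ne_zero {K M : Type*} [Field K] [AddCommGroup M] [Module K M] {k : K}
    (hk : k ≠ 0) {x y : M} (h : k • x = k • y) : x = y := by
  rw [← one_smul K x, ← inv_mul_cancel₀ hk, mul_smul, h, ← mul_smul, inv_mul_cancel₀ hk, one_smul]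

theorem sumAA_sub_twist₂ (i : ZMod n) (c : W n →₀ W n →₀ S n) :
    sumAA (F n) A (c - twist₂ (actHom (s i)) (root i) i c) =
      sumAA (F n) A c - diagMul (s i) (sumAA (F n) A c) := by
  refine (map_sub (sumAA (R := S n) (F n) A) _ _).trans ?_
  exact congrArg (fun x => sumAA (F n) A c - x)
    (sumAA_twist₂ (σ' := actHom (s i)) (p := leftMul (s i)) (p' := fun f => s i • f)
      (σ_mul_smul (s i)) (smul_algebraMap (s i)) (leftMul_A i) c)

theorem sumAA_eq_coproduct {i : ZMod n} {w : W n} (hi : Ascent i w)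
    {c d : W n →₀ W n →₀ S n} (hc : sumAA (F n) A c = coproduct n (A w))
    (hd : root i • d = c - twist₂ (actHom (s i)) (root i) i c) :
    sumAA (F n) A d = coproduct n (A (s i * w)) := by
  have h0 : algebraMap (S n) (F n) (root i) ≠ 0 := by
    rw [algebraMap_root]; exact epF_sub_ne_zero i
  refine smul_left_cancel_of_ne_zero h0 ?_
  rw [← sumAA_smul, hd, sumAA_sub_twist₂, hc, ← simpleA_mul_A_of_ascent hi,
    coproduct_simpleA_mul]

theorem sumAA_one :
    sumAA (F n) A (Finsupp.single 1 (bas (S n) 1)) = coproduct n (A (1 : W n)) := by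
  rw [sumAA_single, sumA_bas, A_one, ← σ_one, coproduct_single, one_smul]

theorem exists_expansion (w : W n) : ∃ c, IsCoproductExpansion w c := by
  suffices ∃ c : W n →₀ W n →₀ S n, sumAA (F n) A c = coproduct n (A w) by
    obtain ⟨c, hc⟩ := this
    exact ⟨c.uncurry, isCoproductExpansion_iff.2 (by rwa [Finsupp.curry_uncurry])⟩
  induction w using length_induction with
  | one => exact ⟨_, sumAA_one⟩
  | step i w hi ih =>
    obtain ⟨c, hc⟩ := ih
    obtain ⟨d, hd⟩ := exists_smul_eq_sub_twist₂ (i := i) (σ' := actHom (s i))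
      (root_dvd_sub_smul i) c
    exact ⟨d, sumAA_eq_coproduct hi hc hd⟩

/-- The structure constants `p^w_{u, ·}`. -/
def slices (w : W n) : W n →₀ W n →₀ S n := (exists_expansion w).choose.curry

theorem slices_apply (w u v : W n) : slices w u v = structureConst w u v := by
  rw [structureConst, dif_pos (exists_expansion w)]
  exact Finsupp.curry_apply _ _ _

theorem sumAA_slices (w : W n) : sumAA (F n) A (slices w) = coproduct n (A w) :=
  isCoproductExpansion_iff.1 (exists_expansion w).choose_spec

theorem slices_one : slices (1 : W n) = Finsupp.single 1 (bas (S n) 1) :=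
  sumAA_A_injective ((sumAA_slices 1).trans sumAA_one.symm)

/-- The quotient by the root expands Δ(A_{s_i w}), so by uniqueness of expansions it is the family
of structure constants of s_i w. -/
theorem root_smul_slices {i : ZMod n} {w : W n} (hi : Ascent i w) :
    root i • slices (s i * w) = slices w - twist₂ (actHom (s i)) (root i) i (slices w) := by
  obtain ⟨d, hd⟩ := exists_smul_eq_sub_twist₂ (i := i) (σ' := actHom (s i))
    (root_dvd_sub_smul i) (slices w)
  rw [sumAA_A_injective ((sumAA_slices (s i * w)).trans
    (sumAA_eq_coproduct hi (sumAA_slices w) hd).symm), hd]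

/-! ### Solutions of the recursion of the structure constants `p^w_{ρ_m, u}` -/

section Recursion

open Polynomial

/-- The product `y_{m+1} ⋯ y_{m+k}`. -/
def yProd {R : Type*} [CommRing R] (y : ZMod n → R) : ℕ → ℕ → R
  | _, 0 => 1
  | m, k + 1 => y ((m : ZMod n) + 1) * yProd y (m + 1) k

theorem yProd_succ_right {R : Type*} [CommRing R] (y : ZMod n → R) (m k : ℕ) :
    yProd y m (k + 1) = yProd y m k * y ((m + k : ℕ) + 1) := by
  induction k generalizing m with
  | zero => simp [yProd]
  | succ k ih =>
    rw [yProd, ih, yProd, mul_assoc]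
    congr 3
    push_cast
    ring

/-- The action exchanges y_k and y_{k+1} for k ≡ i, and the two conditions say that the range of the
product separates no such pair. -/
theorem map_yProd {R : Type*} [CommRing R] {y : ZMod n → R} {σ' : R →+* R} {i : ZMod n}
    (h : ∀ r, r ≠ i → r ≠ i + 1 → σ' (y r) = y r) (h₁ : σ' (y i) = y (i + 1))
    (h₂ : σ' (y (i + 1)) = y i) (k : ℕ) : ∀ m : ℕ, (m : ZMod n) ≠ i →
    ((m + k : ℕ) : ZMod n) ≠ i → σ' (yProd y m k) = yProd y m k := by
  induction k using Nat.strong_induction_on with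
  | _ k ih =>
    intro m hm hmk
    match k with
    | 0 => exact map_one σ'
    | k + 1 =>
      by_cases hi : (m : ZMod n) + 1 = i
      · match k with
        | 0 => exact absurd hi (by push_cast at hmk; simpa using hmk)
        | k + 1 =>
          have := ih k (by omega) (m + 1 + 1) (by
            push_cast; rw [hi]; exact zmod_succ_ne i) (by convert hmk using 2; ring)
          simp only [yProd, map_mul, this, Nat.cast_add, Nat.cast_one, hi, h₁, h₂]
          ring
      · have := ih k (by omega) (m + 1) (by push_cast; exact hi) (by convert hmk using 2; ring)
        rw [yProd, map_mul, this, h _ hi (fun e => hm (add_right_cancel e))]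

variable {B : Type*} [CommRing B]

/-- The elements `y_r = 1 - t e_r`. -/
def yElt (ε : ZMod n → B) (r : ZMod n) : B[X] := 1 - X * C (ε r)

/-- The extension of coefficients to polynomials. -/
def polyMap (n : ℕ) [n.AtLeastTwo] (B : Type*) [CommRing B] : (W n →₀ B) →+ (W n →₀ B[X]) :=
  Finsupp.mapRange.addMonoidHom (C : B →+* B[X]).toAddMonoidHom

theorem polyMap_apply (x : W n →₀ B) (w : W n) : polyMap n B x w = C (x w) := by
  simp [polyMap]

theorem polyMap_bas (w : W n) : polyMap n B (bas B w) = bas B[X] w := by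
  simp [polyMap, bas]

theorem polyMap_smul (r : B) (x : W n →₀ B) : polyMap n B (r • x) = C r • polyMap n B x := by
  ext1 w; simp [polyMap]

theorem polyMap_twist (τ : B →+* B) (α : B) (i : ZMod n) (x : W n →₀ B) :
    polyMap n B (twist τ α i x) = twist (mapRingHom τ) (C α) i (polyMap n B x) := by
  induction x using Finsupp.induction_linear with
  | zero => simp
  | add x y hx hy => rw [map_add, map_add, hx, hy, map_add, map_add]
  | single w r =>
    have e : Finsupp.single w r = r • bas B w := by simp [bas]
    have e' : polyMap n B (upOp B i (bas B w)) = upOp B[X] i (bas B[X] w) := by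
      by_cases h : Ascent i w
      · rw [upOp_of_ascent h, upOp_of_ascent h, polyMap_bas]
      · rw [upOp_of_not_ascent h, upOp_of_not_ascent h, map_zero]
    rw [e, twist_smul, polyMap_smul, polyMap_smul, twist_smul, coe_mapRingHom, map_C, polyMap_bas,
      twist_apply, twist_apply, coeffMap_bas, coeffMap_bas, LinearMap.sub_apply, LinearMap.sub_apply,
      map_sub, LinearMap.smul_apply, LinearMap.smul_apply, polyMap_smul, e', Module.End.one_apply,
      Module.End.one_apply, polyMap_bas]

/-- The generating function `∑_{m ≤ N} t^m y_{m+1} ⋯ y_N D_m`. -/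
def genFun (ε : ZMod n → B) (N : ℕ) (D : ℕ → (W n →₀ B)) : W n →₀ B[X] :=
  ∑ m ∈ Finset.range (N + 1), (X ^ m * yProd (yElt ε) m (N - m)) • polyMap n B (D m)

/-- This matches the scalar by which a new rightmost factor K_{N+1} acts on an element of length at
most N. -/
theorem genFun_succ (ε : ZMod n → B) (N : ℕ) {D : ℕ → (W n →₀ B)} (h : D (N + 1) = 0) :
    genFun ε (N + 1) D = yElt ε ((N : ZMod n) + 1) • genFun ε N D := by
  rw [genFun, Finset.sum_range_succ, h, map_zero, smul_zero, add_zero, genFun, Finset.smul_sum]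
  refine Finset.sum_congr rfl fun m hm => ?_
  have hm' : m ≤ N := Nat.lt_succ_iff.1 (Finset.mem_range.1 hm)
  rw [Nat.succ_sub hm', yProd_succ_right, Nat.add_sub_cancel' hm', smul_smul]
  congr 1
  ring

/-- The recursion for `D_m(w) = p^w_{ρ_m, ·}`. -/
structure IsPieriRecursion (τ : ZMod n → B →+* B) (ε : ZMod n → B) (D : W n → ℕ → (W n →₀ B)) :
    Prop where
  one_zero : D 1 0 = bas B 1
  one_succ : ∀ m, D 1 (m + 1) = 0
  zero : ∀ {i w}, Ascent i w → (ε i - ε (i + 1)) • D (s i * w) 0 =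
    D w 0 - twist (τ i) (ε i - ε (i + 1)) i (D w 0)
  succ_of_eq : ∀ {i w}, Ascent i w → ∀ m : ℕ, (m : ZMod n) = i →
    (ε i - ε (i + 1)) • D (s i * w) (m + 1) =
      D w (m + 1) - twist (τ i) (ε i - ε (i + 1)) i (D w (m + 1)) +
        (ε i - ε (i + 1)) • twist (τ i) (ε i - ε (i + 1)) i (D w m)
  succ_of_ne : ∀ {i w}, Ascent i w → ∀ m : ℕ, (m : ZMod n) ≠ i →
    (ε i - ε (i + 1)) • D (s i * w) (m + 1) =
      D w (m + 1) - twist (τ i) (ε i - ε (i + 1)) i (D w (m + 1))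
  left : ∀ i, τ i (ε i) = ε (i + 1)
  right : ∀ i, τ i (ε (i + 1)) = ε i
  of_ne : ∀ {i r}, r ≠ i → r ≠ i + 1 → τ i (ε r) = ε r
  sub_ne_zero : ∀ i, ε i - ε (i + 1) ≠ 0

theorem smul_finsupp_cancel {R ι : Type*} [CommRing R] [IsDomain R] {r : R} (hr : r ≠ 0)
    {x y : ι →₀ R} (h : r • x = r • y) : x = y := by
  ext a
  exact mul_left_cancel₀ hr (DFunLike.congr_fun h a)

namespace IsPieriRecursion

variable [IsDomain B] {τ : ZMod n → B →+* B} {ε : ZMod n → B} {D : W n → ℕ → (W n →₀ B)}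

theorem eq_zero (h : IsPieriRecursion τ ε D) (w : W n) : ∀ m, length w < m → D w m = 0 := by
  induction w using length_induction with
  | one =>
    intro m hm
    cases m with
    | zero => exact absurd hm (Nat.not_lt_zero _)
    | succ m => exact h.one_succ m
  | step i w hi ih =>
    intro m hm
    rw [length_of_ascent hi] at hm
    cases m with
    | zero => exact absurd hm (Nat.not_lt_zero _)
    | succ m =>
      refine smul_finsupp_cancel (h.sub_ne_zero i) ?_
      by_cases hm' : (m : ZMod n) = i
      · rw [h.succ_of_eq hi m hm', ih (m + 1) (by omega), ih m (by omega)]; simp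
      · rw [h.succ_of_ne hi m hm', ih (m + 1) (by omega)]; simp

theorem map_yElt (h : IsPieriRecursion τ ε D) (i : ZMod n) {r : ZMod n} (h₁ : r ≠ i)
    (h₂ : r ≠ i + 1) : mapRingHom (τ i) (yElt ε r) = yElt ε r := by
  simp [yElt, h.of_ne h₁ h₂]

theorem map_yElt_left (h : IsPieriRecursion τ ε D) (i : ZMod n) :
    mapRingHom (τ i) (yElt ε i) = yElt ε (i + 1) := by
  simp [yElt, h.left]

theorem map_yElt_right (h : IsPieriRecursion τ ε D) (i : ZMod n) :
    mapRingHom (τ i) (yElt ε (i + 1)) = yElt ε i := by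
  simp [yElt, h.right]

theorem yProd_sub_map_of_ne (h : IsPieriRecursion τ ε D) {i : ZMod n} {m k : ℕ}
    (hm : (m : ZMod n) ≠ i) (hmk : ((m + k : ℕ) : ZMod n) ≠ i) :
    mapRingHom (τ i) (yProd (yElt ε) m k) = yProd (yElt ε) m k :=
  map_yProd (fun _ h₁ h₂ => h.map_yElt i h₁ h₂) (h.map_yElt_left i) (h.map_yElt_right i) k m hm hmk

/-- Now the left end separates a pair, and only the first factor fails to be invariant: y_{i+1} -
y_i = t(e_i - e_{i+1}). -/
theorem yProd_sub_map_of_eq (h : IsPieriRecursion τ ε D) {i : ZMod n} {m k : ℕ}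
    (hm : (m : ZMod n) = i) (hmk : ((m + (k + 1) : ℕ) : ZMod n) ≠ i) :
    yProd (yElt ε) m (k + 1) - mapRingHom (τ i) (yProd (yElt ε) m (k + 1)) =
      X * C (ε i - ε (i + 1)) * yProd (yElt ε) (m + 1) k := by
  rw [yProd, map_mul, h.yProd_sub_map_of_ne (by push_cast; rw [hm]; exact zmod_succ_ne i)
    (by convert hmk using 2; ring), hm, h.map_yElt_right]
  simp only [yElt, C_sub]
  ring

/-- For m ≡ i, the extra term of the recursion for D_{m+1} exactly compensates the failure of
y_{m+1}⋯y_N to be invariant. The condition on N keeps the right end from separating a pair. -/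
theorem smul_genFun (h : IsPieriRecursion τ ε D) {i : ZMod n} {w : W n} (hi : Ascent i w) {N : ℕ}
    (hN : (N : ZMod n) ≠ i) : C (ε i - ε (i + 1)) • genFun ε N (D (s i * w)) =
      genFun ε N (D w) -
        twist (mapRingHom (τ i)) (C (ε i - ε (i + 1))) i (genFun ε N (D w)) := by
  classical
  set α := ε i - ε (i + 1) with hα
  set T : ℕ → (W n →₀ B[X]) := fun m => twist (mapRingHom (τ i)) (C α) i (polyMap n B (D w m))
    with hT
  set g : ℕ → B[X] := fun m => yProd (yElt ε) m (N - m) with hg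
  have e1 : genFun ε N (D w) - twist (mapRingHom (τ i)) (C α) i (genFun ε N (D w)) =
      ∑ m ∈ Finset.range (N + 1), ((X ^ m * g m) • (polyMap n B (D w m) - T m) +
        (X ^ m * (g m - mapRingHom (τ i) (g m))) • T m) := by
    rw [genFun, map_sum, ← Finset.sum_sub_distrib]
    refine Finset.sum_congr rfl fun m _ => ?_
    rw [twist_smul, map_mul, map_pow, coe_mapRingHom, map_X]
    simp only [hT, hg]
    module
  have e2 : C α • genFun ε N (D (s i * w)) =
      ∑ m ∈ Finset.range (N + 1), (X ^ m * g m) • (polyMap n B (D w m) - T m) +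
        ∑ m ∈ Finset.range N,
          if (m : ZMod n) = i then (X ^ (m + 1) * g (m + 1) * C α) • T m else 0 := by
    rw [genFun, Finset.sum_range_succ', Finset.sum_range_succ', smul_add, Finset.smul_sum]
    rw [add_right_comm, ← Finset.sum_add_distrib]
    congr 1
    · refine Finset.sum_congr rfl fun m _ => ?_
      rw [smul_comm, ← polyMap_smul]
      split_ifs with hm
      · rw [h.succ_of_eq hi m hm, map_add, map_sub, polyMap_twist, polyMap_smul, polyMap_twist,
          smul_add, smul_smul]
      · rw [h.succ_of_ne hi m hm, map_sub, polyMap_twist, add_zero]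
    · rw [smul_comm, ← polyMap_smul, h.zero hi, map_sub, polyMap_twist]
  rw [e1, e2, Finset.sum_add_distrib]
  congr 1
  rw [Finset.sum_range_succ]
  have e3 : g N = 1 := by simp only [hg, Nat.sub_self]; rfl
  rw [e3, map_one, sub_self, mul_zero, zero_smul, add_zero]
  refine Finset.sum_congr rfl fun m hm => ?_
  have hm' : N - m = N - (m + 1) + 1 := by have := Finset.mem_range.1 hm; omega
  have hmN : m + (N - (m + 1) + 1) = N := by have := Finset.mem_range.1 hm; omega
  split_ifs with hmi
  · simp only [hg]
    rw [hm', h.yProd_sub_map_of_eq hmi (by rw [hmN]; exact hN)]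
    congr 1
    ring
  · simp only [hg]
    rw [h.yProd_sub_map_of_ne hmi (by rw [hm', hmN]; exact hN), sub_self, mul_zero, zero_smul]

theorem yElt_ne_zero (ε : ZMod n → B) (r : ZMod n) : yElt ε r ≠ 0 := by
  intro e
  have := congrArg (fun p => p.coeff 0) e
  simp [yElt] at this

/-- The generating function is a product of the operators `K_c`. -/
theorem genFun_eq_kProd (h : IsPieriRecursion τ ε D) (w : W n) : ∀ N M : ℕ, length w ≤ N →
    length w ≤ M → genFun ε N (D w) =
      kProd (X : B[X]) (fun r => C (ε r)) (-(M : ℤ)) (M + N) (bas B[X] w) := by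
  have hcast : ∀ N M : ℕ, ((-(M : ℤ) + ((M + N : ℕ) : ℤ) + 1 : ℤ) : ZMod n) = (N : ZMod n) + 1 := by
    intro N M; push_cast; ring
  induction w using length_induction with
  | one =>
    intro N M _ _
    -- For the identity only D_0 contributes. On the other side K_c is trivial on it for c ≤ 0 and
    -- multiplies it by y_c for c > 0.
    have hN : ∀ N, genFun ε N (D 1) = yProd (yElt ε) 0 N • bas B[X] 1 := by
      intro N
      rw [genFun, Finset.sum_range_succ', Finset.sum_eq_zero, zero_add, h.one_zero, polyMap_bas]
      · simp
      · intro m _; rw [h.one_succ, map_zero, smul_zero]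
    rw [hN]
    induction N with
    | zero =>
      induction M with
      | zero => simp [yProd, kProd]
      | succ M ih =>
        rw [ih (by rw [length_one]; omega), show M + 1 + 0 = (M + 0) + 1 by ring, kProd_succ_bas_left]
        · congr 3; push_cast; ring
        · rw [length_one]; push_cast; omega
    | succ N ih =>
      rw [yProd_succ_right, mul_comm, mul_smul, ih (by rw [length_one]; omega), ← add_assoc, kProd_succ_bas, hcast,
        Nat.zero_add]
      · rfl
      · rw [length_one]; push_cast; omega
  | step i w hi ih =>
    have hlen := length_of_ascent hi
    -- When neither end of the window separates a pair, both sides satisfy the same recursion, from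
    -- which the nonzero root can be cancelled.
    have main : ∀ N M : ℕ, length w + 1 ≤ N → length w + 1 ≤ M → (N : ZMod n) ≠ i →
        ((-(M : ℤ) : ℤ) : ZMod n) ≠ i → genFun ε N (D (s i * w)) =
          kProd (X : B[X]) (fun r => C (ε r)) (-(M : ℤ)) (M + N) (bas B[X] (s i * w)) := by
      intro N M hN hM hNi hMi
      have hα : C (ε i - ε (i + 1)) ≠ 0 := C_ne_zero.2 (h.sub_ne_zero i)
      refine smul_finsupp_cancel hα ?_
      have hcomm := kProd_twist (σ := mapRingHom (τ i)) (t := (X : B[X]))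
        (e := fun r => C (ε r)) (i := i) (by simp) (fun r h₁ h₂ => by simp [h.of_ne h₁ h₂])
        (by simp [h.left]) (by simp [h.right]) (M + N) (-(M : ℤ)) hMi
        (by push_cast; simpa using hNi) (bas B[X] w)
      rw [← C_sub] at hcomm
      rw [h.smul_genFun hi hNi, ih N M (by omega) (by omega), hcomm, twist_bas _ _ hi, map_sub,
        sub_sub_cancel, map_smul]
    -- A bad left end is moved one step further left, which adds a factor acting trivially.
    have hM : ∀ N M : ℕ, length w + 1 ≤ N → length w + 1 ≤ M → (N : ZMod n) ≠ i →
        genFun ε N (D (s i * w)) =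
          kProd (X : B[X]) (fun r => C (ε r)) (-(M : ℤ)) (M + N) (bas B[X] (s i * w)) := by
      intro N M hN hM hNi
      by_cases hMi : ((-(M : ℤ) : ℤ) : ZMod n) = i
      · rw [main N (M + 1) hN (by omega) hNi, show M + 1 + N = M + N + 1 by ring,
          kProd_succ_bas_left]
        · congr 3; push_cast; ring
        · rw [hlen]; push_cast; omega
        · rw [← hMi]; push_cast
          intro e
          exact zmod_succ_ne (M : ZMod n) (neg_injective e)
      · exact main N M hN hM hNi hMi
    intro N M hN hM'
    rw [hlen] at hN hM'
    by_cases hNi : (N : ZMod n) = i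
    -- A bad right end is moved one step further right, which multiplies both sides by y_{N+1}; this
    -- is nonzero and can be cancelled.
    · have h1 := hM (N + 1) M (by omega) hM' (by
        push_cast; rw [hNi]; exact zmod_succ_ne i)
      rw [genFun_succ _ _ (h.eq_zero _ _ (by omega)), ← add_assoc, kProd_succ_bas] at h1
      · refine smul_finsupp_cancel (yElt_ne_zero ε ((N : ZMod n) + 1)) (h1.trans ?_)
        rw [hcast]; rfl
      · rw [hlen]; push_cast; omega
    · exact hM N M hN hM' hNi

theorem coeff_yProd_zero (ε : ZMod n → B) (m k : ℕ) : (yProd (yElt ε) m k).coeff 0 = 1 := by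
  induction k generalizing m with
  | zero => simp [yProd]
  | succ k ih => rw [yProd, mul_coeff_zero, ih, yElt]; simp

/-- Compare coefficients of t^j at u. In the generating function, terms with m > j do not reach t^j.
Terms with m < j vanish by induction, as no strip of length m goes from w to u when ℓ(u) + m < ℓ(w).
The term m = j gives D_j(u), the product of the y's having constant term 1. -/
theorem apply_eq_card (h : IsPieriRecursion τ ε D) (w u : W n) (j : ℕ) :
    length u + j ≤ length w → D w j u = (Nat.card (StrongStrip w u j) : B) := by
  induction j using Nat.strong_induction_on with
  | _ j ih =>
    intro hj
    have h1 := congrArg (fun x : W n →₀ B[X] => (x u).coeff j)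
      (h.genFun_eq_kProd w (length w) (length w) le_rfl le_rfl)
    rw [coeff_kProd_bas _ _ _ _ _ _ le_rfl hj, card_stripLE_of_length_le (by push_cast; omega),
      genFun, Finsupp.finsetSum_apply, finsetSum_coeff, Finset.sum_eq_single j] at h1
    · rw [← h1, Finsupp.smul_apply, polyMap_apply, smul_eq_mul, mul_assoc, coeff_X_pow_mul',
        if_pos le_rfl, Nat.sub_self, mul_coeff_zero, coeff_yProd_zero, coeff_C_zero, one_mul]
    · intro m _ hm
      rw [Finsupp.smul_apply, polyMap_apply, smul_eq_mul]
      rcases lt_or_gt_of_ne hm with hlt | hgt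
      · have : Nat.card (StrongStrip w u m) = 0 := by
          have : IsEmpty (StrongStrip w u m) := ⟨fun x => by have := x.length_add; omega⟩
          exact Nat.card_of_isEmpty
        rw [ih m hlt (by omega), this, Nat.cast_zero, C_0, mul_zero, coeff_zero]
      · rw [mul_assoc, coeff_X_pow_mul', if_neg (by omega)]
    · intro hnot
      exact absurd (Finset.mem_range.2 (by omega)) hnot

end IsPieriRecursion

end Recursion

/-! ### The elements `ρ_m` -/

theorem pos_rho_succ (m : ℕ) (k : ℤ) :
    pos (rho n (m + 1)) k = pos (rho n m) (simpleFun n (m : ZMod n) k) := by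
  rw [rho, pos_s_mul]

theorem pos_rho_self (m : ℕ) : pos (rho n m) m = 0 := by
  induction m with
  | zero => exact pos_one 0
  | succ m ih =>
    have h := simpleFun_right (n := n) m
    rw [Int.cast_natCast] at h
    rw [pos_rho_succ, Nat.cast_add, Nat.cast_one, h, ih]

theorem simpleFun_cast_ne {i : ZMod n} {k : ℤ} (h : (k : ZMod n) ≠ i + 1) :
    (simpleFun n i k : ZMod n) ≠ i := by
  by_cases hi : (k : ZMod n) = i
  · rw [← hi, simpleFun_left]; push_cast; exact zmod_succ_ne _
  · rwa [simpleFun_of_ne hi h]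

theorem pos_rho_pos (m : ℕ) : ∀ k : ℤ, m < k → (k : ZMod n) ≠ m → 0 < pos (rho n m) k := by
  induction m with
  | zero => intro k hk _; change 0 < pos 1 k; rw [pos_one]; exact_mod_cast hk
  | succ m ih =>
    intro k hk hne
    push_cast at hk hne
    rw [pos_rho_succ]
    refine ih _ ?_ (simpleFun_cast_ne hne)
    by_cases hi : (k : ZMod n) = m
    · rw [← hi, simpleFun_left]; omega
    · rw [simpleFun_of_ne hi hne]; omega

/-- In ρ_m the values outside the class of m keep their natural order, while m itself sits at
position 0, to the left of m + 1. Hence the only possible left descent is m - 1. -/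
theorem pos_rho_lt (m : ℕ) : ∀ k l : ℤ, k < l → (k : ZMod n) ≠ m → (l : ZMod n) ≠ m →
    pos (rho n m) k < pos (rho n m) l := by
  induction m with
  | zero => intro k l hkl _ _; change pos 1 k < pos 1 l; rwa [pos_one, pos_one]
  | succ m ih =>
    intro k l hkl hk hl
    push_cast at hk hl
    rw [pos_rho_succ, pos_rho_succ]
    refine ih _ _ ?_ (simpleFun_cast_ne hk) (simpleFun_cast_ne hl)
    by_contra hlt
    rcases (not_lt.1 hlt).lt_or_eq with h | h
    · obtain ⟨h1, h2⟩ := simpleFun_inverts hkl h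
      rw [h2] at hl
      push_cast at hl
      exact hl (by rw [h1])
    · have := (simpleFun_involutive n (m : ZMod n)).injective h
      omega

theorem ascent_rho_of_ne {i : ZMod n} {m : ℕ} (h : i + 1 ≠ m) : Ascent i (rho n m) := by
  obtain ⟨k, rfl⟩ := exists_intCast i
  rw [ascent_iff]
  by_cases hk : (k : ZMod n) = m
  · obtain ⟨q, hq⟩ := exists_eq_add_mul (n := n) (k := m) (l := k) (by push_cast; exact hk.symm)
    have h1 := pos_rho_pos (n := n) m (m + 1) (by omega) (by push_cast; exact zmod_succ_ne _)
    rw [hq, show (m : ℤ) + q * n + 1 = m + 1 + q * n by ring, pos_add_mul, pos_add_mul, pos_rho_self]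
    omega
  · exact pos_rho_lt m k (k + 1) (by omega) hk (by push_cast; exact h)

theorem ascent_rho_self (m : ℕ) : Ascent (m : ZMod n) (rho n m) :=
  ascent_rho_of_ne (zmod_succ_ne _)

theorem ascent_rho_zero (i : ZMod n) : Ascent i (rho n 0) := by
  obtain ⟨k, rfl⟩ := exists_intCast i
  rw [ascent_iff]
  change pos 1 k < pos 1 (k + 1)
  rw [pos_one, pos_one]
  omega

theorem not_ascent_rho_succ (m : ℕ) : ¬ Ascent (m : ZMod n) (rho n (m + 1)) := by
  rw [rho, ascent_s_mul_iff]
  exact not_not.2 (ascent_rho_self m)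

theorem length_rho (m : ℕ) : length (rho n m) = m := by
  induction m with
  | zero => exact length_one
  | succ m ih => rw [rho, length_of_ascent (ascent_rho_self m), ih]

/-! ### The structure constants -/

/-- The slice of `twist₂` at ρ_{m+1} involves s_i ρ_{m+1} only for a descent i, that is for i ≡ m,
where this element is ρ_m; ρ_0 = 1 has no descent at all. -/
theorem isPieriRecursion_slices :
    IsPieriRecursion (fun i => actHom (s i)) ep fun (w : W n) m => slices w (rho n m) := by
  classical
  have key : ∀ {i : ZMod n} {w : W n}, Ascent i w → ∀ u,
      root i • slices (s i * w) u = slices w u - (twist (actHom (s i)) (root i) i (slices w u) -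
        if Ascent i u then 0 else root i • twist (actHom (s i)) (root i) i (slices w (s i * u))) := by
    intro i w hi u
    rw [← twist₂_apply]
    exact DFunLike.congr_fun (root_smul_slices hi) u
  refine
    { one_zero := ?_, one_succ := ?_, zero := ?_, succ_of_eq := ?_, succ_of_ne := ?_,
      left := smul_ep_left, right := smul_ep_right, of_ne := smul_ep_of_ne,
      sub_ne_zero := root_ne_zero }
  · rw [slices_one]; exact Finsupp.single_eq_same
  · intro m
    rw [slices_one]
    refine Finsupp.single_eq_of_ne fun e => ?_
    have := length_rho (n := n) (m + 1)
    rw [e, length_one] at this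
    omega
  · intro i w hi
    refine (key hi _).trans ?_
    rw [if_pos (ascent_rho_zero i)]
    exact congrArg _ (sub_zero _)
  · rintro i w hi m rfl
    refine (key hi _).trans ?_
    have e : s (m : ZMod n) * rho n (m + 1) = rho n m := by rw [rho, s_mul_s_mul]
    rw [if_neg (not_ascent_rho_succ m), e]
    exact (sub_add _ _ _).symm
  · intro i w hi m hm
    refine (key hi _).trans ?_
    rw [if_pos (ascent_rho_of_ne (by push_cast; exact fun e => hm (add_right_cancel e).symm))]
    exact congrArg _ (sub_zero _)

theorem structureConst_rho {w u : W n} {i : ℕ} (h : length w = length u + i) :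
    structureConst w (rho n i) u = (Nat.card (StrongStrip w u i) : S n) := by
  rw [← slices_apply]
  exact isPieriRecursion_slices.apply_eq_card w u i h.ge

/-! ### The basis of the nilCoxeter ring -/

section NilCoxeter

variable {E : Type*} [Ring E] {g : ZMod n → E} {a : W n → E}

theorem gen_mul_mem_closure (h : ∀ i w, Ascent i w → g i * a w = a (s i * w))
    (h' : ∀ i w, ¬ Ascent i w → g i * a w = 0) (i : ZMod n) {x : E}
    (hx : x ∈ AddSubgroup.closure (Set.range a)) :
    g i * x ∈ AddSubgroup.closure (Set.range a) := by
  induction hx using AddSubgroup.closure_induction with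
  | mem x hx =>
    obtain ⟨w, rfl⟩ := hx
    by_cases hi : Ascent i w
    · rw [h i w hi]; exact AddSubgroup.subset_closure ⟨_, rfl⟩
    · rw [h' i w hi]; exact zero_mem _
  | zero => rw [mul_zero]; exact zero_mem _
  | add x y _ _ hx hy => rw [mul_add]; exact add_mem hx hy
  | neg x _ hx => rw [mul_neg]; exact neg_mem hx

/-- Building a_w one generator at a time reduces closure under products to left multiplication by
the generators. -/
theorem mul_mem_closure (h1 : a 1 = 1) (h : ∀ i w, Ascent i w → g i * a w = a (s i * w))
    (h' : ∀ i w, ¬ Ascent i w → g i * a w = 0) {x y : E}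
    (hx : x ∈ AddSubgroup.closure (Set.range a)) (hy : y ∈ AddSubgroup.closure (Set.range a)) :
    x * y ∈ AddSubgroup.closure (Set.range a) := by
  induction hx using AddSubgroup.closure_induction with
  | mem x hx =>
    obtain ⟨w, rfl⟩ := hx
    induction w using length_induction with
    | one => rwa [h1, one_mul]
    | step i w hi ih =>
      rw [← h i w hi, mul_assoc]
      exact gen_mul_mem_closure h h' i ih
  | zero => rw [zero_mul]; exact zero_mem _
  | add x z _ _ hx hz => rw [add_mul]; exact add_mem hx hz
  | neg x _ hx => rw [neg_mul]; exact neg_mem hx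

theorem mem_addSubgroup_closure (h1 : a 1 = 1)
    (h : ∀ i w, Ascent i w → g i * a w = a (s i * w))
    (h' : ∀ i w, ¬ Ascent i w → g i * a w = 0) {x : E}
    (hx : x ∈ Subring.closure (Set.range g)) : x ∈ AddSubgroup.closure (Set.range a) := by
  have hone : (1 : E) ∈ AddSubgroup.closure (Set.range a) := by
    rw [← h1]; exact AddSubgroup.subset_closure ⟨_, rfl⟩
  induction hx using Subring.closure_induction with
  | mem x hx =>
    obtain ⟨i, rfl⟩ := hx
    rw [← mul_one (g i)]
    exact gen_mul_mem_closure h h' i hone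
  | zero => exact zero_mem _
  | one => exact hone
  | add x y _ _ hx hy => exact add_mem hx hy
  | neg x _ hx => exact neg_mem hx
  | mul x y _ _ hx hy => exact mul_mem_closure h1 h h' hx hy

theorem span_eq_top_of_relations (h1 : a 1 = 1)
    (h : ∀ i w, Ascent i w → g i * a w = a (s i * w))
    (h' : ∀ i w, ¬ Ascent i w → g i * a w = 0) (ha : ∀ w, a w ∈ Subring.closure (Set.range g)) :
    Submodule.span ℤ (Set.range fun w => (⟨a w, ha w⟩ : Subring.closure (Set.range g))) = ⊤ := by
  have key : ∀ x : E, x ∈ AddSubgroup.closure (Set.range a) →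
      ∃ y ∈ Submodule.span ℤ (Set.range fun w => (⟨a w, ha w⟩ : Subring.closure (Set.range g))),
        (y : E) = x := by
    intro x hx
    induction hx using AddSubgroup.closure_induction with
    | mem x hx =>
      obtain ⟨w, rfl⟩ := hx
      exact ⟨⟨a w, ha w⟩, Submodule.subset_span ⟨w, rfl⟩, rfl⟩
    | zero => exact ⟨0, zero_mem _, rfl⟩
    | add x y _ _ hx hy =>
      obtain ⟨a, ha, rfl⟩ := hx
      obtain ⟨b, hb, rfl⟩ := hy
      exact ⟨a + b, add_mem ha hb, rfl⟩
    | neg x _ hx =>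
      obtain ⟨a, ha, rfl⟩ := hx
      exact ⟨-a, neg_mem ha, rfl⟩
  refine eq_top_iff.2 fun x _ => ?_
  obtain ⟨y, hy, e⟩ := key x (mem_addSubgroup_closure h1 h h' x.2)
  rwa [← Subtype.ext e]

end NilCoxeter

theorem span_A0 : Submodule.span ℤ (Set.range (A0 (n := n))) = ⊤ :=
  span_eq_top_of_relations (g := simpleA (n := n)) (a := A (n := n)) A_one
    (fun _ _ => simpleA_mul_A_of_ascent) (fun _ _ => simpleA_mul_A_of_not_ascent) A_mem

theorem linearIndependent_A0 : LinearIndependent ℤ (A0 (n := n)) := by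
  have hinj : Function.Injective fun r : ℤ => r • (1 : F n) := by
    intro a b h
    simp only [zsmul_eq_mul, mul_one] at h
    have h1 : algebraMap (S n) (F n) (algebraMap ℤ (S n) a) =
        algebraMap (S n) (F n) (algebraMap ℤ (S n) b) := by simpa using h
    exact (SymmetricAlgebra.algebraMap_leftInverse (P n)).injective
      (IsFractionRing.injective (S n) (F n) h1)
  have h := (linearIndependent_A (n := n)).restrict_scalars (R := ℤ) hinj
  exact LinearIndependent.of_comp (nilCoxeter n).subtype.toIntAlgHom.toLinearMap h

/-- The basis `A_w` of the nilCoxeter ring. -/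
def basisA0 (n : ℕ) [n.AtLeastTwo] : Module.Basis (W n) ℤ (nilCoxeter n) :=
  Module.Basis.mk linearIndependent_A0 span_A0.ge

theorem basisA0_apply (w : W n) : basisA0 n w = A0 w := by rw [basisA0, Module.Basis.mk_apply]

theorem eq_constr_iff (f : W n → nilCoxeter n) (D : nilCoxeter n →ₗ[ℤ] nilCoxeter n) :
    (∀ w, D (A0 w) = f w) ↔ D = (basisA0 n).constr ℤ f := by
  constructor
  · intro h
    refine (basisA0 n).ext fun w => ?_
    rw [Module.Basis.constr_basis, basisA0_apply, h]
  · rintro rfl w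
    rw [← basisA0_apply, Module.Basis.constr_basis]

theorem evalZero_natCast (k : ℕ) : evalZero n (k : S n) = k := map_natCast _ k

/-- Strips of length i lower the length by exactly i, so both sums live on the finite set of
elements of length at most ℓ(w); grouping strips by their endpoint turns one into the other. -/
theorem finsum_strips (w : W n) (i : ℕ) :
    ∑ᶠ (v : W n) (_ : length v + length (rho n i) = length w),
        evalZero n (structureConst w (rho n i) v) • A0 v =
      ∑ᶠ x : Σ u : W n, StrongStrip w u i, A0 x.1 := by
  classical
  have hT := finite_length_le (n := n) (length w)
  have : Fintype (Σ u : W n, StrongStrip w u i) := Fintype.ofFinite _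
  have : ∀ u : W n, Fintype (StrongStrip w u i) := fun u => Fintype.ofFinite _
  have hsum : ∑ x : Σ u : W n, StrongStrip w u i, A0 x.1 =
      ∑ v ∈ hT.toFinset, Nat.card (StrongStrip w v i) • A0 v := by
    have huniv : (Finset.univ : Finset (Σ u : W n, StrongStrip w u i)) =
        hT.toFinset.sigma fun _ => Finset.univ := by
      refine (Finset.eq_univ_of_forall fun x => ?_).symm
      have := x.2.length_add
      simp only [Finset.mem_sigma, Set.Finite.mem_toFinset, Finset.mem_univ, and_true]
      change length x.1 ≤ length w
      omega
    rw [huniv, Finset.sum_sigma]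
    refine Finset.sum_congr rfl fun v _ => ?_
    rw [Nat.card_eq_fintype_card, ← Finset.card_univ]
    exact Finset.sum_const (A0 v)
  rw [finsum_eq_sum_of_fintype (fun x : Σ u : W n, StrongStrip w u i => A0 x.1), hsum, length_rho,
    finsum_eq_sum_of_support_subset (s := hT.toFinset)]
  · refine Finset.sum_congr rfl fun v _ => ?_
    rw [finsum_eq_if]
    split_ifs with h
    · rw [structureConst_rho h.symm, evalZero_natCast, natCast_zsmul]
    · have : IsEmpty (StrongStrip w v i) := ⟨fun x => h x.length_add⟩
      rw [Nat.card_of_isEmpty]; exact (zero_nsmul (A0 v)).symm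
  · intro v hv
    rw [Function.mem_support, finsum_eq_if] at hv
    have h : length v + i = length w := by
      by_contra h
      exact hv (if_neg h)
    rw [Set.Finite.coe_toFinset]
    change length v ≤ length w
    omega

theorem isCapOperator_rho_iff {i : ℕ} {D : nilCoxeter n →ₗ[ℤ] nilCoxeter n} :
    IsCapOperator (rho n i) D ↔ IsPieriOperator i D := by
  simp only [IsCapOperator, IsPieriOperator, finsum_strips]

end AffinePieri

end

open AffinePieri in
/-- The affine Pieri rule. -/
theorem theorem1p1 (n : ℕ) [n.AtLeastTwo] :
    (∀ w : W n, ∃! c : W n × W n →₀ S n, IsCoproductExpansion w c) ∧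
    (∀ (w : W n) (i : ℕ), Finite (Σ u : W n, StrongStrip w u i)) ∧
    (∀ (w u : W n) (i : ℕ), length w = length u + i →
      structureConst w (rho n i) u = (Nat.card (StrongStrip w u i) : S n)) ∧
    (∀ i : ℕ, ∃ D : nilCoxeter n →ₗ[ℤ] nilCoxeter n,
      (∀ D', IsCapOperator (rho n i) D' ↔ D' = D) ∧ (∀ D', IsPieriOperator i D' ↔ D' = D)) := by
  refine ⟨fun w => ?_, finite_strongStrip, fun w u i => structureConst_rho, fun i => ?_⟩
  · obtain ⟨c, hc⟩ := exists_expansion w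
    exact ⟨c, hc, fun c' hc' => isCoproductExpansion_unique hc' hc⟩
  · exact ⟨(basisA0 n).constr ℤ fun w => ∑ᶠ x : Σ u : W n, StrongStrip w u i, A0 x.1,
      fun D' => isCapOperator_rho_iff.trans (eq_constr_iff _ D'), fun D' => eq_constr_iff _ D'⟩
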